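/- **Theorem (Recipient privacy and unlinkability).** \label{thm:privacy} *Setting.* Let $(\mathbb{G}_\kappa)_\kappa$ be groups of prime order $q=q_\kappa$ with generator $G$, with publicly known parameters of polynomial size, and with efficiently computable group operations, scalar arithmetic and ECDSA conversion function $\mathrm{conv}:\mathbb{G}\to\mathbb{Z}_q$ (for an elliptic curve, the $x$-coordinate modulo $q$). The hash function into $\mathbb{Z}_q$ is a random oracle $H$, used with domain separation for stealth offsets and for the messages to be signed; $\mathrm{HMAC}$ is any fixed public polynomial-time function whose output consists of two halves of $2\kappa$ bits. *Sender.* The sender $\mathsf{DAO}_1$ has $n_1<q$ members and threshold $t_1\ge 1$; its secret $a$ is Shamir-shared as $(a_i)_{i\in[n_1]}$ by a uniformly random polynomial of degree less than $t_1$, and $A=aG$ is its public key. An honest anonymous transfer to a receiver with parent state $(B,cc)$ under a tag $\mathsf{id}$, with qualified subsets $S_1,T_1\subseteq[n_1]$ of at least $t_1$ members, is as follows. 1. $(\omega,cc')=\mathrm{HMAC}(cc,B\parallel\mathsf{id})$; the child state is $(B',cc')$ with $B'=B+\omega G$ ($\omega$ is read modulo $q$). 2. $\Omega=\sum_{i\in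 S_1}\lambda_{i,S_1}(a_iB')$ with Lagrange coefficients $\lambda_{i,S_1}$, $\xi$ is uniform in $\{0,1\}^{2\kappa}$, $\rho=H(\Omega\parallel\xi)$ and $D=B'+\rho G$. 3. $m$ is the payment transaction with recipient field $D$. The members in $T_1$ sign $m$ by threshold ECDSA: $e=H(m)$, $k\in\mathbb{Z}_q^*$ is uniform, $r=\mathrm{conv}(kG)$, $s=k^{-1}\bigl(e+r\sum_{i\in T_1}\lambda_{i,T_1}a_i\bigr)$, and $\sigma=(r,s)$ (no signature if $r=0$ or $s=0$). The public chain transcript is $\tau=(m,\sigma,D,\mathsf{id},\xi)$; nothing else of the session is revealed. *Adversary.* There are $N(\kappa)$ honest receiver DAOs, $N$ a polynomial, with master public keys $B_i=b_iG$, where the $b_i$ are independent and uniform. A two-phase probabilistic polynomial-time adversary with oracle access to $H$ is given the public parameters, $A$ and all $B_i$. A parent state chosen by it is a pair $(B_i+\tau G,cc)$ with an index $i$, an offset $\tau\in\mathbb{Z}_q$ and a chain code $cc\in\{0,1\}^{2\kappa}$ of its choice (so every state that an honest receiver reaches by key derivation can be chosen). It corrupts nobody. An adversary that makes no valid choice is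 counted as guessing $0$ in experiment (i) and "different" in experiment (ii). *Claim.* Assume that the DDH problem is hard in $(\mathbb{G}_\kappa)$ for probabilistic polynomial-time algorithms. Then for every such adversary the following holds. (i) *(Recipient privacy.)* The adversary chooses two parent states $st_0,st_1$ and all fields of the payment transaction other than the recipient. The challenger samples a uniform bit $b$ and a uniform tag $\mathsf{id}\in\{0,1\}^{2\kappa}$, runs an honest anonymous transfer to $st_b$, and returns only its public chain transcript; the adversary outputs a guess $b'$. Then $\left|\Pr[b'=b]-\tfrac12\right|$ is negligible in $\kappa$. (ii) *(Unlinkability.)* The adversary chooses parent states $st_0,st_1$ of two receivers, for each of them a list of tags, and the fields other than the recipient of two payment transactions. The challenger samples independent uniform bits $b_1,b_2$. It runs an honest anonymous transfer under a uniform tag to receiver $b_1$, whose state then moves on to the child state; both states are then advanced by key derivation along the chosen lists of tags (intermediate transfers); then it runs a second honest anonymous transfer under a uniform tag to the current state of receiver $b_2$, possibly with other qualified sender-side subsets. Given only the two public chain transcripts, the adversary guesses whether the receiver was the same, that is, whether $b_1=b_2$. Then $\left|\Pr[\text{the guess is correct}]-\tfrac12\right|$ is negligible in $\kappa$. -/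

import Mathlib

namespace Dao2

/-! ### Data, programs, running time -/

/-- The data on which programs run: binary trees. -/
inductive Data : Type
  | nil : Data
  | node : Data → Data → Data
  deriving DecidableEq

namespace Data

/-- Number of nodes of a tree. -/
def size : Data → ℕ
  | nil => 1
  | node l r => l.size + r.size + 1

def left : Data → Data
  | nil => nil
  | node l _ => l

def right : Data → Data
  | nil => nil
  | node _ r => r

/-- A tree is read as the list of the left sons along its right spine. -/
def toList : Data → List Data
  | nil => []
  | node l r => l :: r.toList

def ofList : List Data → Data
  | [] => nil
  | d :: l => node d (ofList l)

/-- Length of the list that a tree stands for. -/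
def len (d : Data) : ℕ := d.toList.length

/-- `i`-th entry of the list that a tree stands for (`nil` if there is none). -/
def nth (d : Data) (i : ℕ) : Data := d.toList.getD i nil

def ofBool (b : Bool) : Data := if b then node nil nil else nil

/-- Every nonempty tree counts as `true`. -/
def toBool (d : Data) : Bool := decide (d ≠ nil)

/-- The unary numeral `1ⁿ`. -/
def unary (n : ℕ) : Data := ofList (List.replicate n nil)

/-- The natural number with a given binary expansion, least significant bit first. -/
def toNat : Data → ℕ
  | nil => 0
  | node l r => (if l = nil then 0 else 1) + 2 * r.toNat

/-- The binary numeral of `n`, least significant bit first. -/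
def ofNat (n : ℕ) : Data := ofList (n.bits.map ofBool)

end Data

/-- Programs: a loop language on trees. -/
inductive Prog : Type
  | id : Prog
  | nil : Prog
  | left : Prog
  | right : Prog
  /-- on `node x y`: are `x` and `y` equal? -/
  | eq : Prog
  /-- run both programs on the input and pair the results -/
  | pair : Prog → Prog → Prog
  /-- `comp g f` runs `f`, then `g` on its result -/
  | comp : Prog → Prog → Prog
  /-- `ite c f g` runs `f` if the result of `c` is not `nil`, and `g` otherwise -/
  | ite : Prog → Prog → Prog → Prog
  /-- `loop f` on `node c x`: apply `f` to `x` as many times as the list `c` is long -/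
  | loop : Prog → Prog

namespace Prog

/-- The result of a program. -/
def eval : Prog → Data → Data
  | id, x => x
  | nil, _ => .nil
  | left, x => x.left
  | right, x => x.right
  | eq, x => .ofBool (decide (x.left = x.right))
  | pair f g, x => .node (f.eval x) (g.eval x)
  | comp g f, x => g.eval (f.eval x)
  | ite c f g, x => if c.eval x = .nil then g.eval x else f.eval x
  | loop f, x => f.eval^[x.left.len] x.right

/-- The number of steps of a program. A primitive operation is charged the size of the tree it
reads, and a constant; a loop is charged for all its rounds. -/
def time : Prog → Data → ℕ
  | id, x => x.size + 1
  | nil, _ => 1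
  | left, x => x.size + 1
  | right, x => x.size + 1
  | eq, x => x.size + 2
  | pair f g, x => f.time x + g.time x + 1
  | comp g f, x => f.time x + g.time (f.eval x) + 1
  | ite c f g, x => c.time x + (if c.eval x = .nil then g.time x else f.time x) + 1
  | loop f, x => x.size + 1 + ∑ i ∈ Finset.range x.left.len, f.time (f.eval^[i] x.right)

/-- The program runs in time polynomial in the size of its input. -/
def IsPolyTime (p : Prog) : Prop :=
  ∃ P : Polynomial ℕ, ∀ x : Data, p.time x ≤ P.eval x.size

end Prog

/-- Negligible functions of the security parameter. -/
def Negligible (f : ℕ → ℝ) : Prop :=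
  Asymptotics.SuperpolynomialDecay Filter.atTop (fun κ : ℕ => (κ : ℝ)) f

/-- Bit strings of length `n`. -/
abbrev Bits (n : ℕ) : Type := Fin n → Bool

def Bits.enc {n : ℕ} (x : Bits n) : Data := .ofList ((List.ofFn x).map .ofBool)

/-- Read a bit string of length `n` off a tree: cut off, or padded with zeros, to length `n`. -/
def Bits.dec (n : ℕ) (d : Data) : Bits n := fun i => (d.nth i).toBool

/-! ### Groups of prime order, with efficient arithmetic -/

/-- Scalars are written in binary. -/
def encScalar {q : ℕ} (x : ZMod q) : Data := .ofNat x.val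

/-- A function with parameter `par κ` that a program computes in polynomial time from (encodings
of) the parameter and the argument. -/
def Efficient (par : ℕ → Data) {α β : ℕ → Type} (ea : ∀ κ, α κ → Data) (eb : ∀ κ, β κ → Data)
    (f : ∀ κ, α κ → β κ) : Prop :=
  ∃ p : Prog, p.IsPolyTime ∧ ∀ κ (x : α κ), p.eval (.node (par κ) (ea κ x)) = eb κ (f κ x)

/-- A family of groups of prime order, indexed by the security parameter, with public parameters
`pp κ` of polynomial size (for instance the curve and its order), generators, and an encoding
of the group elements with respect to which the group law, scalar multiplication and the
arithmetic of scalars are efficient. `conv` is the conversion function from group elements to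
scalars that ECDSA uses (for an elliptic curve: the `x`-coordinate modulo `q`). -/
structure GroupFamily where
  G : ℕ → Type
  [grp : ∀ κ, AddCommGroup (G κ)]
  q : ℕ → ℕ
  prime : ∀ κ, (q κ).Prime
  card_eq : ∀ κ, Nat.card (G κ) = q κ
  gen : ∀ κ, G κ
  gen_ne : ∀ κ, gen κ ≠ 0
  enc : ∀ κ, G κ → Data
  enc_injective : ∀ κ, Function.Injective (enc κ)
  conv : ∀ κ, G κ → ZMod (q κ)
  pp : ℕ → Data
  size_pp : ∃ P : Polynomial ℕ, ∀ κ, (pp κ).size ≤ P.eval κ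
  size_enc : ∃ P : Polynomial ℕ, ∀ κ x, (enc κ x).size ≤ P.eval κ
  gen_eff : Efficient (fun κ => .node (.unary κ) (pp κ))
    (α := fun _ => Unit) (fun _ _ => .nil) enc (fun κ _ => gen κ)
  order_eff : Efficient (fun κ => .node (.unary κ) (pp κ))
    (α := fun _ => Unit) (β := fun _ => ℕ) (fun _ _ => .nil) (fun _ => .ofNat) (fun κ _ => q κ)
  add_eff : Efficient (fun κ => .node (.unary κ) (pp κ))
    (α := fun κ => G κ × G κ) (fun κ x => .node (enc κ x.1) (enc κ x.2)) enc
    (fun _ x => x.1 + x.2)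
  smul_eff : Efficient (fun κ => .node (.unary κ) (pp κ))
    (α := fun κ => ZMod (q κ) × G κ) (fun κ x => .node (encScalar x.1) (enc κ x.2)) enc
    (fun _ x => x.1.val • x.2)
  conv_eff : Efficient (fun κ => .node (.unary κ) (pp κ)) enc (fun _ => encScalar) conv
  scalar_add_eff : Efficient (fun κ => .node (.unary κ) (pp κ))
    (α := fun κ => ZMod (q κ) × ZMod (q κ)) (β := fun κ => ZMod (q κ))
    (fun _ x => .node (encScalar x.1) (encScalar x.2)) (fun _ => encScalar) (fun _ x => x.1 + x.2)
  scalar_mul_eff : Efficient (fun κ => .node (.unary κ) (pp κ))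
    (α := fun κ => ZMod (q κ) × ZMod (q κ)) (β := fun κ => ZMod (q κ))
    (fun _ x => .node (encScalar x.1) (encScalar x.2)) (fun _ => encScalar) (fun _ x => x.1 * x.2)
  scalar_inv_eff : Efficient (fun κ => .node (.unary κ) (pp κ))
    (α := fun κ => ZMod (q κ)) (β := fun κ => ZMod (q κ))
    (fun _ => encScalar) (fun _ => encScalar) (fun _ x => x⁻¹)
  scalar_reduce_eff : Efficient (fun κ => .node (.unary κ) (pp κ))
    (α := fun _ => Data) (β := fun κ => ZMod (q κ))
    (fun _ d => d) (fun _ => encScalar) (fun _ d => (d.toNat : ZMod (q _)))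

namespace GroupFamily

variable (F : GroupFamily)

instance instGrp (κ : ℕ) : AddCommGroup (F.G κ) := F.grp κ

instance instFact (κ : ℕ) : Fact (F.q κ).Prime := ⟨F.prime κ⟩

/-- Scalars modulo the group order. -/
abbrev Scalar (κ : ℕ) : Type := ZMod (F.q κ)

/-- The public parameters, together with the security parameter in unary. -/
def par (κ : ℕ) : Data := .node (.unary κ) (F.pp κ)

/-- The multiple `x P` of a group element. -/
def mul {F : GroupFamily} {κ : ℕ} (x : F.Scalar κ) (P : F.G κ) : F.G κ := x.val • P

/-- The multiple `x G` of the generator. -/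
def base {κ : ℕ} (x : F.Scalar κ) : F.G κ := mul x (F.gen κ)

end GroupFamily

/-! ### The decisional Diffie-Hellman assumption -/

/-- A probabilistic polynomial-time algorithm without oracle; its random tape is uniform of
polynomial length. -/
structure Distinguisher where
  prog : Prog
  coinLen : Polynomial ℕ
  poly : prog.IsPolyTime

noncomputable section

/-- The uniform distribution on a finite type. -/
def unif (α : Type) [Fintype α] [Nonempty α] : PMF α := PMF.uniformOfFintype α

/-- The probability that a random bit is `true`. -/
def prTrue (p : PMF Bool) : ℝ := (p true).toReal

def Distinguisher.run (𝒟 : Distinguisher) (F : GroupFamily) (κ : ℕ) (X Y Z : F.G κ) :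
    PMF Bool := do
  let coins ← unif (Bits (𝒟.coinLen.eval κ))
  return (𝒟.prog.eval (.ofList
    [F.par κ, F.enc κ X, F.enc κ Y, F.enc κ Z, coins.enc])).toBool

def ddhReal (F : GroupFamily) (𝒟 : Distinguisher) (κ : ℕ) : PMF Bool := do
  let x ← unif (F.Scalar κ)
  let y ← unif (F.Scalar κ)
  𝒟.run F κ (F.base x) (F.base y) (F.base (x * y))

def ddhRandom (F : GroupFamily) (𝒟 : Distinguisher) (κ : ℕ) : PMF Bool := do
  let x ← unif (F.Scalar κ)
  let y ← unif (F.Scalar κ)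
  let z ← unif (F.Scalar κ)
  𝒟.run F κ (F.base x) (F.base y) (F.base z)

def DDH (F : GroupFamily) : Prop :=
  ∀ 𝒟 : Distinguisher,
    Negligible fun κ => |prTrue (ddhReal F 𝒟 κ) - prTrue (ddhRandom F 𝒟 κ)|

/-! ### The random oracle, and adversaries with access to it -/

/-- Randomized computations with a random oracle from trees to scalars, sampled lazily: the state
holds the values of the oracle that are already determined. -/
abbrev ROM (q : ℕ) : Type → Type := StateT (List (Data × ZMod q)) PMF

namespace ROM

variable {q : ℕ} [Fact q.Prime]

def sample (α : Type) [Fintype α] [Nonempty α] : ROM q α := StateT.lift (unif α)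

/-- The value of the random oracle at `d`. -/
def hash (d : Data) : ROM q (ZMod q) := do
  let table ← get
  match table.lookup d with
  | some v => return v
  | none =>
    let v ← sample (ZMod q)
    set ((d, v) :: table)
    return v

/-- The random oracle at `Ω ‖ ξ`, where it derives stealth offsets. -/
def hashStealth (Ω ξ : Data) : ROM q (ZMod q) := hash (.node .nil (.node Ω ξ))

/-- The random oracle at a message to be signed; the tag separates this use from the other. -/
def hashMsg (m : Data) : ROM q (ZMod q) := hash (.node (.node .nil .nil) m)

/-- Run an oracle algorithm, given by the program that computes its next action from its input and
the list of the oracle's answers so far (the last one first). An action `node nil out` halts with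
output `out`, and an action `node (node _ _) d` asks the oracle for its value at `d`. The algorithm
makes at most as many queries as its budget (the first argument) allows. -/
def runAlg (p : Prog) (input : Data) : ℕ → Data → ROM q Data
  | budget, answers =>
    match p.eval (.node input answers) with
    | .nil => return .nil
    | .node .nil out => return out
    | .node (.node _ _) d =>
      match budget with
      | 0 => return .nil
      | n + 1 => do
        let v ← hash d
        runAlg p input n (.node (encScalar v) answers)

end ROM

/-- A probabilistic polynomial-time adversary with a random oracle, in two phases: `choose` makes
its choices before the challenge, and `guess` its guess after it. The programs compute
the next action of the adversary, in polynomial time. The number of queries in each phase and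
the length of the random tape are polynomial in the security parameter. -/
structure Adversary where
  choose : Prog
  guess : Prog
  coinLen : Polynomial ℕ
  queries : Polynomial ℕ
  choose_poly : choose.IsPolyTime
  guess_poly : guess.IsPolyTime

/-! ### The protocol -/

/-- The keyed hash of key derivation: key and message to two half outputs (for HMAC-SHA512
`2κ = 256` bits each). It is some fixed public function, computable in polynomial time. -/
structure Hmac (F : GroupFamily) where
  fn : ∀ κ, Bits (2 * κ) × Data → Bits (2 * κ) × Bits (2 * κ)
  eff : Efficient F.par (α := fun κ => Bits (2 * κ) × Data)
    (β := fun κ => Bits (2 * κ) × Bits (2 * κ))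
    (fun _ x => .node (Bits.enc x.1) x.2) (fun _ y => .node (Bits.enc y.1) (Bits.enc y.2)) fn

/-- The public derivation state of a receiver: public key and chain code. -/
abbrev PubState (F : GroupFamily) (κ : ℕ) : Type := F.G κ × Bits (2 * κ)

/-- One step of distributed key derivation, on public states:
`(ω, cc') = HMAC(cc, B ‖ id)`, and the child state is `(B + ω G, cc')`. -/
def Hmac.derive {F : GroupFamily} (hm : Hmac F) {κ : ℕ} (st : PubState F κ) (tag : Bits (2 * κ)) :
    PubState F κ :=
  let I := hm.fn κ (st.2, .node (F.enc κ st.1) tag.enc)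
  (st.1 + F.base ((Bits.enc I.1).toNat : F.Scalar κ), I.2)

/-- Derivation along a list of tags. -/
def Hmac.deriveAll {F : GroupFamily} (hm : Hmac F) {κ : ℕ} (st : PubState F κ)
    (tags : List (Bits (2 * κ))) : PubState F κ :=
  tags.foldl hm.derive st

/-- Lagrange coefficient at `0` of the index `i` in `S`. -/
def lagrange {q : ℕ} (S : Finset ℕ) (i : ℕ) : ZMod q :=
  ∏ j ∈ S.erase i, (j : ZMod q) * ((j : ZMod q) - (i : ZMod q))⁻¹

/-- The share of party `i` in Shamir's scheme: the polynomial with coefficients `c`, at `i`. -/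
def share {q t : ℕ} (c : Fin t → ZMod q) (i : ℕ) : ZMod q :=
  ∑ l : Fin t, c l * (i : ZMod q) ^ (l : ℕ)

/-- The sending organization: `n κ` members with indices `1, …, n κ`, and threshold `t κ`. -/
structure SenderDAO (F : GroupFamily) where
  n : ℕ → ℕ
  t : ℕ → ℕ
  t_pos : ∀ κ, 0 < t κ
  n_lt : ∀ κ, n κ < F.q κ

/-- The qualified sender-side subsets of a session: `S` generates the destination, `T` signs. -/
structure Quorum {F : GroupFamily} (dao : SenderDAO F) where
  S : ℕ → Finset ℕ
  T : ℕ → Finset ℕ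
  S_subset : ∀ κ, S κ ⊆ Finset.Icc 1 (dao.n κ)
  T_subset : ∀ κ, T κ ⊆ Finset.Icc 1 (dao.n κ)
  le_card_S : ∀ κ, dao.t κ ≤ (S κ).card
  le_card_T : ∀ κ, dao.t κ ≤ (T κ).card

/-- The sender's secret sharing polynomial, as honest key generation chooses it. -/
abbrev SenderDAO.Secret {F : GroupFamily} (dao : SenderDAO F) (κ : ℕ) : Type :=
  Fin (dao.t κ) → F.Scalar κ

/-- The sender's public key `A = a G`, where the secret `a` is the value at `0` of the sharing
polynomial. -/
def SenderDAO.publicKey {F : GroupFamily} (dao : SenderDAO F) {κ : ℕ} (c : dao.Secret κ) :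
    F.G κ :=
  F.base (share c 0)

/-- Threshold ECDSA signing by the members in `T` with their shares, with joint nonce `k`: for
`e = H(m)`, `R = k G` and `r = conv R`, the partial signatures `k⁻¹ r λᵢ xᵢ` are added up to
`s = k⁻¹ (e + r ∑ᵢ λᵢ xᵢ)`. The protocol aborts without a signature if `r = 0` or `s = 0`. -/
def thresholdSign {F : GroupFamily} {κ : ℕ} (T : Finset ℕ) (x : ℕ → F.Scalar κ) (m : Data) :
    ROM (F.q κ) (Option (F.Scalar κ × F.Scalar κ)) := do
  let e ← ROM.hashMsg m
  let k ← ROM.sample (F.Scalar κ)ˣ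
  let kinv : F.Scalar κ := ((k⁻¹ : (F.Scalar κ)ˣ) : F.Scalar κ)
  let r := F.conv κ (F.base (k : F.Scalar κ))
  let s := kinv * e + ∑ i ∈ T, kinv * r * lagrange T i * x i
  return if r = 0 ∨ s = 0 then none else some (r, s)

/-- Distributed shared secret: `Ω = ∑ᵢ λᵢ Ωᵢ` with `Ωᵢ = aᵢ B`, over the members in `S`. -/
def sharedSecret {F : GroupFamily} {κ : ℕ} (S : Finset ℕ) (x : ℕ → F.Scalar κ) (B : F.G κ) :
    F.G κ :=
  ∑ i ∈ S, GroupFamily.mul (lagrange S i) (GroupFamily.mul (x i) B)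

/-- The sender's part of an honest anonymous transfer to the child key `B` with tag `tag`; `pay`
holds all fields of the payment transaction other than the recipient. The result is the public
chain transcript `(m, σ, D, id, ξ)`. -/
def session {F : GroupFamily} {dao : SenderDAO F} (Q : Quorum dao) {κ : ℕ} (c : dao.Secret κ)
    (B : F.G κ) (tag : Bits (2 * κ)) (pay : Data) : ROM (F.q κ) Data := do
  let Ω := sharedSecret (Q.S κ) (share c) B
  let ξ ← ROM.sample (Bits (2 * κ))
  let ρ ← ROM.hashStealth (F.enc κ Ω) ξ.enc
  let D := B + F.base ρ
  let m : Data := .node pay (F.enc κ D)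
  let σ ← thresholdSign (Q.T κ) (share c) m
  let σd : Data := match σ with
    | none => .nil
    | some (r, s) => .node (encScalar r) (encScalar s)
  return .ofList [m, σd, F.enc κ D, tag.enc, ξ.enc]

/-! ### The experiments -/

/-- A parent state chosen by the adversary, given as a list of an index `i` in unary,
an offset `τ` in binary and a chain code `cc`: the state is `(Bᵢ + τ G, cc)`, where `Bᵢ` is the
master public key of the `i`-th honest receiver. -/
def parseState {F : GroupFamily} {κ N : ℕ} (keys : Fin N → F.G κ) (d : Data) :
    Option (PubState F κ) :=
  if h : (d.nth 0).len < N then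
    some (keys ⟨(d.nth 0).len, h⟩ + F.base ((d.nth 1).toNat : F.Scalar κ),
      Bits.dec (2 * κ) (d.nth 2))
  else none

/-- What the adversary knows from the start: the public parameters, its random tape, the sender's
public key and the master public keys of the honest receivers. -/
def initialView {F : GroupFamily} {κ N n : ℕ} (coins : Bits n) (A : F.G κ)
    (keys : Fin N → F.G κ) : Data :=
  .ofList [F.par κ, coins.enc, F.enc κ A, .ofList ((List.ofFn keys).map (F.enc κ))]

/-- The privacy experiment with `N κ` honest receivers. The adversary's choice is a list
`[st, st₀, st₁, pay]` of an auxiliary state, the two candidate parent states and the other fields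
of the payment transaction; an adversary that does not choose two states guesses `false`.
The result is `true` if the guess is correct. -/
def privExp {F : GroupFamily} (hm : Hmac F) {dao : SenderDAO F} (Q : Quorum dao)
    (N : Polynomial ℕ) (𝒜 : Adversary) (κ : ℕ) : PMF Bool :=
  let game : ROM (F.q κ) Bool := do
    let c ← ROM.sample (dao.Secret κ)
    let y ← ROM.sample (Fin (N.eval κ) → F.Scalar κ)
    let keys := fun i => F.base (y i)
    let coins ← ROM.sample (Bits (𝒜.coinLen.eval κ))
    let view := initialView coins (dao.publicKey c) keys
    let choice ← ROM.runAlg 𝒜.choose view (𝒜.queries.eval κ) .nil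
    let b ← ROM.sample Bool
    match parseState keys (choice.nth 1), parseState keys (choice.nth 2) with
    | some st₀, some st₁ =>
      let tag ← ROM.sample (Bits (2 * κ))
      let child := hm.derive (if b then st₁ else st₀) tag
      let τ ← session Q c child.1 tag (choice.nth 3)
      let out ← ROM.runAlg 𝒜.guess (.ofList [view, choice.nth 0, τ]) (𝒜.queries.eval κ) .nil
      return (out.toBool == b)
    | _, _ => return (false == b)
  Prod.fst <$> game.run []

/-- The unlinkability experiment with `N κ` honest receivers. The adversary's choice is a list
`[st, st₀, st₁, mid₀, mid₁, pay₁, pay₂]`: an auxiliary state, current parent states of two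
receivers, two lists of tags, and the other fields of two payment transactions. In the first session
the receiver `b₁` is paid, and its state moves on to the child state; then both receivers derive
along their lists of tags (transfers between the two sessions); in the second session the receiver
`b₂` is paid. From the two transcripts the adversary guesses whether `b₁ = b₂`.
(Adversaries that pick the same receiver twice are allowed, too.) The result is `true` if the guess is correct. -/
def unlinkExp {F : GroupFamily} (hm : Hmac F) {dao : SenderDAO F} (Q₁ Q₂ : Quorum dao)
    (N : Polynomial ℕ) (𝒜 : Adversary) (κ : ℕ) : PMF Bool :=
  let game : ROM (F.q κ) Bool := do
    let c ← ROM.sample (dao.Secret κ)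
    let y ← ROM.sample (Fin (N.eval κ) → F.Scalar κ)
    let keys := fun i => F.base (y i)
    let coins ← ROM.sample (Bits (𝒜.coinLen.eval κ))
    let view := initialView coins (dao.publicKey c) keys
    let choice ← ROM.runAlg 𝒜.choose view (𝒜.queries.eval κ) .nil
    let b₁ ← ROM.sample Bool
    let b₂ ← ROM.sample Bool
    match parseState keys (choice.nth 1), parseState keys (choice.nth 2) with
    | some st₀, some st₁ =>
      let start : Bool → PubState F κ := fun b => if b then st₁ else st₀
      let mid : Bool → List (Bits (2 * κ)) := fun b =>
        (choice.nth (if b then 4 else 3)).toList.map (Bits.dec (2 * κ))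
      let tag₁ ← ROM.sample (Bits (2 * κ))
      let child₁ := hm.derive (start b₁) tag₁
      let τ₁ ← session Q₁ c child₁.1 tag₁ (choice.nth 5)
      let current : Bool → PubState F κ := fun b =>
        hm.deriveAll (if b = b₁ then child₁ else start b) (mid b)
      let tag₂ ← ROM.sample (Bits (2 * κ))
      let child₂ := hm.derive (current b₂) tag₂
      let τ₂ ← session Q₂ c child₂.1 tag₂ (choice.nth 6)
      let out ← ROM.runAlg 𝒜.guess (.ofList [view, choice.nth 0, τ₁, τ₂])
        (𝒜.queries.eval κ) .nil
      return (out.toBool == (b₁ == b₂))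
    | _, _ => return (false == (b₁ == b₂))
  Prod.fst <$> game.run []

end

end Dao2

/-!
The sender's secret `a` enters a session in two places, the shared secret `Ω = a B'` behind the
stealth offset and the signature, and both can be simulated from a triple `(A, Y, Z)` of group
elements with `A = a G`. The experiments are rewritten in this way, so that under DDH the entry
`Z = a Y` may be replaced by a random point.

*Signature.* The nonce point is chosen as `u G + v A` with random scalars `u` and `v`, the
signature is `(r, s)` with `r = conv (u G + v A)` and `s = r / v`, and the oracle is programmed to
the value `u s` at the signed message. For a fixed nonce `k = u + v a` the map from the oracle
value to `v` is a bijection where `s ≠ 0`, if `r ≠ 0`, so the result is `2 / q`-close to honest signing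
(`within_signature`).

*Stealth offset.* All receivers' keys are written as offsets from one uniform point `Y`, and key
derivation is an operation on offsets that does not need discrete logarithms of the keys. For a
receiver with offset `x` the shared secret is `a (Y + x G) = Z + x A`. Lagrange interpolation
reduces the sender's quorums to the secret (`sum_lagrange_mul_share`).

Both oracle values of a session are fresh, up to a small error: `ξ` is uniform, so the stealth
query is new, and the message contains the destination `D = B' + ρ G` with `ρ` uniform, so the
signed message is new (`Within.expect_hash`, `within_session`). Hence the experiments are close to
the games `simPriv` and `simUnlink` on a Diffie-Hellman triple (`within_privExp`,
`within_unlinkExp`).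

On a triple with a random `Z`, the shared secrets are uniform and occur only in the oracle table,
at points that the adversary's second phase does not query, except with probability at most the
number of its queries divided by `q`, for each session (`within_runTape_of_hidden`). Without these
entries `ρ` is used only in `D`, so that `D` is uniform whoever the receiver is, and the guess is
independent of the challenger's bits (`within_simPriv_random`, `within_simUnlink_random`).

The simulated games are played by a distinguisher that is an actual program of the loop language.
`PolyTime` is the class of functions that programs compute in polynomial time; it is closed under
composition, case distinction and loops over states of polynomial size, which carries the protocol
steps, the interpreter `runD` of oracle algorithms, and the games. Scalars are sampled from coins by
reducing a number with `κ` more bits than `q` (`Sampleable.scalar`), and `exists_distinguisher` puts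
these together.

The errors are multiples of `1 / q` and `1 / 2 ^ κ`. That `1 / q` is negligible is itself a
consequence of DDH: accepting exactly the triples `(0, Y, 0)` has advantage `1 / q - 1 / q ^ 2`
(`DDH.negligible_inv_q`).
-/

namespace Dao2

noncomputable section

open scoped ENNReal

/-! ### Expectations of finite randomness -/

section Expectation

variable {α β γ : Type}

/-- The expectation of a nonnegative function. -/
def expect (p : PMF α) (f : α → ℝ≥0∞) : ℝ≥0∞ := ∑' a, p a * f a

@[simp] lemma expect_pure (a : α) (f : α → ℝ≥0∞) : expect (pure a) f = f a := by
  classical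
  unfold expect
  rw [tsum_eq_single a]
  · show PMF.pure a a * _ = _
    simp [PMF.pure_apply]
  · intro b hb
    show PMF.pure a b * _ = _
    simp [PMF.pure_apply, hb]

lemma expect_bind (p : PMF α) (k : α → PMF β) (f : β → ℝ≥0∞) :
    expect (p >>= k) f = expect p fun a => expect (k a) f := by
  unfold expect
  show ∑' b, (p.bind k) b * f b = _
  simp only [PMF.bind_apply, ← ENNReal.tsum_mul_right, ← ENNReal.tsum_mul_left]
  rw [ENNReal.tsum_comm]
  simp only [mul_assoc]

lemma expect_map (p : PMF α) (g : α → β) (f : β → ℝ≥0∞) :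
    expect (g <$> p) f = expect p fun a => f (g a) := by
  have : g <$> p = p >>= fun a => pure (g a) := by rw [map_eq_pure_bind]
  rw [this, expect_bind]
  simp

@[simp] lemma expect_const (p : PMF α) (c : ℝ≥0∞) : (expect p fun _ => c) = c := by
  unfold expect
  rw [ENNReal.tsum_mul_right, p.tsum_coe, one_mul]

lemma expect_mono_support {p : PMF α} {f g : α → ℝ≥0∞} (h : ∀ a ∈ p.support, f a ≤ g a) :
    expect p f ≤ expect p g := by
  refine ENNReal.tsum_le_tsum fun a => ?_
  by_cases ha : a ∈ p.support
  · gcongr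
    exact h a ha
  · rw [PMF.mem_support_iff, not_not] at ha
    simp [ha]

lemma expect_mono {p : PMF α} {f g : α → ℝ≥0∞} (h : ∀ a, f a ≤ g a) :
    expect p f ≤ expect p g := expect_mono_support fun a _ => h a

lemma expect_le_one {p : PMF α} {f : α → ℝ≥0∞} (h : ∀ a, f a ≤ 1) : expect p f ≤ 1 :=
  (expect_mono h).trans_eq (expect_const p 1)

lemma expect_add (p : PMF α) (f g : α → ℝ≥0∞) :
    (expect p fun a => f a + g a) = expect p f + expect p g := by
  unfold expect
  simp only [mul_add, ENNReal.tsum_add]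

lemma expect_comm (p : PMF α) (q : PMF β) (f : α → β → ℝ≥0∞) :
    (expect p fun a => expect q fun b => f a b) = expect q fun b => expect p fun a => f a b := by
  unfold expect
  simp only [← ENNReal.tsum_mul_left]
  rw [ENNReal.tsum_comm]
  refine tsum_congr fun b => tsum_congr fun a => ?_
  ring

lemma expect_unif [Fintype α] [Nonempty α] (f : α → ℝ≥0∞) :
    expect (unif α) f = (Fintype.card α : ℝ≥0∞)⁻¹ * ∑ a, f a := by
  unfold expect unif
  rw [tsum_fintype, Finset.mul_sum]
  simp

lemma expect_unif_equiv [Fintype α] [Nonempty α] [Fintype β] [Nonempty β] (e : α ≃ β)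
    (f : β → ℝ≥0∞) : (expect (unif α) fun a => f (e a)) = expect (unif β) f := by
  rw [expect_unif, expect_unif, Fintype.card_congr e, e.sum_comp]

lemma expect_unif_prod [Fintype α] [Nonempty α] [Fintype β] [Nonempty β] (f : α × β → ℝ≥0∞) :
    expect (unif (α × β)) f = expect (unif α) fun a => expect (unif β) fun b => f (a, b) := by
  simp only [expect_unif, Fintype.card_prod, Fintype.sum_prod_type, Nat.cast_mul]
  rw [ENNReal.mul_inv (by simp) (by simp), ← Finset.mul_sum, mul_assoc]

lemma expect_unif_fin_succ [Fintype α] [Nonempty α] (n : ℕ) (f : (Fin (n + 1) → α) → ℝ≥0∞) :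
    expect (unif (Fin (n + 1) → α)) f =
      expect (unif α) fun a => expect (unif (Fin n → α)) fun x => f (Fin.cons a x) := by
  rw [← expect_unif_equiv (Fin.consEquiv fun _ => α), expect_unif_prod]
  rfl

/-- The indicator of truth. -/
def ind (b : Bool) : ℝ≥0∞ := if b then 1 else 0

lemma ind_le_one (b : Bool) : ind b ≤ 1 := by cases b <;> simp [ind]

lemma prTrue_eq_expect (p : PMF Bool) : prTrue p = (expect p ind).toReal := by
  unfold prTrue expect
  rw [tsum_fintype]
  simp [ind]

/-- A guess that does not depend on a uniform bit matches it with probability `1 / 2`. -/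
lemma expect_ind_beq_bool (c : Bool) : (expect (unif Bool) fun b => ind (c == b)) = 2⁻¹ := by
  rw [expect_unif]
  cases c <;> simp [ind]

/-! ### Numbers that differ by a bounded amount -/

/-- Two extended nonnegative reals differ by at most `ε`. -/
def Within (ε x y : ℝ≥0∞) : Prop := x ≤ y + ε ∧ y ≤ x + ε

namespace Within

variable {ε δ x y z : ℝ≥0∞}

lemma refl (ε x : ℝ≥0∞) : Within ε x x := ⟨le_self_add, le_self_add⟩

lemma of_eq (h : x = y) : Within ε x y := h ▸ refl _ _

lemma symm (h : Within ε x y) : Within ε y x := ⟨h.2, h.1⟩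

lemma trans (h : Within ε x y) (h' : Within δ y z) : Within (ε + δ) x z :=
  ⟨h.1.trans (by rw [add_comm ε, ← add_assoc]; gcongr; exact h'.1),
    h'.2.trans (by rw [← add_assoc]; gcongr; exact h.2)⟩

lemma mono (h : Within ε x y) (hε : ε ≤ δ) : Within δ x y :=
  ⟨h.1.trans (by gcongr), h.2.trans (by gcongr)⟩

lemma of_le_one (hx : x ≤ 1) (hy : y ≤ 1) : Within 1 x y :=
  ⟨hx.trans le_add_self, hy.trans le_add_self⟩

lemma expect {p : PMF α} {f g ε : α → ℝ≥0∞} (h : ∀ a ∈ p.support, Within (ε a) (f a) (g a)) :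
    Within (expect p ε) (expect p f) (expect p g) :=
  ⟨(expect_mono_support fun a ha => (h a ha).1).trans_eq (expect_add _ _ _),
    (expect_mono_support fun a ha => (h a ha).2).trans_eq (expect_add _ _ _)⟩

lemma expect_of_support {p : PMF α} {f g : α → ℝ≥0∞}
    (h : ∀ a ∈ p.support, Within ε (f a) (g a)) :
    Within ε (Dao2.expect p f) (Dao2.expect p g) := by
  simpa using Within.expect (ε := fun _ => ε) h

lemma expect_const {p : PMF α} {f g : α → ℝ≥0∞} (h : ∀ a, Within ε (f a) (g a)) :
    Within ε (Dao2.expect p f) (Dao2.expect p g) := expect_of_support fun a _ => h a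

lemma abs_toReal_sub_le {r : ℝ} (hr : 0 ≤ r) (hx : x ≠ ∞) (hy : y ≠ ∞)
    (h : Within (ENNReal.ofReal r) x y) : |x.toReal - y.toReal| ≤ r := by
  rw [abs_sub_le_iff]
  have key : ∀ {x y : ℝ≥0∞}, y ≠ ∞ → x ≤ y + ENNReal.ofReal r → x.toReal - y.toReal ≤ r := by
    intro x y hy h
    have := ENNReal.toReal_mono (by simp [hy]) h
    rw [ENNReal.toReal_add hy (by simp), ENNReal.toReal_ofReal hr] at this
    linarith
  exact ⟨key hy h.1, key hx h.2⟩

end Within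

lemma within_of_abs_toReal_sub_le {x y : ℝ≥0∞} {r : ℝ} (hx : x ≠ ∞) (hy : y ≠ ∞)
    (h : |x.toReal - y.toReal| ≤ r) : Within (ENNReal.ofReal r) x y := by
  have hr : 0 ≤ r := (abs_nonneg _).trans h
  rw [abs_sub_le_iff] at h
  have key : ∀ {x y : ℝ≥0∞}, x ≠ ∞ → y ≠ ∞ → x.toReal - y.toReal ≤ r →
      x ≤ y + ENNReal.ofReal r := by
    intro x y hx hy h
    rw [← ENNReal.ofReal_toReal hx, ← ENNReal.ofReal_toReal hy,
      ← ENNReal.ofReal_add (by simp) hr]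
    exact ENNReal.ofReal_le_ofReal (by linarith)
  exact ⟨key hx hy h.1, key hy hx h.2⟩

/-- A function with values at most `1` that vanishes off `s` has mean at most `#s / #α`. -/
lemma expect_unif_le_of_card [Fintype α] [Nonempty α] {f : α → ℝ≥0∞} (hf : ∀ a, f a ≤ 1)
    (s : Finset α) (hs : ∀ a ∉ s, f a = 0) :
    expect (unif α) f ≤ s.card / Fintype.card α := by
  rw [expect_unif, ← Finset.sum_subset s.subset_univ fun a _ h => hs a h, mul_comm,
    ← div_eq_mul_inv]
  gcongr
  calc ∑ a ∈ s, f a ≤ ∑ _a ∈ s, 1 := Finset.sum_le_sum fun a _ => hf a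
    _ = s.card := by simp

/-- Functions that agree outside a finite set have close means. -/
lemma Within.expect_unif_of_eq_off [Fintype α] [Nonempty α] {f g : α → ℝ≥0∞} (hf : ∀ a, f a ≤ 1)
    (hg : ∀ a, g a ≤ 1) (s : Finset α) (h : ∀ a ∉ s, f a = g a) :
    Within (s.card / Fintype.card α) (Dao2.expect (unif α) f) (Dao2.expect (unif α) g) := by
  classical
  refine (Within.expect (ε := fun a => if a ∈ s then 1 else 0) fun a _ => ?_).mono
    (expect_unif_le_of_card (fun a => by split_ifs <;> simp) s fun a ha => by simp [ha])
  split_ifs with ha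
  · exact .of_le_one (hf a) (hg a)
  · exact .of_eq (h a ha)

/-- A uniform nonzero element of a finite field is close to a uniform element. -/
lemma Within.expect_units {K : Type} [Field K] [Fintype K] [DecidableEq K] {f : K → ℝ≥0∞}
    (hf : ∀ a, f a ≤ 1) :
    Within (1 / Fintype.card K) (Dao2.expect (unif Kˣ) fun k => f k)
      (Dao2.expect (unif K) f) := by
  have hsum : ∑ a : K, f a = f 0 + ∑ k : Kˣ, f k := by
    rw [← Finset.add_sum_erase _ _ (Finset.mem_univ (0 : K))]
    congr 1
    refine (Finset.sum_bij (fun (k : Kˣ) _ => (k : K)) (by simp) (by simp [Units.ext_iff])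
      (fun a ha => ⟨Units.mk0 a (Finset.ne_of_mem_erase ha), by simp⟩) (by simp)).symm
  have hcard : (Fintype.card K : ℝ≥0∞) = Fintype.card Kˣ + 1 := by
    rw [Fintype.card_units]
    exact_mod_cast (Nat.sub_add_cancel Fintype.card_pos).symm
  have hpos : 0 < Fintype.card Kˣ := Fintype.card_pos
  have hS : ∑ k : Kˣ, f k ≤ Fintype.card Kˣ := by
    calc ∑ k : Kˣ, f k ≤ ∑ _k : Kˣ, 1 := Finset.sum_le_sum fun a _ => hf _
      _ = _ := by simp
  rw [expect_unif, expect_unif, hsum, hcard]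
  set S := ∑ k : Kˣ, f k
  set n : ℝ≥0∞ := (Fintype.card Kˣ : ℝ≥0∞)
  have hn0 : n ≠ 0 := by simp [n]
  have hnt : n ≠ ∞ := by simp [n]
  have h1 : n + 1 ≠ 0 := by simp
  have h2 : n + 1 ≠ ∞ := by simp [hnt]
  have e1 : (n + 1)⁻¹ * (n + 1) = 1 := ENNReal.inv_mul_cancel h1 h2
  have e2 : n⁻¹ * n = 1 := ENNReal.inv_mul_cancel hn0 hnt
  constructor
  · have : n⁻¹ * S = (n + 1)⁻¹ * S + (n + 1)⁻¹ * (n⁻¹ * S) := by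
      calc n⁻¹ * S = ((n + 1)⁻¹ * (n + 1)) * (n⁻¹ * S) := by rw [e1, one_mul]
        _ = (n + 1)⁻¹ * ((n⁻¹ * n) * S) + (n + 1)⁻¹ * (n⁻¹ * S) := by ring
        _ = _ := by rw [e2, one_mul]
    rw [this, one_div]
    gcongr ?_ + ?_
    · gcongr
      exact le_add_self
    · calc (n + 1)⁻¹ * (n⁻¹ * S) ≤ (n + 1)⁻¹ * (n⁻¹ * n) := by gcongr
        _ = _ := by rw [e2, mul_one]
  · rw [mul_add, add_comm, one_div]
    gcongr ?_ + ?_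
    · gcongr
      exact le_self_add
    · calc (n + 1)⁻¹ * f 0 ≤ (n + 1)⁻¹ * 1 := by gcongr; exact hf 0
        _ = _ := mul_one _

/-! ### Uniform lists -/

/-- A list of `n` independent uniform elements. -/
def unifList (α : Type) [Fintype α] [Nonempty α] : ℕ → PMF (List α)
  | 0 => pure []
  | n + 1 => do
    let a ← unif α
    let l ← unifList α n
    return a :: l

section unifList

variable [Fintype α] [Nonempty α]

@[simp] lemma expect_unifList_zero (f : List α → ℝ≥0∞) : expect (unifList α 0) f = f [] := by
  simp [unifList]

lemma expect_unifList_succ (n : ℕ) (f : List α → ℝ≥0∞) :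
    expect (unifList α (n + 1)) f =
      expect (unif α) fun a => expect (unifList α n) fun l => f (a :: l) := by
  simp [unifList, expect_bind, expect_map]

lemma expect_unifList_add (m n : ℕ) (f : List α → ℝ≥0∞) :
    expect (unifList α (m + n)) f =
      expect (unifList α m) fun l => expect (unifList α n) fun l' => f (l ++ l') := by
  induction m generalizing f with
  | zero => simp
  | succ m ih =>
    rw [Nat.succ_add]
    simp only [expect_unifList_succ, ih, List.cons_append]

lemma expect_unif_fin (n : ℕ) (f : List α → ℝ≥0∞) :
    (expect (unif (Fin n → α)) fun x => f (List.ofFn x)) = expect (unifList α n) f := by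
  induction n generalizing f with
  | zero => simp
  | succ n ih =>
    rw [expect_unif_fin_succ, expect_unifList_succ]
    simp only [List.ofFn_succ, Fin.cons_zero, Fin.cons_succ]
    exact congrArg _ (funext fun a => ih fun l => f (a :: l))

lemma Within.expect_unifList {ε : ℝ≥0∞} {n : ℕ} {f g : List α → ℝ≥0∞}
    (h : ∀ l, l.length = n → Within ε (f l) (g l)) :
    Within ε (Dao2.expect (unifList α n) f) (Dao2.expect (unifList α n) g) := by
  rw [← expect_unif_fin, ← expect_unif_fin]
  exact .expect_const fun x => h _ (by simp)

end unifList

end Expectation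

/-! ### Arithmetic in the group -/

section HonestSession

namespace GroupFamily

variable {F : GroupFamily} {κ : ℕ}

lemma q_nsmul (P : F.G κ) : F.q κ • P = 0 := by
  rw [← F.card_eq κ]
  exact card_nsmul_eq_zero'

instance instModule (κ : ℕ) : Module (F.Scalar κ) (F.G κ) :=
  AddCommGroup.zmodModule q_nsmul

lemma mul_eq_smul (x : F.Scalar κ) (P : F.G κ) : mul x P = x • P := by
  conv_rhs => rw [← ZMod.natCast_zmod_val x]
  rw [Nat.cast_smul_eq_nsmul]
  rfl

lemma base_eq_smul (x : F.Scalar κ) : F.base x = x • F.gen κ := mul_eq_smul _ _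

lemma base_add (x y : F.Scalar κ) : F.base (x + y) = F.base x + F.base y := by
  simp only [base_eq_smul, add_smul]

lemma mul_base (x y : F.Scalar κ) : mul x (F.base y) = F.base (x * y) := by
  simp only [mul_eq_smul, base_eq_smul, mul_smul]

lemma base_injective : Function.Injective (F.base (κ := κ)) := by
  intro x y h
  simp only [base_eq_smul] at h
  rw [← sub_eq_zero, ← sub_smul, smul_eq_zero] at h
  exact sub_eq_zero.1 (h.resolve_right (F.gen_ne κ))

end GroupFamily

/-! ### Lagrange interpolation -/

lemma natCast_injOn_of_subset {q n : ℕ} {S : Finset ℕ} (hS : S ⊆ Finset.Icc 1 n) (hn : n < q) :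
    Set.InjOn (fun i : ℕ => (i : ZMod q)) S := by
  -- As `n < q`, distinct indices have distinct residues.
  intro i hi j hj h
  have hi' := Finset.mem_Icc.1 (hS hi)
  have hj' := Finset.mem_Icc.1 (hS hj)
  have := (ZMod.natCast_eq_natCast_iff' i j q).1 h
  rwa [Nat.mod_eq_of_lt (by omega), Nat.mod_eq_of_lt (by omega)] at this

open Polynomial in
/-- Any qualified set of shares determines the secret. -/
lemma sum_lagrange_mul_share {q n t : ℕ} [Fact q.Prime] {S : Finset ℕ}
    (hS : S ⊆ Finset.Icc 1 n) (hn : n < q) (ht : t ≤ S.card) (c : Fin t → ZMod q) :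
    ∑ i ∈ S, lagrange S i * share c i = share c 0 := by
  set P : (ZMod q)[X] := ∑ l : Fin t, C (c l) * X ^ (l : ℕ)
  have hev : ∀ i : ℕ, P.eval (i : ZMod q) = share c i := fun i => by
    simp [P, share, eval_finsetSum]
  have hdeg : P.degree < S.card := by
    refine (degree_sum_le _ _).trans_lt ((Finset.sup_lt_iff (WithBot.bot_lt_coe _)).2 ?_)
    intro l _
    refine (degree_C_mul_X_pow_le _ _).trans_lt ?_
    exact_mod_cast l.2.trans_le ht
  have hP := Lagrange.eq_interpolate (natCast_injOn_of_subset hS hn) hdeg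
  have h0 := congrArg (eval 0) hP
  rw [← Nat.cast_zero (R := ZMod q), hev, Lagrange.interpolate_apply, eval_finsetSum] at h0
  rw [h0]
  refine Finset.sum_congr rfl fun i _ => ?_
  rw [eval_mul, eval_C, hev, mul_comm, lagrange, Lagrange.basis, eval_prod]
  congr 1
  refine Finset.prod_congr rfl fun j _ => ?_
  rw [Lagrange.basisDivisor, eval_mul, eval_C, eval_sub, eval_X, eval_C, Nat.cast_zero, zero_sub,
    mul_neg, ← neg_mul, ← inv_neg, neg_sub, mul_comm]

variable {F : GroupFamily} {dao : SenderDAO F} {κ : ℕ}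

lemma sum_lagrange_mul_share_S (Q : Quorum dao) (c : dao.Secret κ) :
    ∑ i ∈ Q.S κ, lagrange (Q.S κ) i * share c i = share c 0 :=
  sum_lagrange_mul_share (Q.S_subset κ) (dao.n_lt κ) (Q.le_card_S κ) c

lemma sum_lagrange_mul_share_T (Q : Quorum dao) (c : dao.Secret κ) :
    ∑ i ∈ Q.T κ, lagrange (Q.T κ) i * share c i = share c 0 :=
  sum_lagrange_mul_share (Q.T_subset κ) (dao.n_lt κ) (Q.le_card_T κ) c

lemma sharedSecret_eq (Q : Quorum dao) (c : dao.Secret κ) (B : F.G κ) :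
    sharedSecret (Q.S κ) (share c) B = GroupFamily.mul (share c 0) B := by
  simp only [sharedSecret, GroupFamily.mul_eq_smul, smul_smul, ← Finset.sum_smul,
    sum_lagrange_mul_share_S]

/-- The secret of honest key generation is uniform. -/
lemma expect_share_zero (dao : SenderDAO F) (f : F.Scalar κ → ℝ≥0∞) :
    (expect (unif (dao.Secret κ)) fun c => f (share c 0)) = expect (unif (F.Scalar κ)) f := by
  unfold SenderDAO.Secret
  obtain ⟨t, ht⟩ : ∃ t, dao.t κ = t + 1 := ⟨dao.t κ - 1, by have := dao.t_pos κ; omega⟩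
  rw [ht, expect_unif_fin_succ]
  simp [share, Fin.sum_univ_succ]

/-! ### Expectations over random oracle computations -/

section ROM

variable {q : ℕ} {α β : Type}

/-- The values of the random oracle that are determined. -/
abbrev Table (q : ℕ) : Type := List (Data × ZMod q)

/-- The value of the oracle at `d`, which is `v` if it is fresh. -/
def Table.get (T : Table q) (d : Data) (v : ZMod q) : ZMod q := (T.lookup d).getD v

/-- The table after a query `d`, whose value is `v` if it is fresh. -/
def Table.insert (T : Table q) (d : Data) (v : ZMod q) : Table q :=
  if (T.lookup d).isSome then T else (d, v) :: T

lemma expect_run_bind (m : ROM q α) (k : α → ROM q β) (T : Table q)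
    (f : β × Table q → ℝ≥0∞) :
    expect ((m >>= k).run T) f = expect (m.run T) fun x => expect ((k x.1).run x.2) f := by
  rw [StateT.run_bind, expect_bind]

lemma expect_run_pure (a : α) (T : Table q) (f : α × Table q → ℝ≥0∞) :
    expect ((pure a : ROM q α).run T) f = f (a, T) := by
  rw [StateT.run_pure, expect_pure]

lemma expect_run_sample [Fintype α] [Nonempty α] (T : Table q) (f : α × Table q → ℝ≥0∞) :
    expect ((ROM.sample α : ROM q α).run T) f = expect (unif α) fun a => f (a, T) := by
  show expect (unif α >>= fun a => pure (a, T)) f = _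
  simp [expect_map]

lemma expect_run_hash [Fact q.Prime] (d : Data) (T : Table q) (f : ZMod q × Table q → ℝ≥0∞) :
    expect ((ROM.hash d).run T) f =
      expect (unif (ZMod q)) fun v => f (T.get d v, T.insert d v) := by
  unfold ROM.hash Table.get Table.insert
  rw [expect_run_bind, StateT.run_get, expect_pure]
  dsimp only
  cases T.lookup d with
  | some v => simp
  | none =>
    simp [expect_map, expect_run_sample]

/-- Querying the oracle at an unpredictable point returns a fresh uniform value. -/
lemma Within.expect_hash [Fact q.Prime] [Fintype α] [Nonempty α] {K : α → Data}
    (hK : Function.Injective K)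
    {T : Table q} {T' : α → Table q} (hT : ∀ a v, (K a, v) ∈ T' a → (K a, v) ∈ T)
    {f : α → ZMod q × Table q → ℝ≥0∞} (hf : ∀ a x, f a x ≤ 1) :
    Within (T.length / Fintype.card α)
      (Dao2.expect (unif α) fun a => Dao2.expect ((ROM.hash (K a)).run (T' a)) (f a))
      (Dao2.expect (unif α) fun a => Dao2.expect (unif (ZMod q)) fun v =>
        f a (v, (K a, v) :: T' a)) := by
  classical
  -- As `K` is injective, at most `T.length` choices hit an entry of `T`.
  let s : Finset α := Finset.univ.filter fun a => K a ∈ T.map Prod.fst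
  have hs : s.card ≤ T.length := by
    calc s.card = (s.map ⟨K, hK⟩).card := (Finset.card_map _).symm
      _ ≤ (T.map Prod.fst).toFinset.card := Finset.card_le_card fun d hd => by
          simp only [Finset.mem_map, s, Finset.mem_filter] at hd
          obtain ⟨a, ha, rfl⟩ := hd
          exact List.mem_toFinset.2 ha.2
      _ ≤ (T.map Prod.fst).length := List.toFinset_card_le _
      _ = T.length := List.length_map _
  refine (Within.expect_unif_of_eq_off (fun a => expect_le_one (hf a))
    (fun a => expect_le_one fun v => hf _ _) s fun a ha => ?_).mono (by gcongr)
  rw [expect_run_hash]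
  have : (T' a).lookup (K a) = none := by
    rw [List.lookup_eq_none_iff]
    rintro ⟨d, v⟩ hd
    rw [bne_iff_ne]
    rintro rfl
    exact ha (by simpa [s] using ⟨v, hT _ _ hd⟩)
  simp [Table.get, Table.insert, this]

end ROM

lemma Data.toList_ofList (l : List Data) : (Data.ofList l).toList = l := by
  induction l with
  | nil => rfl
  | cons d l ih => simp [Data.ofList, Data.toList, ih]

lemma Data.ofList_toList (d : Data) : Data.ofList d.toList = d := by
  induction d with
  | nil => rfl
  | node l r _ ih => simp [Data.ofList, Data.toList, ih]

lemma Data.ofBool_injective : Function.Injective Data.ofBool := by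
  intro a b h
  cases a <;> cases b <;> simp_all [Data.ofBool]

lemma Bits.enc_injective {n : ℕ} : Function.Injective (Bits.enc (n := n)) := by
  intro x y h
  have := congrArg Data.toList h
  simp only [Bits.enc, Data.toList_ofList] at this
  exact List.ofFn_injective (List.map_injective_iff.2 Data.ofBool_injective this)

/-! ### Simulating a session without the secret -/

/-- The oracle query of the stealth offset. -/
def stealthKey (Ω ξ : Data) : Data := .node .nil (.node Ω ξ)

/-- The oracle query of a message to be signed. -/
def msgKey (m : Data) : Data := .node (.node .nil .nil) m

/-- The signature as a tree, or `nil` if there is none. -/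
def encSig {q : ℕ} (r s : ZMod q) : Data :=
  if r = 0 ∨ s = 0 then .nil else .node (encScalar r) (encScalar s)

/-- The `s`-part of the signature, when the nonce point is `u G + v A`. -/
def simS (A : F.G κ) (u v : F.Scalar κ) : F.Scalar κ :=
  F.conv κ (F.base u + GroupFamily.mul v A) * v⁻¹

/-- The signature that a simulator without the secret makes from two random scalars. -/
def simSig (A : F.G κ) (u v : F.Scalar κ) : Data :=
  encSig (F.conv κ (F.base u + GroupFamily.mul v A)) (simS A u v)

/-- The oracle value for which `simSig` is a valid signature. It is `e'` if there is no
signature. -/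
def simHash (A : F.G κ) (u v e' : F.Scalar κ) : F.Scalar κ :=
  if F.conv κ (F.base u + GroupFamily.mul v A) = 0 then e' else u * simS A u v

/-- Honest signing with nonce `k` for a uniform oracle value `e` is close to choosing the nonce
point as `u G + v A` and programming the oracle. -/
lemma within_signature (a : F.Scalar κ) {h : Data → F.Scalar κ → ℝ≥0∞} (hh : ∀ d e, h d e ≤ 1) :
    Within (2 / F.q κ)
      (expect (unif (F.Scalar κ)) fun e => expect (unif (F.Scalar κ)ˣ) fun k =>
        h (encSig (F.conv κ (F.base k))
          ((k⁻¹ : (F.Scalar κ)ˣ) * e + ((k⁻¹ : (F.Scalar κ)ˣ) : F.Scalar κ) *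
            F.conv κ (F.base k) * a)) e)
      (expect (unif (F.Scalar κ)) fun u => expect (unif (F.Scalar κ)) fun v =>
        expect (unif (F.Scalar κ)) fun e' =>
          h (simSig (F.base a) u v) (simHash (F.base a) u v e')) := by
  have hq : (Fintype.card (F.Scalar κ) : ℝ≥0∞) = F.q κ := by rw [ZMod.card]
  have h2 : (2 : ℝ≥0∞) / F.q κ = 1 / F.q κ + 1 / F.q κ := by
    rw [← ENNReal.add_div, one_add_one_eq_two]
  rw [h2]
  -- The simulation in terms of `k = u + v a` instead of `u`.
  have e1 : (expect (unif (F.Scalar κ)) fun u => expect (unif (F.Scalar κ)) fun v =>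
        expect (unif (F.Scalar κ)) fun e' =>
          h (simSig (F.base a) u v) (simHash (F.base a) u v e')) =
      expect (unif (F.Scalar κ)) fun k => expect (unif (F.Scalar κ)) fun v =>
        expect (unif (F.Scalar κ)) fun e' =>
          h (encSig (F.conv κ (F.base k)) (F.conv κ (F.base k) * v⁻¹))
            (if F.conv κ (F.base k) = 0 then e' else
              (k - v * a) * (F.conv κ (F.base k) * v⁻¹)) := by
    rw [expect_comm]
    conv_rhs => rw [expect_comm]
    refine congrArg _ (funext fun v => ?_)
    refine Eq.trans ?_ (expect_unif_equiv (Equiv.addRight (v * a)) _)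
    refine congrArg _ (funext fun u => congrArg _ (funext fun e' => ?_))
    simp [simSig, simHash, simS, GroupFamily.mul_base, ← GroupFamily.base_add]
  rw [e1, expect_comm]
  refine Within.trans (Within.expect_const fun k => ?_)
    ((Within.expect_units (K := F.Scalar κ) fun k => expect_le_one fun v => expect_le_one fun e' =>
      hh _ _).mono (by rw [hq]))
  set r := F.conv κ (F.base (k : F.Scalar κ))
  by_cases hr : r = 0
  · exact .of_eq (by simp only [hr, encSig, true_or, if_true, expect_const])
  -- For fixed `k` the oracle value `e = k s - r a` and `v = r / s` determine each other.
  have hk : (k : F.Scalar κ) ≠ 0 := k.ne_zero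
  let φ : F.Scalar κ ≃ F.Scalar κ :=
    ((Equiv.inv _).trans (Equiv.mulLeft₀ (k * r) (mul_ne_zero hk hr))).trans
      (Equiv.addRight (-(r * a)))
  rw [← expect_unif_equiv φ]
  simp only [if_neg hr, expect_const]
  refine (Within.expect_unif_of_eq_off (fun v => hh _ _) (fun v => hh _ _) {0}
    fun v hv => ?_).mono (by rw [hq]; simp)
  have hv : v ≠ 0 := by simpa using hv
  simp only [φ, Equiv.trans_apply, Equiv.inv_apply, Equiv.mulLeft₀_apply, Equiv.coe_addRight,
    Units.val_inv_eq_inv_val]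
  congr 2
  · field_simp
    ring
  · field_simp
    ring

/-- The transcript of a session with destination `D`. -/
def transcript (A D : F.G κ) (tag : Data) (pay ξ : Data) (u v : F.Scalar κ) : Data :=
  .ofList [.node pay (F.enc κ D), simSig A u v, F.enc κ D, tag, ξ]

/-- An honest session is close to a simulated one, in which both oracle values are fresh. -/
lemma within_session (Q : Quorum dao) (c : dao.Secret κ) (B : F.G κ) (tag : Bits (2 * κ))
    (pay : Data) (T : Table (F.q κ)) {f : Data × Table (F.q κ) → ℝ≥0∞} (hf : ∀ x, f x ≤ 1) :
    Within (T.length / 2 ^ (2 * κ) + (T.length / F.q κ + 2 / F.q κ))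
      (expect ((session Q c B tag pay).run T) f)
      (expect (unif (Bits (2 * κ))) fun ξ => expect (unif (F.Scalar κ)) fun ρ =>
        expect (unif (F.Scalar κ)) fun u => expect (unif (F.Scalar κ)) fun v =>
        expect (unif (F.Scalar κ)) fun e' =>
          f (transcript (F.base (share c 0)) (B + F.base ρ) tag.enc pay ξ.enc u v,
            (msgKey (.node pay (F.enc κ (B + F.base ρ))),
              simHash (F.base (share c 0)) u v e') ::
            (stealthKey (F.enc κ (GroupFamily.mul (share c 0) B)) ξ.enc, ρ) :: T)) := by
  simp only [session, sharedSecret_eq, ROM.hashStealth, thresholdSign, ROM.hashMsg,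
    expect_run_bind, expect_run_sample, expect_run_pure]
  have hsum : ∀ kinv r : F.Scalar κ,
      ∑ i ∈ Q.T κ, kinv * r * lagrange (Q.T κ) i * share c i = kinv * r * share c 0 := by
    intro kinv r
    rw [← sum_lagrange_mul_share_T Q c, Finset.mul_sum]
    exact Finset.sum_congr rfl fun i _ => by ring
  simp only [hsum]
  have hρ : Function.Injective fun ρ : F.Scalar κ =>
      msgKey (.node pay (F.enc κ (B + F.base ρ))) := by
    intro ρ ρ' h
    simp only [msgKey, Data.node.injEq, true_and] at h
    exact GroupFamily.base_injective (add_left_cancel (F.enc_injective κ h))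
  refine Within.trans ((Within.expect_hash (K := fun ξ : Bits (2 * κ) =>
      stealthKey (F.enc κ (GroupFamily.mul (share c 0) B)) ξ.enc) ?_ (T := T) (T' := fun _ => T)
      (fun _ _ h => h) fun ξ x => expect_le_one fun _ => expect_le_one fun _ => hf _).mono ?_)
    (Within.expect_const fun ξ => ?_)
  · intro ξ ξ' h
    simp only [stealthKey, Data.node.injEq, true_and] at h
    exact Bits.enc_injective h
  · simp [Fintype.card_bool]
  refine Within.trans ((Within.expect_hash hρ (T := T) (T' := fun ρ =>
      (stealthKey (F.enc κ (GroupFamily.mul (share c 0) B)) ξ.enc, ρ) :: T) ?_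
      fun ρ x => expect_le_one fun _ => hf _).mono ?_)
    (Within.expect_const fun ρ => ?_)
  · intro ρ v h
    simpa [stealthKey, msgKey] using h
  · rw [ZMod.card]
  refine Within.trans (ε := 0) (.of_eq ?_) (within_signature (share c 0) (h := fun d e =>
      f (.ofList [.node pay (F.enc κ (B + F.base ρ)), d, F.enc κ (B + F.base ρ), tag.enc, ξ.enc],
        (msgKey (.node pay (F.enc κ (B + F.base ρ))), e) ::
        (stealthKey (F.enc κ (GroupFamily.mul (share c 0) B)) ξ.enc, ρ) :: T))
      fun d e => hf _) |>.mono (by rw [zero_add])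
  refine congrArg _ (funext fun e => congrArg _ (funext fun k => ?_))
  congr 5
  unfold encSig
  split_ifs <;> rfl

end HonestSession

/-! ### Oracle algorithms on a tape of fresh oracle values -/

section Tape

variable {q : ℕ}

/-- The output of an algorithm whose last action is `act`; it is `nil` if it did not halt. -/
def haltOutput (act : Data) : Data := if act.left = .nil then act.right else .nil

/-- The run of an oracle algorithm in which the fresh oracle values come from a tape: the output
and the final table. Each query uses up one entry of the tape, whether it is fresh or not. -/
def runTape (p : Prog) (input : Data) : List (ZMod q) → Data → Table q → Data × Table q
  | [], answers, T => (haltOutput (p.eval (.node input answers)), T)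
  | v :: tape, answers, T =>
    if (p.eval (.node input answers)).left = .nil then ((p.eval (.node input answers)).right, T)
    else runTape p input tape
      (.node (encScalar (T.get (p.eval (.node input answers)).right v)) answers)
      (T.insert (p.eval (.node input answers)).right v)

/-- The queries made in the run `runTape`. -/
def tapeQueries (p : Prog) (input : Data) : List (ZMod q) → Data → Table q → List Data
  | [], _, _ => []
  | v :: tape, answers, T =>
    if (p.eval (.node input answers)).left = .nil then []
    else (p.eval (.node input answers)).right :: tapeQueries p input tape
      (.node (encScalar (T.get (p.eval (.node input answers)).right v)) answers)
      (T.insert (p.eval (.node input answers)).right v)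

lemma length_tapeQueries_le (p : Prog) (input : Data) (tape : List (ZMod q)) (answers : Data)
    (T : Table q) : (tapeQueries p input tape answers T).length ≤ tape.length := by
  induction tape generalizing answers T with
  | nil => simp [tapeQueries]
  | cons v tape ih =>
    rw [tapeQueries]
    split_ifs
    · simp
    · simpa using ih _ _

lemma length_runTape_le (p : Prog) (input : Data) (tape : List (ZMod q)) (answers : Data)
    (T : Table q) : (runTape p input tape answers T).2.length ≤ T.length + tape.length := by
  induction tape generalizing answers T with
  | nil => simp [runTape]
  | cons v tape ih =>
    rw [runTape]
    split_ifs
    · simp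
    · refine (ih _ _).trans ?_
      unfold Table.insert
      split_ifs <;> (simp; try omega)

/-- The lazily sampled oracle may be sampled in advance, query by query. -/
lemma expect_runAlg [Fact q.Prime] (p : Prog) (input : Data) (n : ℕ) (answers : Data)
    (T : Table q) (f : Data × Table q → ℝ≥0∞) :
    expect ((ROM.runAlg p input n answers).run T) f =
      expect (unifList (ZMod q) n) fun tape => f (runTape p input tape answers T) := by
  induction n generalizing answers T with
  | zero =>
    rw [ROM.runAlg, expect_unifList_zero, runTape]
    cases p.eval (.node input answers) with
    | nil => exact expect_run_pure _ _ _
    | node l r =>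
      cases l with
      | nil => exact expect_run_pure _ _ _
      | node l l' => exact expect_run_pure _ _ _
  | succ n ih =>
    rw [ROM.runAlg, expect_unifList_succ]
    simp only [runTape]
    cases p.eval (.node input answers) with
    | nil => simp [Data.left, Data.right]
    | node l r =>
      cases l with
      | nil => simp [Data.left, Data.right]
      | node l l' =>
        simp only [expect_run_bind, expect_run_hash, ih, Data.left, Data.right, reduceCtorEq,
          if_false]

lemma lookup_insert (T : Table q) (d : Data) (v : ZMod q) (d' : Data) :
    (T.insert d v).lookup d' = if d' = d then some (T.get d v) else T.lookup d' := by
  unfold Table.insert Table.get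
  cases h : T.lookup d with
  | some w =>
    by_cases hd : d' = d
    · simp [hd, h]
    · simp [hd]
  | none =>
    by_cases hd : d' = d
    · simp [hd]
    · simp [List.lookup_cons, hd, beq_eq_false_iff_ne.2 hd]

/-- A run does not notice the oracle values at points that it does not query. -/
lemma runTape_congr (p : Prog) (input : Data) (S : Set Data) (tape : List (ZMod q))
    (answers : Data) (T T' : Table q) (hT : ∀ d ∉ S, T.lookup d = T'.lookup d)
    (hS : ∀ d ∈ tapeQueries p input tape answers T', d ∉ S) :
    (runTape p input tape answers T).1 = (runTape p input tape answers T').1 := by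
  induction tape generalizing answers T T' with
  | nil => simp [runTape]
  | cons v tape ih =>
    rw [tapeQueries] at hS
    rw [runTape, runTape]
    split_ifs at hS ⊢ with h
    · rfl
    · have hd := hT _ (hS _ List.mem_cons_self)
      have hget : T.get (p.eval (.node input answers)).right v =
          T'.get (p.eval (.node input answers)).right v := by rw [Table.get, Table.get, hd]
      rw [hget]
      refine ih _ _ _ (fun d hdS => ?_) fun d h => hS d (List.mem_cons_of_mem _ h)
      rw [lookup_insert, lookup_insert, hget, hT d hdS]

/-- Oracle values at points that depend injectively on a uniform `z`, independent of all the rest,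
are not noticed, except with small probability. -/
lemma within_runTape_of_hidden {ι : Type} [Fintype ι] [Nonempty ι] [Fact q.Prime] (p : Prog)
    (input : Data) {c n : ℕ} {K : Fin c → ι → Data} (hK : ∀ j, Function.Injective (K j))
    {T : ι → Table q} {T' : Table q}
    (hT : ∀ z d, (∀ j, d ≠ K j z) → (T z).lookup d = T'.lookup d) {g : Data → ℝ≥0∞}
    (hg : ∀ d, g d ≤ 1) :
    Within ((c * n : ℕ) / Fintype.card ι)
      (expect (unif ι) fun z => expect (unifList (ZMod q) n) fun tape =>
        g (runTape p input tape .nil (T z)).1)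
      (expect (unifList (ZMod q) n) fun tape => g (runTape p input tape .nil T').1) := by
  classical
  rw [expect_comm]
  refine Within.expect_unifList fun tape hlen => ?_
  let s : Finset ι := Finset.univ.biUnion fun j =>
    Finset.univ.filter fun z => K j z ∈ tapeQueries p input tape .nil T'
  have hs : s.card ≤ c * n := by
    refine (Finset.card_biUnion_le_card_mul _ _ n fun j _ => ?_).trans_eq (by simp)
    calc _ = ((Finset.univ.filter fun z => K j z ∈ tapeQueries p input tape .nil T').map
          ⟨K j, hK j⟩).card := (Finset.card_map _).symm
      _ ≤ (tapeQueries p input tape .nil T').toFinset.card := Finset.card_le_card fun d hd => by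
          simp only [Finset.mem_map, Finset.mem_filter] at hd
          obtain ⟨a, ha, rfl⟩ := hd
          exact List.mem_toFinset.2 ha.2
      _ ≤ (tapeQueries p input tape .nil T').length := List.toFinset_card_le _
      _ ≤ n := hlen ▸ length_tapeQueries_le _ _ _ _ _
  have := Within.expect_unif_of_eq_off (f := fun z => g (runTape p input tape .nil (T z)).1)
    (g := fun _ => g (runTape p input tape .nil T').1) (fun _ => hg _) (fun _ => hg _) s
    fun z hz => congrArg g (runTape_congr p input {d | ∃ j, d = K j z} tape _ _ _
      (fun d hd => hT z d (by simpa using hd)) fun d hd ⟨j, hj⟩ => hz (by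
        simp only [s, Finset.mem_biUnion, Finset.mem_filter, Finset.mem_univ, true_and]
        exact ⟨j, hj ▸ hd⟩))
  rw [expect_const] at this
  exact this.mono (by gcongr)

end Tape

/-! ### The games of the reduction -/

section Simulation

variable {α β : Type}

/-- A pair of independent random elements. -/
def prodPMF (p : PMF α) (q : PMF β) : PMF (α × β) := do
  let a ← p
  let b ← q
  return (a, b)

lemma expect_prodPMF (p : PMF α) (q : PMF β) (f : α × β → ℝ≥0∞) :
    expect (prodPMF p q) f = expect p fun a => expect q fun b => f (a, b) := by
  simp [prodPMF, expect_bind, expect_map]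

lemma expect_ind_beq_const (p : PMF α) (o : α → Bool) :
    (expect (unif Bool) fun b => expect p fun x => ind (o x == b)) = 2⁻¹ := by
  rw [expect_comm]
  simp [expect_ind_beq_bool]

lemma expect_ind_beq_beq_const (p : PMF α) (o : α → Bool) :
    (expect (unif Bool) fun b₁ => expect (unif Bool) fun b₂ =>
      expect p fun x => ind (o x == (b₁ == b₂))) = 2⁻¹ := by
  have h : ∀ (c b₁ b₂ : Bool), (c == (b₁ == b₂)) = ((c == b₁) == b₂) := by decide
  refine Eq.trans (congrArg _ (funext fun b₁ => ?_)) (expect_const (unif Bool) 2⁻¹)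
  simp only [h]
  exact expect_ind_beq_const p fun x => o x == b₁

variable {F : GroupFamily} {κ : ℕ}

/-- A receiver's state, written relative to a point `Y`: the state `(Y + x G, cc)` is `(x, cc)`. -/
abbrev OffState (F : GroupFamily) (κ : ℕ) : Type := F.Scalar κ × Bits (2 * κ)

/-- The public state with a given offset from `Y`. -/
def OffState.toPub (Y : F.G κ) (st : OffState F κ) : PubState F κ := (Y + F.base st.1, st.2)

/-- Key derivation on offsets from `Y`. -/
def deriveOff (hm : Hmac F) (Y : F.G κ) (st : OffState F κ) (tag : Bits (2 * κ)) :
    OffState F κ :=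
  (st.1 + ((Bits.enc (hm.fn κ (st.2, .node (F.enc κ (Y + F.base st.1)) tag.enc)).1).toNat :
    F.Scalar κ), (hm.fn κ (st.2, .node (F.enc κ (Y + F.base st.1)) tag.enc)).2)

lemma derive_toPub (hm : Hmac F) (Y : F.G κ) (st : OffState F κ) (tag : Bits (2 * κ)) :
    hm.derive (st.toPub Y) tag = (deriveOff hm Y st tag).toPub Y := by
  simp [Hmac.derive, OffState.toPub, deriveOff, GroupFamily.base_add, add_assoc]

lemma deriveAll_toPub (hm : Hmac F) (Y : F.G κ) (st : OffState F κ) (tags : List (Bits (2 * κ))) :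
    hm.deriveAll (st.toPub Y) tags = OffState.toPub Y (tags.foldl (deriveOff hm Y) st) := by
  unfold Hmac.deriveAll
  induction tags generalizing st with
  | nil => rfl
  | cons tag tags ih => rw [List.foldl_cons, derive_toPub, ih, List.foldl_cons]

/-- A parent state chosen by the adversary, when the master public keys have offsets `w`. -/
def parseOff (κ : ℕ) (w : List (F.Scalar κ)) (d : Data) : Option (OffState F κ) :=
  w[(d.nth 0).len]?.map fun x =>
    (x + ((d.nth 1).toNat : F.Scalar κ), Bits.dec (2 * κ) (d.nth 2))

lemma parseState_eq {N : ℕ} (Y : F.G κ) (w : Fin N → F.Scalar κ) (d : Data) :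
    parseState (fun i => Y + F.base (w i)) d =
      (parseOff κ (List.ofFn w) d).map (OffState.toPub Y) := by
  unfold parseState parseOff
  split_ifs with h
  · simp [h, OffState.toPub, GroupFamily.base_add, add_assoc]
  · simp [h]

/-- The adversary's initial view, when the master public keys have offsets `w` from `Y`. -/
def simView (A Y : F.G κ) (w : List (F.Scalar κ)) (coins : Data) : Data :=
  .ofList [F.par κ, coins, F.enc κ A, .ofList (w.map fun x => F.enc κ (Y + F.base x))]

lemma initialView_eq {N n : ℕ} (A Y : F.G κ) (w : Fin N → F.Scalar κ) (coins : Bits n) :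
    initialView coins A (fun i => Y + F.base (w i)) = simView A Y (List.ofFn w) coins.enc := by
  simp [initialView, simView, List.map_ofFn, Function.comp_def]

/-- The randomness of a simulated session: the tag, `ξ`, the stealth offset, the two scalars of
the signature, and an oracle value. -/
structure SessRand (F : GroupFamily) (κ : ℕ) where
  tag : Bits (2 * κ)
  ξ : Bits (2 * κ)
  ρ : F.Scalar κ
  u : F.Scalar κ
  v : F.Scalar κ
  e : F.Scalar κ

/-- The components of the randomness of a session. -/
abbrev SessTuple (F : GroupFamily) (κ : ℕ) : Type :=
  Bits (2 * κ) × Bits (2 * κ) × F.Scalar κ × F.Scalar κ × F.Scalar κ × F.Scalar κ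

/-- The randomness of a session from its components. -/
def SessRand.ofTuple (x : SessTuple F κ) : SessRand F κ :=
  ⟨x.1, x.2.1, x.2.2.1, x.2.2.2.1, x.2.2.2.2.1, x.2.2.2.2.2⟩

/-- Independent uniform components of the randomness of a session. -/
def sessTuple (F : GroupFamily) (κ : ℕ) : PMF (SessTuple F κ) :=
  prodPMF (unif _) (prodPMF (unif _) (prodPMF (unif _) (prodPMF (unif _)
    (prodPMF (unif _) (unif _)))))

/-- Uniform randomness of a session. -/
def sessRand (F : GroupFamily) (κ : ℕ) : PMF (SessRand F κ) :=
  SessRand.ofTuple <$> sessTuple F κ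

lemma expect_sessRand (f : SessRand F κ → ℝ≥0∞) :
    expect (sessRand F κ) f =
      expect (unif (Bits (2 * κ))) fun tag => expect (unif (Bits (2 * κ))) fun ξ =>
      expect (unif (F.Scalar κ)) fun ρ => expect (unif (F.Scalar κ)) fun u =>
      expect (unif (F.Scalar κ)) fun v => expect (unif (F.Scalar κ)) fun e =>
        f ⟨tag, ξ, ρ, u, v, e⟩ := by
  simp only [sessRand, sessTuple, expect_map, expect_prodPMF, SessRand.ofTuple]

/-- A stealth offset that is not used elsewhere hides a shift that depends on the tag. -/
lemma expect_sessRand_shift (δ : Bits (2 * κ) → F.Scalar κ) (f : SessRand F κ → ℝ≥0∞) :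
    (expect (sessRand F κ) fun s => f { s with ρ := δ s.tag + s.ρ }) =
      expect (sessRand F κ) f := by
  rw [expect_sessRand, expect_sessRand]
  refine congrArg _ (funext fun tag => congrArg _ (funext fun ξ => ?_))
  exact expect_unif_equiv (Equiv.addLeft (δ tag)) fun ρ =>
    expect (unif (F.Scalar κ)) fun u => expect (unif (F.Scalar κ)) fun v =>
      expect (unif (F.Scalar κ)) fun e => f ⟨tag, ξ, ρ, u, v, e⟩

/-- The transcript of a simulated session with destination `D`. -/
def SessRand.transcript (s : SessRand F κ) (A D : F.G κ) (pay : Data) : Data :=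
  Dao2.transcript A D s.tag.enc pay s.ξ.enc s.u s.v

/-- The oracle value at the message of a simulated session. -/
def SessRand.msgEntry (s : SessRand F κ) (A D : F.G κ) (pay : Data) : Data × F.Scalar κ :=
  (msgKey (.node pay (F.enc κ D)), simHash A s.u s.v s.e)

/-- The oracle value that defines the stealth offset of a simulated session. For a receiver with
offset `x` from `Y` and `Z = a Y` the shared secret is `Z + x A`. -/
def SessRand.stealthEntry (s : SessRand F κ) (A Z : F.G κ) (x : F.Scalar κ) :
    Data × F.Scalar κ :=
  (stealthKey (F.enc κ (Z + GroupFamily.mul x A)) s.ξ.enc, s.ρ)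

/-- The destination of a simulated session for a receiver with offset `x` from `Y`. -/
def SessRand.dest (s : SessRand F κ) (Y : F.G κ) (x : F.Scalar κ) : F.G κ :=
  Y + F.base x + F.base s.ρ

/-- The oracle table after a simulated session. -/
def SessRand.table (s : SessRand F κ) (A Y Z : F.G κ) (x : F.Scalar κ) (pay : Data)
    (T : Table (F.q κ)) : Table (F.q κ) :=
  s.msgEntry A (s.dest Y x) pay :: s.stealthEntry A Z x :: T

/-- The bound on the error of simulating a session. -/
def sessError (F : GroupFamily) (κ n : ℕ) : ℝ≥0∞ :=
  n / 2 ^ (2 * κ) + (n / F.q κ + 2 / F.q κ)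

lemma sessError_mono {n m : ℕ} (h : n ≤ m) : sessError F κ n ≤ sessError F κ m := by
  unfold sessError
  gcongr

/-- `within_session`, for a receiver whose state is given by an offset. -/
lemma within_session_offset {dao : SenderDAO F} (Q : Quorum dao) (c : dao.Secret κ)
    (y : F.Scalar κ) (x : Bits (2 * κ) → F.Scalar κ) (pay : Data) (T : Table (F.q κ))
    {f : Bits (2 * κ) → Data × Table (F.q κ) → ℝ≥0∞} (hf : ∀ tag x, f tag x ≤ 1) :
    Within (sessError F κ T.length)
      (expect (unif (Bits (2 * κ))) fun tag =>
        expect ((session Q c (F.base y + F.base (x tag)) tag pay).run T) (f tag))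
      (expect (sessRand F κ) fun s =>
        f s.tag (s.transcript (F.base (share c 0)) (s.dest (F.base y) (x s.tag)) pay,
          s.table (F.base (share c 0)) (F.base y) (F.base (share c 0 * y)) (x s.tag) pay T)) := by
  rw [expect_sessRand]
  refine Within.expect_const fun tag => ?_
  have h := within_session Q c (F.base y + F.base (x tag)) tag pay T (hf tag)
  have hΩ : GroupFamily.mul (share c 0) (F.base y + F.base (x tag)) =
      F.base (share c 0 * y) + GroupFamily.mul (x tag) (F.base (share c 0)) := by
    rw [← GroupFamily.base_add, GroupFamily.mul_base, GroupFamily.mul_base,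
      ← GroupFamily.base_add]
    congr 1
    ring
  rw [hΩ] at h
  exact h

/-- The randomness of a simulated experiment: offsets of the master public keys, the random tape
of the adversary, fresh oracle values for its first phase, the bits of the challenger, and the
sessions. -/
structure GameRand (F : GroupFamily) (κ c : ℕ) where
  w : List (F.Scalar κ)
  coins : Bits c
  h : List (F.Scalar κ)
  b₁ : Bool
  b₂ : Bool
  s₁ : SessRand F κ
  s₂ : SessRand F κ

/-- The components of the randomness of an experiment. -/
abbrev GameTuple (F : GroupFamily) (κ c : ℕ) : Type :=
  List (F.Scalar κ) × Bits c × List (F.Scalar κ) × Bool × Bool × SessTuple F κ × SessTuple F κ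

/-- The randomness of an experiment from its components. -/
def GameRand.ofTuple {c : ℕ} (x : GameTuple F κ c) : GameRand F κ c :=
  ⟨x.1, x.2.1, x.2.2.1, x.2.2.2.1, x.2.2.2.2.1, .ofTuple x.2.2.2.2.2.1, .ofTuple x.2.2.2.2.2.2⟩

/-- Independent uniform components of the randomness of an experiment. -/
def gameTuple (F : GroupFamily) (κ N c n : ℕ) : PMF (GameTuple F κ c) :=
  prodPMF (unifList _ N) (prodPMF (unif _) (prodPMF (unifList _ n) (prodPMF (unif _)
    (prodPMF (unif _) (prodPMF (sessTuple F κ) (sessTuple F κ))))))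

/-- Uniform randomness of an experiment with `N` receivers, `c` coins and `n` queries. -/
def gameRand (F : GroupFamily) (κ N c n : ℕ) : PMF (GameRand F κ c) :=
  GameRand.ofTuple <$> gameTuple F κ N c n

lemma expect_gameRand (N c n : ℕ) (f : GameRand F κ c → ℝ≥0∞) :
    expect (gameRand F κ N c n) f =
      expect (unifList (F.Scalar κ) N) fun w => expect (unif (Bits c)) fun coins =>
      expect (unifList (F.Scalar κ) n) fun h => expect (unif Bool) fun b₁ =>
      expect (unif Bool) fun b₂ => expect (sessRand F κ) fun s₁ => expect (sessRand F κ) fun s₂ =>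
        f ⟨w, coins, h, b₁, b₂, s₁, s₂⟩ := by
  simp only [gameRand, gameTuple, sessRand, expect_map, expect_prodPMF, GameRand.ofTuple]

variable {c : ℕ}

/-- The adversary's initial view in a simulated experiment. -/
def GameRand.view (r : GameRand F κ c) (A Y : F.G κ) : Data := simView A Y r.w r.coins.enc

/-- The first phase of the adversary in a simulated experiment: its choice, and the table. -/
def GameRand.choice (r : GameRand F κ c) (𝒜 : Adversary) (A Y : F.G κ) :
    Data × Table (F.q κ) :=
  runTape 𝒜.choose (r.view A Y) r.h .nil []

/-- The guess of the adversary. -/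
def simGuess {q : ℕ} (𝒜 : Adversary) (input : Data) (h : List (ZMod q)) (T : Table q) : Bool :=
  (runTape 𝒜.guess input h .nil T).1.toBool

/-- The key offset of the receiver in the session of the privacy experiment. -/
def privOffset (hm : Hmac F) (Y : F.G κ) (st₀ st₁ : OffState F κ) (b : Bool)
    (tag : Bits (2 * κ)) : F.Scalar κ :=
  (deriveOff hm Y (if b then st₁ else st₀) tag).1

lemma derive_toPub_ite (hm : Hmac F) (Y : F.G κ) (st₀ st₁ : OffState F κ) (b : Bool)
    (tag : Bits (2 * κ)) :
    (hm.derive (if b then st₁.toPub Y else st₀.toPub Y) tag).1 =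
      Y + F.base (privOffset hm Y st₀ st₁ b tag) := by
  rw [← apply_ite (OffState.toPub Y), derive_toPub]
  rfl

/-- The privacy experiment on a triple `(A, Y, Z)`, simulated without the sender's secret. -/
def simPriv (hm : Hmac F) (𝒜 : Adversary) (A Y Z : F.G κ) (r : GameRand F κ c)
    (h : List (F.Scalar κ)) : Bool :=
  match parseOff κ r.w ((r.choice 𝒜 A Y).1.nth 1), parseOff κ r.w ((r.choice 𝒜 A Y).1.nth 2) with
  | some st₀, some st₁ =>
    simGuess 𝒜 (.ofList [r.view A Y, (r.choice 𝒜 A Y).1.nth 0,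
        r.s₁.transcript A (r.s₁.dest Y (privOffset hm Y st₀ st₁ r.b₁ r.s₁.tag))
          ((r.choice 𝒜 A Y).1.nth 3)]) h
      (r.s₁.table A Y Z (privOffset hm Y st₀ st₁ r.b₁ r.s₁.tag)
        ((r.choice 𝒜 A Y).1.nth 3) (r.choice 𝒜 A Y).2) == r.b₁
  | _, _ => false == r.b₁

/-- The tags of the intermediate transfers to the receiver `b`. -/
def midTags (κ : ℕ) (choice : Data) (b : Bool) : List (Bits (2 * κ)) :=
  (choice.nth (if b then 4 else 3)).toList.map (Bits.dec (2 * κ))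

/-- The key offset of the receiver in the second session of the unlinkability experiment. -/
def secondOffset (hm : Hmac F) (Y : F.G κ) (st₀ st₁ : OffState F κ) (choice : Data)
    (b₁ b₂ : Bool) (tag₁ tag₂ : Bits (2 * κ)) : F.Scalar κ :=
  (deriveOff hm Y ((midTags κ choice b₂).foldl (deriveOff hm Y)
    (if b₂ = b₁ then deriveOff hm Y (if b₁ then st₁ else st₀) tag₁
      else if b₂ then st₁ else st₀)) tag₂).1

/-- The unlinkability experiment on a triple `(A, Y, Z)`, simulated without the sender's secret. -/
def simUnlink (hm : Hmac F) (𝒜 : Adversary) (A Y Z : F.G κ) (r : GameRand F κ c)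
    (h : List (F.Scalar κ)) : Bool :=
  match parseOff κ r.w ((r.choice 𝒜 A Y).1.nth 1), parseOff κ r.w ((r.choice 𝒜 A Y).1.nth 2) with
  | some st₀, some st₁ =>
    simGuess 𝒜 (.ofList [r.view A Y, (r.choice 𝒜 A Y).1.nth 0,
        r.s₁.transcript A (r.s₁.dest Y (privOffset hm Y st₀ st₁ r.b₁ r.s₁.tag))
          ((r.choice 𝒜 A Y).1.nth 5),
        r.s₂.transcript A (r.s₂.dest Y
          (secondOffset hm Y st₀ st₁ (r.choice 𝒜 A Y).1 r.b₁ r.b₂ r.s₁.tag r.s₂.tag))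
          ((r.choice 𝒜 A Y).1.nth 6)]) h
      (r.s₂.table A Y Z
        (secondOffset hm Y st₀ st₁ (r.choice 𝒜 A Y).1 r.b₁ r.b₂ r.s₁.tag r.s₂.tag)
        ((r.choice 𝒜 A Y).1.nth 6)
        (r.s₁.table A Y Z (privOffset hm Y st₀ st₁ r.b₁ r.s₁.tag)
          ((r.choice 𝒜 A Y).1.nth 5) (r.choice 𝒜 A Y).2)) == (r.b₁ == r.b₂)
  | _, _ => false == (r.b₁ == r.b₂)

/-- The probability that the simulated guess is correct. -/
def simValue (F : GroupFamily) (κ N c n : ℕ) (sim : GameRand F κ c → List (F.Scalar κ) → Bool) :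
    ℝ≥0∞ :=
  expect (gameRand F κ N c n) fun r => expect (unifList (F.Scalar κ) n) fun h => ind (sim r h)

/-- Master public keys are uniform, also relative to a point `Y = y G`. -/
lemma expect_keys (N : ℕ) (f : (Fin N → F.Scalar κ) → ℝ≥0∞) :
    expect (unif (Fin N → F.Scalar κ)) f = expect (unif (F.Scalar κ)) fun y =>
      expect (unif (Fin N → F.Scalar κ)) fun w => f fun i => y + w i := by
  have h : ∀ y : F.Scalar κ, (expect (unif (Fin N → F.Scalar κ)) fun w => f fun i => y + w i) =
      expect (unif (Fin N → F.Scalar κ)) f := fun y =>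
    expect_unif_equiv (Equiv.piCongrRight fun _ => Equiv.addLeft y) f
  simp [h]

/-- The privacy experiment is close to its simulation on a Diffie-Hellman triple. -/
lemma within_privExp (hm : Hmac F) {dao : SenderDAO F} (Q : Quorum dao) (N : Polynomial ℕ)
    (𝒜 : Adversary) (κ : ℕ) :
    Within (sessError F κ (𝒜.queries.eval κ)) (expect (privExp hm Q N 𝒜 κ) ind)
      (expect (unif (F.Scalar κ)) fun a => expect (unif (F.Scalar κ)) fun y =>
        simValue F κ (N.eval κ) (𝒜.coinLen.eval κ) (𝒜.queries.eval κ)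
          (simPriv hm 𝒜 (F.base a) (F.base y) (F.base (a * y)))) := by
  rw [← expect_share_zero dao]
  unfold privExp simValue
  simp only [expect_map, expect_run_bind, expect_run_sample, expect_gameRand, expect_runAlg]
  refine Within.expect_const fun c => ?_
  rw [expect_keys]
  refine Within.expect_const fun y => ?_
  rw [← expect_unif_fin]
  refine Within.expect_const fun w => Within.expect_const fun coins =>
    Within.expect_unifList fun h hlen => ?_
  have hw : (fun i => F.base (y + w i)) = fun i => F.base y + F.base (w i) := by
    funext i; rw [GroupFamily.base_add]
  simp only [hw, initialView_eq, parseState_eq, simPriv, GameRand.choice, GameRand.view]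
  have hT := length_runTape_le 𝒜.choose
    (simView (F.base (share c 0)) (F.base y) (List.ofFn w) coins.enc) h .nil []
  rw [hlen, List.length_nil, zero_add] at hT
  refine Within.expect_const fun b => ?_
  unfold SenderDAO.publicKey
  generalize runTape 𝒜.choose
    (simView (F.base (share c 0)) (F.base y) (List.ofFn w) coins.enc) h .nil [] = run at hT ⊢
  cases parseOff κ (List.ofFn w) (run.1.nth 1) with
  | none => exact .of_eq (by simp)
  | some st₀ =>
  cases parseOff κ (List.ofFn w) (run.1.nth 2) with
  | none => exact .of_eq (by simp)
  | some st₁ =>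
  simp only [Option.map_some, expect_const, expect_run_bind, expect_run_sample, expect_runAlg,
    expect_run_pure, derive_toPub_ite]
  exact (within_session_offset Q c y _ _ _ fun _ _ =>
    expect_le_one fun _ => ind_le_one _).mono (sessError_mono hT)

/-- The unlinkability experiment is close to its simulation on a Diffie-Hellman triple. -/
lemma within_unlinkExp (hm : Hmac F) {dao : SenderDAO F} (Q₁ Q₂ : Quorum dao) (N : Polynomial ℕ)
    (𝒜 : Adversary) (κ : ℕ) :
    Within (sessError F κ (𝒜.queries.eval κ) + sessError F κ (𝒜.queries.eval κ + 2))
      (expect (unlinkExp hm Q₁ Q₂ N 𝒜 κ) ind)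
      (expect (unif (F.Scalar κ)) fun a => expect (unif (F.Scalar κ)) fun y =>
        simValue F κ (N.eval κ) (𝒜.coinLen.eval κ) (𝒜.queries.eval κ)
          (simUnlink hm 𝒜 (F.base a) (F.base y) (F.base (a * y)))) := by
  rw [← expect_share_zero dao]
  unfold unlinkExp simValue
  simp only [expect_map, expect_run_bind, expect_run_sample, expect_gameRand, expect_runAlg]
  refine Within.expect_const fun c => ?_
  rw [expect_keys]
  refine Within.expect_const fun y => ?_
  rw [← expect_unif_fin]
  refine Within.expect_const fun w => Within.expect_const fun coins =>
    Within.expect_unifList fun h hlen => ?_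
  have hw : (fun i => F.base (y + w i)) = fun i => F.base y + F.base (w i) := by
    funext i; rw [GroupFamily.base_add]
  simp only [hw, initialView_eq, parseState_eq, simUnlink, GameRand.choice, GameRand.view]
  have hT := length_runTape_le 𝒜.choose
    (simView (F.base (share c 0)) (F.base y) (List.ofFn w) coins.enc) h .nil []
  rw [hlen, List.length_nil, zero_add] at hT
  refine Within.expect_const fun b₁ => Within.expect_const fun b₂ => ?_
  unfold SenderDAO.publicKey
  generalize runTape 𝒜.choose
    (simView (F.base (share c 0)) (F.base y) (List.ofFn w) coins.enc) h .nil [] = run at hT ⊢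
  cases parseOff κ (List.ofFn w) (run.1.nth 1) with
  | none => exact .of_eq (by simp)
  | some st₀ =>
  cases parseOff κ (List.ofFn w) (run.1.nth 2) with
  | none => exact .of_eq (by simp)
  | some st₁ =>
  have hsecond : ∀ tag₁ tag₂ : Bits (2 * κ),
      (hm.derive (hm.deriveAll
        (if b₂ = b₁ then hm.derive (if b₁ then st₁.toPub (F.base y) else st₀.toPub (F.base y)) tag₁
          else if b₂ then st₁.toPub (F.base y) else st₀.toPub (F.base y))
        ((run.1.nth (if b₂ then 4 else 3)).toList.map (Bits.dec (2 * κ)))) tag₂).1 =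
      F.base y + F.base (secondOffset hm (F.base y) st₀ st₁ run.1 b₁ b₂ tag₁ tag₂) := by
    intro tag₁ tag₂
    simp only [← apply_ite (OffState.toPub (F.base y)), derive_toPub, deriveAll_toPub]
    rfl
  simp only [Option.map_some, expect_run_bind, expect_run_sample, expect_runAlg,
    expect_run_pure, hsecond]
  simp only [derive_toPub_ite]
  refine Within.trans ((within_session_offset Q₁ c y _ _ _
    (f := fun tag₁ x => expect (unif (Bits (2 * κ))) fun tag₂ => _) fun _ _ =>
    expect_le_one fun _ => expect_le_one fun _ => expect_le_one fun _ => ind_le_one _).mono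
    (sessError_mono hT)) (Within.expect_const fun s₁ => ?_)
  refine (within_session_offset Q₂ c y
    (secondOffset hm (F.base y) st₀ st₁ run.1 b₁ b₂ s₁.tag) _ _ fun _ _ =>
    expect_le_one fun _ => ind_le_one _).mono (sessError_mono ?_)
  simpa [SessRand.table] using hT

lemma SessRand.dest_base (s : SessRand F κ) (y x : F.Scalar κ) :
    s.dest (F.base y) x = F.base (y + x + s.ρ) := by
  rw [SessRand.dest, GroupFamily.base_add, GroupFamily.base_add]

lemma SessRand.stealthEntry_injective (s : SessRand F κ) (A : F.G κ) (x : F.Scalar κ) :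
    Function.Injective fun z => (s.stealthEntry A (F.base z) x).1 := by
  intro z z' h
  simp only [stealthEntry, stealthKey, Data.node.injEq, true_and, and_true] at h
  exact GroupFamily.base_injective (add_right_cancel (F.enc_injective κ h))

lemma lookup_cons_of_ne {q : ℕ} (e : Data × ZMod q) (T : Table q) {d : Data} (h : d ≠ e.1) :
    List.lookup d (e :: T) = T.lookup d := by
  obtain ⟨k, v⟩ := e
  simp [List.lookup_cons, beq_eq_false_iff_ne.2 h]

lemma lookup_cons_congr {q : ℕ} (e : Data × ZMod q) {T T' : Table q} {d : Data}
    (h : T.lookup d = T'.lookup d) : List.lookup d (e :: T) = List.lookup d (e :: T') := by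
  obtain ⟨k, v⟩ := e
  simp [List.lookup_cons, h]

/-- When `Z` is random, the shared secret is hidden. The adversary does not query the oracle at it,
so that the destination is uniform and tells nothing about the receiver. -/
lemma within_simPriv_random (hm : Hmac F) (𝒜 : Adversary) (N c n : ℕ) (a y : F.Scalar κ) :
    Within (n / F.q κ)
      (expect (unif (F.Scalar κ)) fun z =>
        simValue F κ N c n (simPriv hm 𝒜 (F.base a) (F.base y) (F.base z))) 2⁻¹ := by
  unfold simValue
  rw [expect_comm, ← expect_const (gameRand F κ N c n) 2⁻¹]
  simp only [expect_gameRand]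
  refine Within.expect_const fun w => Within.expect_const fun coins =>
    Within.expect_const fun h => ?_
  simp only [simPriv, GameRand.choice, GameRand.view]
  generalize simView (F.base a) (F.base y) w coins.enc = view
  generalize runTape 𝒜.choose view h .nil [] = run
  cases parseOff κ w (run.1.nth 1) with
  | none => exact .of_eq (by simp only [expect_const, expect_ind_beq_bool])
  | some st₀ =>
  cases parseOff κ w (run.1.nth 2) with
  | none => exact .of_eq (by simp only [expect_const, expect_ind_beq_bool])
  | some st₁ =>
  simp only [expect_const]
  -- The guess when the table lacks the stealth query and the destination is `s.ρ G`.
  let o : SessRand F κ → List (F.Scalar κ) → Bool := fun s h =>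
    simGuess 𝒜 (.ofList [view, run.1.nth 0,
      s.transcript (F.base a) (F.base s.ρ) (run.1.nth 3)]) h
      (s.msgEntry (F.base a) (F.base s.ρ) (run.1.nth 3) :: run.2)
  have key : (expect (unif Bool) fun b => expect (sessRand F κ) fun s =>
      expect (unifList (F.Scalar κ) n) fun h =>
        ind (o { s with ρ := y + privOffset hm (F.base y) st₀ st₁ b s.tag + s.ρ } h == b)) =
      2⁻¹ := by
    have := expect_ind_beq_const (prodPMF (sessRand F κ) (unifList (F.Scalar κ) n))
      fun x => o x.1 x.2
    simp only [expect_prodPMF] at this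
    rw [← this]
    refine congrArg _ (funext fun b => ?_)
    exact expect_sessRand_shift (fun tag => y + privOffset hm (F.base y) st₀ st₁ b tag)
      fun s => expect (unifList (F.Scalar κ) n) fun h => ind (o s h == b)
  rw [← key]
  refine Within.expect_const fun b => Within.expect_const fun s => ?_
  have := within_runTape_of_hidden 𝒜.guess (.ofList [view, run.1.nth 0,
      s.transcript (F.base a) (s.dest (F.base y) (privOffset hm (F.base y) st₀ st₁ b s.tag))
        (run.1.nth 3)]) (n := n)
    (K := fun _ : Fin 1 => fun z => (s.stealthEntry (F.base a) (F.base z)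
      (privOffset hm (F.base y) st₀ st₁ b s.tag)).1)
    (fun _ => s.stealthEntry_injective _ _)
    (T := fun z => s.table (F.base a) (F.base y) (F.base z)
      (privOffset hm (F.base y) st₀ st₁ b s.tag) (run.1.nth 3) run.2)
    (T' := s.msgEntry (F.base a)
      (s.dest (F.base y) (privOffset hm (F.base y) st₀ st₁ b s.tag)) (run.1.nth 3) :: run.2)
    (fun z d hd => lookup_cons_congr _ (lookup_cons_of_ne _ _ (hd 0)))
    (g := fun d => ind (d.toBool == b)) fun _ => ind_le_one _
  rw [ZMod.card, one_mul] at this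
  simp only [o, ← SessRand.dest_base]
  simp only [SessRand.dest_base] at this ⊢
  exact this

/-- The analogue of `within_simPriv_random` for two sessions. -/
lemma within_simUnlink_random (hm : Hmac F) (𝒜 : Adversary) (N c n : ℕ) (a y : F.Scalar κ) :
    Within ((2 * n : ℕ) / F.q κ)
      (expect (unif (F.Scalar κ)) fun z =>
        simValue F κ N c n (simUnlink hm 𝒜 (F.base a) (F.base y) (F.base z))) 2⁻¹ := by
  unfold simValue
  rw [expect_comm, ← expect_const (gameRand F κ N c n) 2⁻¹]
  simp only [expect_gameRand]
  refine Within.expect_const fun w => Within.expect_const fun coins =>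
    Within.expect_const fun h => ?_
  simp only [simUnlink, GameRand.choice, GameRand.view]
  generalize simView (F.base a) (F.base y) w coins.enc = view
  generalize runTape 𝒜.choose view h .nil [] = run
  have hfalse := expect_ind_beq_beq_const (pure ()) fun _ => false
  simp only [expect_pure] at hfalse
  cases parseOff κ w (run.1.nth 1) with
  | none => exact .of_eq (by simp only [expect_const, hfalse])
  | some st₀ =>
  cases parseOff κ w (run.1.nth 2) with
  | none => exact .of_eq (by simp only [expect_const, hfalse])
  | some st₁ =>
  simp only [expect_const]
  let x₁ : Bool → Bits (2 * κ) → F.Scalar κ := privOffset hm (F.base y) st₀ st₁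
  let x₂ : Bool → Bool → Bits (2 * κ) → Bits (2 * κ) → F.Scalar κ :=
    secondOffset hm (F.base y) st₀ st₁ run.1
  -- The guess when the table lacks the stealth queries and the destinations are `s.ρ G`, `s'.ρ G`.
  let o : SessRand F κ → SessRand F κ → List (F.Scalar κ) → Bool := fun s s' h =>
    simGuess 𝒜 (.ofList [view, run.1.nth 0,
      s.transcript (F.base a) (F.base s.ρ) (run.1.nth 5),
      s'.transcript (F.base a) (F.base s'.ρ) (run.1.nth 6)]) h
      (s'.msgEntry (F.base a) (F.base s'.ρ) (run.1.nth 6) ::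
        s.msgEntry (F.base a) (F.base s.ρ) (run.1.nth 5) :: run.2)
  have key : (expect (unif Bool) fun b₁ => expect (unif Bool) fun b₂ =>
      expect (sessRand F κ) fun s => expect (sessRand F κ) fun s' =>
      expect (unifList (F.Scalar κ) n) fun h =>
        ind (o { s with ρ := y + x₁ b₁ s.tag + s.ρ }
          { s' with ρ := y + x₂ b₁ b₂ s.tag s'.tag + s'.ρ } h == (b₁ == b₂))) = 2⁻¹ := by
    have := expect_ind_beq_beq_const
      (prodPMF (sessRand F κ) (prodPMF (sessRand F κ) (unifList (F.Scalar κ) n)))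
      fun x => o x.1 x.2.1 x.2.2
    simp only [expect_prodPMF] at this
    rw [← this]
    refine congrArg _ (funext fun b₁ => congrArg _ (funext fun b₂ => ?_))
    refine Eq.trans (congrArg _ (funext fun s => ?_))
      (expect_sessRand_shift (fun tag => y + x₁ b₁ tag) fun s =>
        expect (sessRand F κ) fun s' => expect (unifList (F.Scalar κ) n) fun h =>
          ind (o s s' h == (b₁ == b₂)))
    exact expect_sessRand_shift (fun tag => y + x₂ b₁ b₂ s.tag tag)
      fun s' => expect (unifList (F.Scalar κ) n) fun h =>
        ind (o { s with ρ := y + x₁ b₁ s.tag + s.ρ } s' h == (b₁ == b₂))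
  rw [← key]
  refine Within.expect_const fun b₁ => Within.expect_const fun b₂ =>
    Within.expect_const fun s => Within.expect_const fun s' => ?_
  have := within_runTape_of_hidden 𝒜.guess (.ofList [view, run.1.nth 0,
      s.transcript (F.base a) (s.dest (F.base y) (x₁ b₁ s.tag)) (run.1.nth 5),
      s'.transcript (F.base a) (s'.dest (F.base y) (x₂ b₁ b₂ s.tag s'.tag)) (run.1.nth 6)])
    (n := n)
    (K := fun j : Fin 2 => if j = 0 then fun z => (s.stealthEntry (F.base a) (F.base z)
      (x₁ b₁ s.tag)).1 else fun z => (s'.stealthEntry (F.base a) (F.base z)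
      (x₂ b₁ b₂ s.tag s'.tag)).1)
    (fun j => by split_ifs <;> exact SessRand.stealthEntry_injective _ _ _)
    (T := fun z => s'.table (F.base a) (F.base y) (F.base z) (x₂ b₁ b₂ s.tag s'.tag)
      (run.1.nth 6) (s.table (F.base a) (F.base y) (F.base z) (x₁ b₁ s.tag) (run.1.nth 5) run.2))
    (T' := s'.msgEntry (F.base a) (s'.dest (F.base y) (x₂ b₁ b₂ s.tag s'.tag)) (run.1.nth 6) ::
      s.msgEntry (F.base a) (s.dest (F.base y) (x₁ b₁ s.tag)) (run.1.nth 5) :: run.2)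
    (fun z d hd => lookup_cons_congr _ ((lookup_cons_of_ne _ _ (hd 1)).trans
      (lookup_cons_congr _ (lookup_cons_of_ne _ _ (hd 0)))))
    (g := fun d => ind (d.toBool == (b₁ == b₂))) fun _ => ind_le_one _
  rw [ZMod.card] at this
  simp only [o, SessRand.dest_base] at this ⊢
  exact this

end Simulation

/-! ### Functions computable in polynomial time -/

namespace Data

@[simp] lemma left_node (l r : Data) : (node l r).left = l := rfl

@[simp] lemma right_node (l r : Data) : (node l r).right = r := rfl

lemma one_le_size (d : Data) : 1 ≤ d.size := by cases d <;> simp [size]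

lemma size_left_le (d : Data) : d.left.size ≤ d.size := by
  cases d <;> simp [left, size]; omega

lemma size_right_le (d : Data) : d.right.size ≤ d.size := by
  cases d <;> simp [right, size]; omega

lemma len_le_size (d : Data) : d.len ≤ d.size := by
  induction d with
  | nil => simp [len, toList]
  | node l r _ ih => simp only [len, toList, List.length_cons, size] at ih ⊢; omega

lemma size_ofList (l : List Data) : (ofList l).size = (l.map fun d => d.size + 1).sum + 1 := by
  induction l with
  | nil => rfl
  | cons d l ih => simp only [ofList, size, List.map_cons, List.sum_cons, ih]; omega

lemma size_ofList_le {l : List Data} {n B : ℕ} (hl : l.length ≤ n) (hB : ∀ d ∈ l, d.size ≤ B) :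
    (ofList l).size ≤ n * (B + 1) + 1 := by
  rw [size_ofList]
  have := List.sum_le_card_nsmul (l.map fun d => d.size + 1) (B + 1) (by
    intro x hx
    obtain ⟨d, hd, rfl⟩ := List.mem_map.1 hx
    have := hB d hd
    omega)
  rw [List.length_map, smul_eq_mul] at this
  exact Nat.add_le_add_right (this.trans (Nat.mul_le_mul_right _ hl)) 1

lemma size_le_of_mem {d a : Data} (h : a ∈ d.toList) : a.size ≤ d.size := by
  induction d with
  | nil => simp [toList] at h
  | node l r _ ih =>
    rw [toList, List.mem_cons] at h
    rcases h with rfl | h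
    · simp only [size]; omega
    · have := ih h
      simp only [size]; omega

lemma size_ofList_sublist {l l' : List Data} (h : l.Sublist l') :
    (ofList l).size ≤ (ofList l').size := by
  rw [size_ofList, size_ofList]
  exact Nat.add_le_add_right (List.Sublist.sum_le_sum (h.map _) (by simp)) 1

lemma size_ofList_perm {l l' : List Data} (h : l.Perm l') :
    (ofList l).size = (ofList l').size := by
  rw [size_ofList, size_ofList, (h.map _).sum_eq]

lemma toList_right (d : Data) : d.right.toList = d.toList.tail := by cases d <;> rfl

lemma len_unary (n : ℕ) : (unary n).len = n := by simp [len, unary, toList_ofList]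

lemma unary_succ (n : ℕ) : unary (n + 1) = node nil (unary n) := rfl

lemma size_unary (n : ℕ) : (unary n).size = 2 * n + 1 := by
  induction n with
  | zero => rfl
  | succ n ih => rw [unary_succ, size, ih, size]; omega

end Data

lemma eval_nat_mono (P : Polynomial ℕ) : Monotone fun n => P.eval n := by
  intro a b h
  simp only [Polynomial.eval_eq_sum_range]
  gcongr

/-- Functions of trees that are bounded by a polynomial in the size. -/
def PolyBdd (b : Data → ℕ) : Prop := ∃ P : Polynomial ℕ, ∀ x, b x ≤ P.eval x.size

namespace PolyBdd

variable {a b : Data → ℕ}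

lemma mono (hb : PolyBdd b) (h : ∀ x, a x ≤ b x) : PolyBdd a :=
  let ⟨P, hP⟩ := hb
  ⟨P, fun x => (h x).trans (hP x)⟩

lemma const (n : ℕ) : PolyBdd fun _ => n := ⟨Polynomial.C n, fun x => by simp⟩

lemma id : PolyBdd Data.size := ⟨Polynomial.X, fun x => by simp⟩

lemma add (ha : PolyBdd a) (hb : PolyBdd b) : PolyBdd fun x => a x + b x :=
  let ⟨P, hP⟩ := ha
  let ⟨Q, hQ⟩ := hb
  ⟨P + Q, fun x => by rw [Polynomial.eval_add]; exact Nat.add_le_add (hP x) (hQ x)⟩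

lemma mul (ha : PolyBdd a) (hb : PolyBdd b) : PolyBdd fun x => a x * b x :=
  let ⟨P, hP⟩ := ha
  let ⟨Q, hQ⟩ := hb
  ⟨P * Q, fun x => by rw [Polynomial.eval_mul]; exact Nat.mul_le_mul (hP x) (hQ x)⟩

lemma eval (P : Polynomial ℕ) (ha : PolyBdd a) : PolyBdd fun x => P.eval (a x) :=
  let ⟨Q, hQ⟩ := ha
  ⟨P.comp Q, fun x => by rw [Polynomial.eval_comp]; exact eval_nat_mono P (hQ x)⟩

end PolyBdd

lemma Prog.size_eval_le (p : Prog) (x : Data) : (p.eval x).size ≤ p.time x := by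
  induction p generalizing x with
  | id => simp [eval, time]
  | nil => simp [eval, time, Data.size]
  | left => exact (Data.size_left_le x).trans (Nat.le_succ _)
  | right => exact (Data.size_right_le x).trans (Nat.le_succ _)
  | eq =>
    have := x.one_le_size
    simp only [eval, time, Data.ofBool]
    split_ifs <;> simp only [Data.size] <;> omega
  | pair f g hf hg =>
    simp only [eval, time, Data.size]
    have := hf x
    have := hg x
    omega
  | comp g f hg hf =>
    simp only [eval, time]
    have := hg (f.eval x)
    omega
  | ite c f g hc hf hg =>
    simp only [eval, time]
    have := hf x
    have := hg x
    split_ifs <;> omega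
  | loop f hf =>
    simp only [eval, time]
    cases h : x.left.len with
    | zero =>
      have := x.size_right_le
      simp only [Function.iterate_zero, _root_.id]
      omega
    | succ n =>
      rw [Function.iterate_succ_apply', Finset.sum_range_succ]
      have := hf (f.eval^[n] x.right)
      omega

/-- Functions that a program computes in polynomial time. -/
@[fun_prop]
def PolyTime (f : Data → Data) : Prop := ∃ p : Prog, p.IsPolyTime ∧ ∀ x, p.eval x = f x

namespace PolyTime

variable {f g h : Data → Data}

lemma size (hf : PolyTime f) : ∃ P : Polynomial ℕ, ∀ x, (f x).size ≤ P.eval x.size :=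
  let ⟨p, ⟨P, hP⟩, hp⟩ := hf
  ⟨P, fun x => hp x ▸ (p.size_eval_le x).trans (hP x)⟩

lemma polyBdd (hf : PolyTime f) : PolyBdd fun x => (f x).size := hf.size

@[fun_prop]
lemma id : PolyTime fun x => x :=
  ⟨.id, PolyBdd.id.add (.const 1), fun _ => rfl⟩

@[fun_prop]
lemma comp (hg : PolyTime g) (hf : PolyTime f) : PolyTime fun x => g (f x) := by
  obtain ⟨p, hp, hpf⟩ := hf
  obtain ⟨q, ⟨Q, hQ⟩, hqg⟩ := hg
  refine ⟨.comp q p, ?_, fun x => by rw [Prog.eval, hpf, hqg]⟩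
  refine ((PolyBdd.add hp (PolyBdd.eval Q hp)).add (.const 1)).mono fun x => ?_
  simp only [Prog.time]
  gcongr
  exact (hQ _).trans (eval_nat_mono Q (p.size_eval_le x))

@[fun_prop]
lemma left (hf : PolyTime f) : PolyTime fun x => (f x).left :=
  comp (g := Data.left) ⟨.left, PolyBdd.id.add (.const 1), fun _ => rfl⟩ hf

@[fun_prop]
lemma right (hf : PolyTime f) : PolyTime fun x => (f x).right :=
  comp (g := Data.right) ⟨.right, PolyBdd.id.add (.const 1), fun _ => rfl⟩ hf

@[fun_prop]
lemma node (hf : PolyTime f) (hg : PolyTime g) : PolyTime fun x => .node (f x) (g x) := by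
  obtain ⟨p, hp, hpf⟩ := hf
  obtain ⟨q, hq, hqg⟩ := hg
  exact ⟨.pair p q, (PolyBdd.add hp hq).add (.const 1), fun x => by rw [Prog.eval, hpf, hqg]⟩

@[fun_prop]
lemma const (d : Data) : PolyTime fun _ => d := by
  induction d with
  | nil => exact ⟨.nil, PolyBdd.const 1, fun _ => rfl⟩
  | node l r hl hr => exact hl.node hr

end PolyTime

namespace Data

/-- Case distinction on whether a tree is `nil`. -/
def cond (c a b : Data) : Data := if c = nil then b else a

/-- Equality of trees, as a tree. -/
def beq (a b : Data) : Data := ofBool (decide (a = b))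

@[simp] lemma cond_nil (a b : Data) : cond nil a b = b := if_pos rfl

lemma cond_of_ne {c : Data} (h : c ≠ nil) (a b : Data) : cond c a b = a := if_neg h

lemma cond_self (c a : Data) : cond c a a = a := ite_self _

@[simp] lemma cond_ofBool (c : Bool) (a b : Data) : cond (ofBool c) a b = if c then a else b := by
  cases c <;> simp [cond, ofBool]

end Data

namespace PolyTime

variable {f g h : Data → Data}

@[fun_prop]
lemma cond (hf : PolyTime f) (hg : PolyTime g) (hh : PolyTime h) :
    PolyTime fun x => .cond (f x) (g x) (h x) := by
  obtain ⟨p, hp, hpf⟩ := hf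
  obtain ⟨q, hq, hqg⟩ := hg
  obtain ⟨r, hr, hrh⟩ := hh
  refine ⟨.ite p q r, ?_, fun x => by rw [Prog.eval, hpf, hqg, hrh]; rfl⟩
  refine ((PolyBdd.add hp (PolyBdd.add hq hr)).add (.const 1)).mono fun x => ?_
  simp only [Prog.time]
  split_ifs <;> omega

@[fun_prop]
lemma beq (hf : PolyTime f) (hg : PolyTime g) : PolyTime fun x => .beq (f x) (g x) :=
  comp (g := fun x => .beq x.left x.right) ⟨.eq, PolyBdd.id.add (.const 2), fun _ => rfl⟩
    (hf.node hg)

/-- Bounded loops, on states whose size remains polynomial. -/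
lemma iterate {f : Data → Data → Data} {c i : Data → Data}
    (hf : PolyTime fun y => f y.left y.right) (hc : PolyTime c) (hi : PolyTime i)
    {b : Data → ℕ} (hb : PolyBdd b) (h : ∀ x, ∀ n ≤ (c x).len, ((f x)^[n] (i x)).size ≤ b x) :
    PolyTime fun x => (f x)^[(c x).len] (i x) := by
  have hs := hc.polyBdd
  have hi' := hi.polyBdd
  obtain ⟨p, hp, hpf⟩ := node (left id) hf
  obtain ⟨q, hq, hqi⟩ := (show PolyTime fun x => .node (c x) (.node x (i x)) by fun_prop)
  have hit : ∀ x n, p.eval^[n] (.node x (i x)) = .node x ((f x)^[n] (i x)) := by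
    intro x n
    induction n with
    | zero => rfl
    | succ n ih => rw [Function.iterate_succ_apply', ih, Function.iterate_succ_apply', hpf]; rfl
  obtain ⟨P, hP⟩ := hp
  refine ⟨.comp .right (.comp (.loop p) q), ?_, fun x => ?_⟩
  · have h1 := (hs.add (PolyBdd.id.add (hi'.add (.const 3)))).add
      (hs.mul (PolyBdd.eval P (PolyBdd.id.add (hb.add (.const 1)))))
    have h2 := PolyBdd.id.add (hb.add (.const 2))
    refine (((PolyBdd.add hq h1).add h2).add (.const 2)).mono fun x => ?_
    simp only [Prog.time, Prog.eval, hqi, Data.left, Data.right, hit]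
    have e1 : ∑ n ∈ Finset.range (c x).len, p.time (.node x ((f x)^[n] (i x))) ≤
        (c x).size * P.eval (x.size + (b x + 1)) := by
      refine (Finset.sum_le_card_nsmul _ _ (P.eval (x.size + (b x + 1))) fun n hn => ?_).trans ?_
      · refine (hP _).trans (eval_nat_mono P ?_)
        have := h x n (Finset.mem_range.1 hn).le
        simp only [Data.size]
        omega
      · rw [Finset.card_range, smul_eq_mul]
        exact Nat.mul_le_mul_right _ (Data.len_le_size _)
    have e2 := h x _ le_rfl
    simp only [Data.size]
    omega
  · simp only [Prog.eval, hqi, Data.left, Data.right, hit]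

/-- Loops over the entries of a list, on states whose size remains polynomial. -/
lemma foldl {f : Data → Data → Data → Data} {l i : Data → Data}
    (hf : PolyTime fun y => f y.left y.right.left y.right.right) (hl : PolyTime l)
    (hi : PolyTime i) {b : Data → ℕ} (hb : PolyBdd b)
    (h : ∀ x l', l' <+: (l x).toList → (l'.foldl (fun s a => f x a s) (i x)).size ≤ b x) :
    PolyTime fun x => (l x).toList.foldl (fun s a => f x a s) (i x) := by
  have hit : ∀ x n, n ≤ (l x).toList.length →
      (fun s : Data => Data.node s.left.right (f x s.left.left s.right))^[n]
        (.node (l x) (i x)) =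
      .node (.ofList ((l x).toList.drop n))
        (((l x).toList.take n).foldl (fun s a => f x a s) (i x)) := by
    intro x n
    induction n with
    | zero => simp [Data.ofList_toList]
    | succ n ih =>
      intro hn
      rw [Function.iterate_succ_apply', ih (by omega), List.take_succ_eq_append_getElem hn,
        List.foldl_append, List.drop_eq_getElem_cons hn]
      rfl
  have key := iterate (f := fun x s => .node s.left.right (f x s.left.left s.right)) (c := l)
    (i := fun x => .node (l x) (i x)) ?_ hl (hl.node hi) ((hl.polyBdd.add hb).add (.const 1)) ?_
  · have := right key
    convert this using 2 with x
    rw [Data.len, hit x _ le_rfl]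
    simp [Data.right]
  · have := comp hf (show PolyTime fun y => .node y.left (.node y.right.left.left y.right.right)
      by fun_prop)
    simp only [Data.left, Data.right] at this
    exact node (by fun_prop) this
  · intro x n hn
    rw [hit x n hn, Data.size]
    have h1 := Data.size_ofList_sublist (List.drop_sublist n (l x).toList)
    rw [Data.ofList_toList] at h1
    have h2 := h x _ (List.take_prefix n _)
    omega

end PolyTime

namespace Data

/-- Reversal of lists. -/
def rev (d : Data) : Data := d.toList.foldl (fun s a => node a s) nil

lemma foldl_node (l s : List Data) :
    l.foldl (fun s a => node a s) (ofList s) = ofList (l.reverse ++ s) := by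
  induction l generalizing s with
  | nil => simp
  | cons a l ih =>
    rw [List.foldl_cons, ← ofList, ih]
    simp

lemma rev_eq (d : Data) : d.rev = ofList d.toList.reverse := by
  have := foldl_node d.toList []
  rwa [List.append_nil] at this

/-- The entries of a list, up to the length of the first one. -/
def take (u d : Data) : Data := ofList (d.toList.take u.len)

/-- The entries of a list, from the length of the first one. -/
def drop (u d : Data) : Data := right^[u.len] d

lemma right_iterate (n : ℕ) (d : Data) : right^[n] d = ofList (d.toList.drop n) := by
  induction n with
  | zero => simp [ofList_toList]
  | succ n ih =>
    rw [Function.iterate_succ_apply', ih, ← ofList_toList (right _), toList_right, toList_ofList,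
      List.tail_drop]

lemma drop_eq (u d : Data) : drop u d = ofList (d.toList.drop u.len) := right_iterate _ _

end Data

namespace PolyTime

variable {f g h : Data → Data}

@[fun_prop]
lemma rev (hf : PolyTime f) : PolyTime fun x => (f x).rev := by
  refine comp (g := Data.rev) (foldl (f := fun x a s => .node a s) (by fun_prop) (by fun_prop)
    (by fun_prop) PolyBdd.id ?_) hf
  intro x l' hl'
  have := Data.foldl_node l' []
  rw [Data.ofList] at this
  rw [this, List.append_nil, Data.size_ofList_perm (List.reverse_perm l')]
  have := Data.size_ofList_sublist hl'.sublist
  rwa [Data.ofList_toList] at this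

lemma map {f : Data → Data → Data} {l : Data → Data} (hf : PolyTime fun y => f y.left y.right)
    (hl : PolyTime l) : PolyTime fun x => .ofList ((l x).toList.map (f x)) := by
  have hfold : ∀ (x : Data) (l' : List Data),
      l'.foldl (fun s a => Data.node (f x a) s) .nil = .ofList (l'.map (f x)).reverse := by
    intro x l'
    have := Data.foldl_node (l'.map (f x)) []
    rwa [List.append_nil, List.foldl_map] at this
  obtain ⟨P, hP⟩ := hf.size
  have h1 : PolyTime fun x => (l x).toList.foldl (fun s a => Data.node (f x a) s) .nil := by
    refine foldl (f := fun x a s => .node (f x a) s) ?_ hl (by fun_prop)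
      ((hl.polyBdd.mul ((PolyBdd.eval P (PolyBdd.id.add (hl.polyBdd.add (.const 1)))).add
        (.const 1))).add (.const 1)) ?_
    · have := comp hf (show PolyTime fun y => .node y.left y.right.left by fun_prop)
      simp only [Data.left, Data.right] at this
      exact node this (by fun_prop)
    · intro x l' hl'
      rw [hfold]
      refine Data.size_ofList_le ?_ ?_
      · rw [List.length_reverse, List.length_map]
        exact hl'.length_le.trans (Data.len_le_size _)
      · intro d hd
        simp only [List.mem_reverse, List.mem_map] at hd
        obtain ⟨a, ha, rfl⟩ := hd
        refine (hP (.node x a)).trans (eval_nat_mono P ?_)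
        have := Data.size_le_of_mem (hl'.subset ha)
        simp only [Data.size]
        omega
  have := rev h1
  convert this using 2 with x
  rw [hfold, Data.rev_eq, Data.toList_ofList, List.reverse_reverse]

@[fun_prop]
lemma drop (hf : PolyTime f) (hg : PolyTime g) : PolyTime fun x => .drop (f x) (g x) := by
  refine iterate (f := fun _ s => s.right) (by fun_prop) hf hg hg.polyBdd fun x n _ => ?_
  rw [Data.right_iterate]
  refine (Data.size_ofList_sublist (List.drop_sublist _ _)).trans ?_
  rw [Data.ofList_toList]

@[fun_prop]
lemma take (hf : PolyTime f) (hg : PolyTime g) : PolyTime fun x => .take (f x) (g x) := by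
  -- The state consists of the remaining list and the entries taken so far.
  let step : Data → Data := fun s =>
    .cond s.left (.node s.left.right (.node s.left.left s.right)) s
  have hit : ∀ (d : Data) n, step^[n] (.node d .nil) =
      .node (.ofList (d.toList.drop n)) (.ofList (d.toList.take n).reverse) := by
    intro d n
    induction n with
    | zero => simp [Data.ofList_toList, Data.ofList]
    | succ n ih =>
      rw [Function.iterate_succ_apply', ih]
      by_cases hn : n < d.toList.length
      · rw [List.take_succ_eq_append_getElem hn, List.drop_eq_getElem_cons hn,
          List.reverse_append]
        simp [step, Data.cond, Data.ofList, Data.left, Data.right]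
      · rw [List.drop_eq_nil_of_le (by omega), List.drop_eq_nil_of_le (by omega),
          List.take_of_length_le (by omega), List.take_of_length_le (by omega)]
        simp [step, Data.cond, Data.ofList, Data.left]
  have key : PolyTime fun x => (step^[(f x).len] (.node (g x) .nil)).right.rev := by
    refine rev (right (iterate (f := fun _ => step) (by fun_prop) hf (by fun_prop)
      ((hg.polyBdd.add hg.polyBdd).add (.const 1)) fun x n _ => ?_))
    rw [hit, Data.size, Data.size_ofList_perm (List.reverse_perm _)]
    have h1 := Data.size_ofList_sublist (List.drop_sublist n (g x).toList)
    have h2 := Data.size_ofList_sublist (List.take_sublist n (g x).toList)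
    rw [Data.ofList_toList] at h1 h2
    omega
  convert key using 2 with x
  rw [hit, Data.right, Data.rev_eq, Data.toList_ofList, List.reverse_reverse]
  rfl

end PolyTime

/-! ### Unary polynomials and normalized bit strings -/

namespace Data

/-- The value of a polynomial at the length of a list, in unary. -/
def poly (P : Polynomial ℕ) (d : Data) : Data := unary (P.eval d.len)

/-- Addition of a unary number. -/
def addUnary (u d : Data) : Data := (fun s => node nil s)^[u.len] d

lemma size_iterate_node (n : ℕ) (d : Data) :
    ((fun s => node nil s)^[n] d).size = d.size + n * 2 := by
  induction n with
  | zero => simp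
  | succ n ih => rw [Function.iterate_succ_apply', size, ih, size]; ring

lemma addUnary_unary (m n : ℕ) : addUnary (unary m) (unary n) = unary (n + m) := by
  rw [addUnary, len_unary]
  induction m with
  | zero => rfl
  | succ m ih => rw [Function.iterate_succ_apply', ih]; rfl

/-- A truth value as a tree. -/
def norm (d : Data) : Data := ofBool d.toBool

/-- At most `u.len` entries of a list of bits. -/
def trunc (u d : Data) : Data := ofList ((take u d).toList.map norm)

/-- The first `u.len` entries of a list of bits, padded with zeros. -/
def pad (u d : Data) : Data := ofList ((List.range u.len).map fun i => norm (d.nth i))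

lemma norm_eq (d : Data) : d.norm = cond d (node nil nil) nil := by
  by_cases h : d = nil <;> simp [norm, toBool, ofBool, cond, h]

lemma size_norm_le (d : Data) : d.norm.size ≤ 3 := by
  rw [norm_eq, cond]
  split_ifs <;> simp [size]

lemma size_trunc_le (u d : Data) : (trunc u d).size ≤ u.len * 4 + 1 := by
  refine size_ofList_le (B := 3) ?_ ?_
  · rw [List.length_map, take, toList_ofList]
    exact List.length_take_le _ _
  · intro a ha
    obtain ⟨b, -, rfl⟩ := List.mem_map.1 ha
    exact b.size_norm_le

lemma size_pad_le (u d : Data) : (pad u d).size ≤ u.len * 4 + 1 := by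
  refine size_ofList_le (B := 3) (by simp) ?_
  intro a ha
  obtain ⟨b, -, rfl⟩ := List.mem_map.1 ha
  exact size_norm_le _

lemma pad_unary (n : ℕ) (d : Data) : pad (unary n) d = (Bits.dec n d).enc := by
  rw [pad, len_unary, Bits.enc, List.map_ofFn]
  congr 1
  refine List.ext_getElem (by simp) fun i h h' => ?_
  simp [norm, Bits.dec]

lemma nth_eq_left_right (d : Data) (i : ℕ) : d.nth i = (right^[i] d).left := by
  rw [right_iterate, nth]
  have h : ∀ l : List Data, (ofList l).left = l[0]?.getD nil := by
    intro l
    cases l <;> simp [ofList, left]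
  rw [h, List.getElem?_drop, List.getD_eq_getElem?_getD, add_zero]

end Data

namespace PolyTime

variable {f g h : Data → Data}

@[fun_prop]
lemma nth (i : ℕ) (hf : PolyTime f) : PolyTime fun x => (f x).nth i := by
  simp only [Data.nth_eq_left_right]
  refine left ?_
  induction i with
  | zero => exact hf
  | succ i ih =>
    simp only [Function.iterate_succ_apply']
    exact right ih

@[fun_prop]
lemma norm (hf : PolyTime f) : PolyTime fun x => (f x).norm := by
  simp only [Data.norm_eq]
  fun_prop

@[fun_prop]
lemma trunc (hf : PolyTime f) (hg : PolyTime g) : PolyTime fun x => .trunc (f x) (g x) :=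
  map (f := fun _ a => a.norm) (by fun_prop) (by fun_prop)

@[fun_prop]
lemma pad (hf : PolyTime f) (hg : PolyTime g) : PolyTime fun x => .pad (f x) (g x) := by
  -- The state consists of the remaining list and the reversed output.
  let step : Data → Data := fun s => .node s.left.right (.node s.left.left.norm s.right)
  have hit : ∀ (d : Data) n, step^[n] (.node d .nil) =
      .node (Data.right^[n] d)
        (.ofList ((List.range n).map fun i => (d.nth i).norm).reverse) := by
    intro d n
    induction n with
    | zero => rfl
    | succ n ih =>
      rw [Function.iterate_succ_apply', ih, Function.iterate_succ_apply', List.range_succ,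
        List.map_append, List.reverse_append]
      simp [step, Data.left, Data.right, Data.ofList, Data.nth_eq_left_right]
  have key : PolyTime fun x => (step^[(f x).len] (.node (g x) .nil)).right.rev := by
    refine rev (right (iterate (f := fun _ => step) (by fun_prop) hf (by fun_prop)
      ((hg.polyBdd.add (hf.polyBdd.mul (.const 4))).add (.const 2)) fun x n hn => ?_))
    rw [hit, Data.size, Data.size_ofList_perm (List.reverse_perm _), Data.right_iterate]
    have h1 := Data.size_ofList_sublist (List.drop_sublist n (g x).toList)
    rw [Data.ofList_toList] at h1
    have h2 := Data.size_pad_le (.unary n) (g x)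
    rw [Data.pad, Data.len_unary] at h2
    have := Data.len_le_size (f x)
    omega
  convert key using 2 with x
  rw [hit, Data.right, Data.rev_eq, Data.toList_ofList, List.reverse_reverse]
  rfl

@[fun_prop]
lemma addUnary (hf : PolyTime f) (hg : PolyTime g) :
    PolyTime fun x => .addUnary (f x) (g x) := by
  refine iterate (f := fun _ s => .node .nil s) (by fun_prop) hf hg
    (hg.polyBdd.add (hf.polyBdd.mul (.const 2))) fun x n hn => ?_
  rw [Data.size_iterate_node]
  have := Data.len_le_size (f x)
  omega

lemma poly_mul_X {P : Polynomial ℕ} (hP : PolyTime (Data.poly P)) :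
    PolyTime (Data.poly (P * .X)) := by
  have hit : ∀ x n, (Data.addUnary (.poly P x))^[n] .nil = .unary (n * P.eval x.len) := by
    intro x n
    induction n with
    | zero => simp [Data.unary, Data.ofList]
    | succ n ih =>
      rw [Function.iterate_succ_apply', ih, Data.poly, Data.addUnary_unary]
      congr 1
      ring
  have key := iterate (f := fun x s => .addUnary (.poly P x) s) (by fun_prop) PolyTime.id
    (const .nil) ((PolyBdd.id.mul (hP.polyBdd.mul (.const 2))).add (.const 1)) fun x n hn => by
      rw [hit, Data.size_unary, Data.poly, Data.size_unary]
      have := Nat.mul_le_mul (hn.trans x.len_le_size) (le_refl (P.eval x.len * 2))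
      nlinarith
  convert key using 2 with x
  rw [hit, Data.poly, Polynomial.eval_mul, Polynomial.eval_X, mul_comm]

lemma poly (P : Polynomial ℕ) : PolyTime (Data.poly P) := by
  induction P using Polynomial.induction_on with
  | C n =>
    have : Data.poly (.C n) = fun _ => .unary n := by
      funext x
      rw [Data.poly, Polynomial.eval_C]
    exact this ▸ const (.unary n)
  | add P Q hP hQ =>
    have : PolyTime fun x => .addUnary (.poly P x) (.poly Q x) := by fun_prop
    convert this using 2 with x
    rw [Data.poly, Data.poly, Data.poly, Data.addUnary_unary, Polynomial.eval_add, add_comm]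
  | monomial n a h =>
    rw [pow_succ, ← mul_assoc]
    exact poly_mul_X h

@[fun_prop]
lemma poly_comp (P : Polynomial ℕ) (hf : PolyTime f) : PolyTime fun x => .poly P (f x) :=
  comp (poly P) hf

end PolyTime

/-! ### Programs for the group operations -/

section Efficient

variable {par : ℕ → Data} {α β : ℕ → Type} {ea : ∀ κ, α κ → Data} {eb : ∀ κ, β κ → Data}
  {f : ∀ κ, α κ → β κ}

/-- The function on trees that computes an efficient function. -/
def Efficient.fn (h : Efficient par ea eb f) : Data → Data := h.choose.eval

@[fun_prop]
lemma Efficient.polyTime (h : Efficient par ea eb f) : PolyTime h.fn :=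
  ⟨h.choose, h.choose_spec.1, fun _ => rfl⟩

lemma Efficient.fn_eq (h : Efficient par ea eb f) (κ : ℕ) (x : α κ) :
    h.fn (.node (par κ) (ea κ x)) = eb κ (f κ x) := h.choose_spec.2 κ x

end Efficient

lemma Data.len_ofNat (n : ℕ) : (Data.ofNat n).len = n.size := by
  simp [Data.len, Data.ofNat, Data.toList_ofList, Nat.size_eq_bits_len]

namespace GroupFamily

variable (F : GroupFamily) {κ : ℕ}

lemma size_par : ∃ P : Polynomial ℕ, ∀ κ, (F.par κ).size ≤ P.eval κ := by
  obtain ⟨P, hP⟩ := F.size_pp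
  refine ⟨.C 2 * .X + .C 1 + P + .C 1, fun κ => ?_⟩
  have := hP κ
  simp only [par, Data.size, Data.size_unary, Polynomial.eval_add, Polynomial.eval_mul,
    Polynomial.eval_C, Polynomial.eval_X]
  omega

/-- Scalars have polynomial length. -/
lemma exists_scalarLen : ∃ P : Polynomial ℕ, ∀ κ, F.q κ < 2 ^ P.eval κ := by
  obtain ⟨P, hP⟩ := F.size_par
  obtain ⟨Q, hQ⟩ := F.order_eff.polyTime.size
  refine ⟨Q.comp (P + .C 2), fun κ => ?_⟩
  have h := hQ (.node (F.par κ) .nil)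
  have e : F.order_eff.fn (.node (F.par κ) .nil) = .ofNat (F.q κ) := F.order_eff.fn_eq κ ()
  rw [e] at h
  refine (Nat.lt_size_self _).trans_le (Nat.pow_le_pow_right two_pos ?_)
  rw [← Data.len_ofNat]
  refine (Data.len_le_size _).trans (h.trans ?_)
  rw [Polynomial.eval_comp]
  refine eval_nat_mono Q ?_
  have := hP κ
  simp only [Data.size, Polynomial.eval_add, Polynomial.eval_C]
  omega

/-- A polynomial bound for the length of scalars. -/
def scalarLen : Polynomial ℕ := F.exists_scalarLen.choose

lemma q_lt (κ : ℕ) : F.q κ < 2 ^ F.scalarLen.eval κ := F.exists_scalarLen.choose_spec κ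

lemma len_encScalar_le (x : F.Scalar κ) : (encScalar x).len ≤ F.scalarLen.eval κ := by
  rw [encScalar, Data.len_ofNat, Nat.size_le]
  exact (ZMod.val_lt x).trans (F.q_lt κ)

/-- The generator as a function of the encoded public parameters `P`. In this and all following
functions on trees, the suffix `D` stands for `Data`, and `P` for the public parameters. -/
def genD (P : Data) : Data := F.gen_eff.fn (.node P .nil)

/-- Addition of points on trees. -/
def addD (P x y : Data) : Data := F.add_eff.fn (.node P (.node x y))

/-- Multiplication of the point `y` by the scalar `x` on trees. -/
def mulD (P x y : Data) : Data := F.smul_eff.fn (.node P (.node x y))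

/-- Multiplication of the generator by a scalar on trees. -/
def baseD (P x : Data) : Data := F.mulD P x (F.genD P)

/-- The conversion function on trees. -/
def convD (P x : Data) : Data := F.conv_eff.fn (.node P x)

/-- Addition of scalars on trees. -/
def scalarAddD (P x y : Data) : Data := F.scalar_add_eff.fn (.node P (.node x y))

/-- Multiplication of scalars on trees. -/
def scalarMulD (P x y : Data) : Data := F.scalar_mul_eff.fn (.node P (.node x y))

/-- Inversion of scalars on trees. -/
def scalarInvD (P x : Data) : Data := F.scalar_inv_eff.fn (.node P x)

/-- The reduction of a binary numeral modulo `q` on trees. -/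
def reduceD (P d : Data) : Data := F.scalar_reduce_eff.fn (.node P d)

/-- The bound for the length of scalars, in unary. -/
def lenD (P : Data) : Data := .poly F.scalarLen P.left

@[simp] lemma genD_eq : F.genD (F.par κ) = F.enc κ (F.gen κ) := F.gen_eff.fn_eq κ ()

@[simp] lemma addD_eq (x y : F.G κ) :
    F.addD (F.par κ) (F.enc κ x) (F.enc κ y) = F.enc κ (x + y) := F.add_eff.fn_eq κ (x, y)

@[simp] lemma mulD_eq (x : F.Scalar κ) (y : F.G κ) :
    F.mulD (F.par κ) (encScalar x) (F.enc κ y) = F.enc κ (mul x y) := F.smul_eff.fn_eq κ (x, y)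

@[simp] lemma baseD_eq (x : F.Scalar κ) :
    F.baseD (F.par κ) (encScalar x) = F.enc κ (F.base x) := by simp [baseD, base]

@[simp] lemma convD_eq (x : F.G κ) :
    F.convD (F.par κ) (F.enc κ x) = encScalar (F.conv κ x) := F.conv_eff.fn_eq κ x

@[simp] lemma scalarAddD_eq (x y : F.Scalar κ) :
    F.scalarAddD (F.par κ) (encScalar x) (encScalar y) = encScalar (x + y) :=
  F.scalar_add_eff.fn_eq κ (x, y)

@[simp] lemma scalarMulD_eq (x y : F.Scalar κ) :
    F.scalarMulD (F.par κ) (encScalar x) (encScalar y) = encScalar (x * y) :=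
  F.scalar_mul_eff.fn_eq κ (x, y)

@[simp] lemma scalarInvD_eq (x : F.Scalar κ) :
    F.scalarInvD (F.par κ) (encScalar x) = encScalar x⁻¹ := F.scalar_inv_eff.fn_eq κ x

@[simp] lemma reduceD_eq (d : Data) :
    F.reduceD (F.par κ) d = encScalar (d.toNat : F.Scalar κ) := F.scalar_reduce_eff.fn_eq κ d

lemma poly_par_left (P : Polynomial ℕ) : Data.poly P (F.par κ).left = .unary (P.eval κ) := by
  rw [Data.poly, par, Data.left, Data.len_unary]

@[simp] lemma lenD_eq : F.lenD (F.par κ) = .unary (F.scalarLen.eval κ) := F.poly_par_left _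

section PolyTime

variable {f g h : Data → Data}

@[fun_prop]
lemma polyTime_genD (hf : PolyTime f) : PolyTime fun x => F.genD (f x) := by
  unfold genD; fun_prop

@[fun_prop]
lemma polyTime_addD (hf : PolyTime f) (hg : PolyTime g) (hh : PolyTime h) :
    PolyTime fun x => F.addD (f x) (g x) (h x) := by
  unfold addD; fun_prop

@[fun_prop]
lemma polyTime_mulD (hf : PolyTime f) (hg : PolyTime g) (hh : PolyTime h) :
    PolyTime fun x => F.mulD (f x) (g x) (h x) := by
  unfold mulD; fun_prop

@[fun_prop]
lemma polyTime_baseD (hf : PolyTime f) (hg : PolyTime g) :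
    PolyTime fun x => F.baseD (f x) (g x) := by
  unfold baseD; fun_prop

@[fun_prop]
lemma polyTime_convD (hf : PolyTime f) (hg : PolyTime g) :
    PolyTime fun x => F.convD (f x) (g x) := by
  unfold convD; fun_prop

@[fun_prop]
lemma polyTime_scalarAddD (hf : PolyTime f) (hg : PolyTime g) (hh : PolyTime h) :
    PolyTime fun x => F.scalarAddD (f x) (g x) (h x) := by
  unfold scalarAddD; fun_prop

@[fun_prop]
lemma polyTime_scalarMulD (hf : PolyTime f) (hg : PolyTime g) (hh : PolyTime h) :
    PolyTime fun x => F.scalarMulD (f x) (g x) (h x) := by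
  unfold scalarMulD; fun_prop

@[fun_prop]
lemma polyTime_scalarInvD (hf : PolyTime f) (hg : PolyTime g) :
    PolyTime fun x => F.scalarInvD (f x) (g x) := by
  unfold scalarInvD; fun_prop

@[fun_prop]
lemma polyTime_reduceD (hf : PolyTime f) (hg : PolyTime g) :
    PolyTime fun x => F.reduceD (f x) (g x) := by
  unfold reduceD; fun_prop

@[fun_prop]
lemma polyTime_lenD (hf : PolyTime f) : PolyTime fun x => F.lenD (f x) := by
  unfold lenD; fun_prop

end PolyTime

end GroupFamily

/-! ### Sampling from coins -/

/-- A list of bits as a tree. -/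
def encBits (l : List Bool) : Data := .ofList (l.map .ofBool)

lemma toList_encBits (l : List Bool) : (encBits l).toList = l.map .ofBool := Data.toList_ofList _

lemma take_encBits (l l' : List Bool) :
    Data.take (.unary l.length) (encBits (l ++ l')) = encBits l := by
  rw [Data.take, Data.len_unary, toList_encBits, ← List.map_take, List.take_left, encBits]

lemma drop_encBits (l l' : List Bool) :
    Data.drop (.unary l.length) (encBits (l ++ l')) = encBits l' := by
  rw [Data.drop_eq, Data.len_unary, toList_encBits, ← List.map_drop, List.drop_left, encBits]

/-- Encoded samples of a family of distributions can be computed from uniform coins, up to an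
exponentially small error. -/
def Sampleable (F : GroupFamily) {α : ℕ → Type} (enc : ∀ κ, α κ → Data) (p : ∀ κ, PMF (α κ)) :
    Prop :=
  ∃ (n P : Polynomial ℕ) (D : Data → Data), PolyTime D ∧ ∀ κ (f : Data → ℝ≥0∞), (∀ d, f d ≤ 1) →
    Within ((P.eval κ : ℕ) / 2 ^ κ) (expect (p κ) fun a => f (enc κ a))
      (expect (unifList Bool (n.eval κ)) fun l => f (D (.node (F.par κ) (encBits l))))

namespace Sampleable

variable {F : GroupFamily} {α β : ℕ → Type} {ea : ∀ κ, α κ → Data} {eb : ∀ κ, β κ → Data}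
  {p : ∀ κ, PMF (α κ)} {q : ∀ κ, PMF (β κ)}

lemma bits {n : ℕ → ℕ} (P : Polynomial ℕ) (hP : ∀ κ, P.eval κ = n κ) :
    Sampleable F (α := fun κ => Bits (n κ)) (fun _ => Bits.enc) fun _ => unif _ := by
  refine ⟨P, 0, Data.right, by fun_prop, fun κ f _ => .of_eq ?_⟩
  rw [hP]
  exact expect_unif_fin _ fun l => f (encBits l)

lemma bool : Sampleable F (α := fun _ => Bool) (fun _ => Data.ofBool) fun _ => unif Bool := by
  refine ⟨1, 0, fun x => x.right.left, by fun_prop, fun κ f _ => .of_eq ?_⟩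
  rw [Polynomial.eval_one, ← zero_add 1, expect_unifList_succ]
  simp only [expect_unifList_zero]
  rfl

lemma prod (hp : Sampleable F ea p) (hq : Sampleable F eb q) :
    Sampleable F (α := fun κ => α κ × β κ) (fun κ x => .node (ea κ x.1) (eb κ x.2))
      fun κ => prodPMF (p κ) (q κ) := by
  obtain ⟨m, P, D, hD, hp⟩ := hp
  obtain ⟨n, Q, E, hE, hq⟩ := hq
  refine ⟨m + n, P + Q, fun x => .node (D (.node x.left (.take (.poly m x.left.left) x.right)))
    (E (.node x.left (.drop (.poly m x.left.left) x.right))), by fun_prop, fun κ f hf => ?_⟩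
  rw [expect_prodPMF, Polynomial.eval_add, Polynomial.eval_add, expect_unifList_add,
    Nat.cast_add, ENNReal.add_div]
  refine Within.trans (hp κ (fun d => expect (q κ) fun b => f (.node d (eb κ b)))
    fun d => expect_le_one fun _ => hf _) ?_
  refine Within.expect_unifList fun l hl => ?_
  have := hq κ (fun d => f (.node (D (.node (F.par κ) (encBits l))) d)) fun _ => hf _
  convert this using 4 with l'
  simp only [Data.left_node, Data.right_node]
  rw [F.poly_par_left, ← hl, take_encBits, drop_encBits]

end Sampleable

/-- The binary numeral of uniform bits is a uniform number. -/
lemma expect_toNat_encBits (n : ℕ) (f : ℕ → ℝ≥0∞) :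
    (expect (unifList Bool n) fun l => f (encBits l).toNat) =
      (2 ^ n : ℝ≥0∞)⁻¹ * ∑ i ∈ Finset.range (2 ^ n), f i := by
  have hsum : ∀ (m : ℕ) (g : ℕ → ℝ≥0∞), ∑ i ∈ Finset.range (2 * m), g i =
      ∑ i ∈ Finset.range m, g (2 * i) + ∑ i ∈ Finset.range m, g (1 + 2 * i) := by
    intro m g
    induction m with
    | zero => simp
    | succ m ih =>
      rw [Nat.mul_succ, Finset.sum_range_succ, Finset.sum_range_succ, ih,
        Finset.sum_range_succ, Finset.sum_range_succ, add_comm 1]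
      ring
  induction n generalizing f with
  | zero => simp [encBits, Data.ofList, Data.toNat]
  | succ n ih =>
    have hcons : ∀ b l,
        (encBits (b :: l)).toNat = (if b then 1 else 0) + 2 * (encBits l).toNat := by
      intro b l
      cases b <;> simp [encBits, Data.ofList, Data.toNat, Data.ofBool]
    rw [expect_unifList_succ]
    simp only [hcons]
    rw [expect_unif, Fintype.sum_bool, Fintype.card_bool, pow_succ', pow_succ', hsum,
      ENNReal.mul_inv (by simp) (by simp), mul_assoc]
    simp only [if_true, Bool.false_eq_true, if_false, zero_add]
    rw [ih fun i => f (1 + 2 * i), ih fun i => f (2 * i), ← mul_add, add_comm (∑ _ ∈ _, _)]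
    norm_num

/-- A uniform number below `M`, reduced modulo `q`, is close to uniform. -/
lemma within_sum_mod {q : ℕ} [NeZero q] {M : ℕ} (hM : 0 < M) {f : ZMod q → ℝ≥0∞}
    (hf : ∀ x, f x ≤ 1) :
    Within (q / M) (expect (unif (ZMod q)) f)
      ((M : ℝ≥0∞)⁻¹ * ∑ i ∈ Finset.range M, f (i : ZMod q)) := by
  have hq : 0 < q := NeZero.pos q
  set t := M / q
  set s := M % q
  have hs : s < q := Nat.mod_lt _ hq
  have hMts : M = q * t + s := (Nat.div_add_mod M q).symm
  set G := ∑ x, f x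
  have hG : G ≤ q := by
    calc G ≤ ∑ _x : ZMod q, 1 := Finset.sum_le_sum fun x _ => hf x
      _ = q := by simp [ZMod.card]
  have hblock : ∑ i ∈ Finset.range q, f (i : ZMod q) = G := by
    refine Finset.sum_bij (fun i _ => (i : ZMod q)) (by simp) ?_ ?_ (by simp)
    · intro i hi j hj h
      have := (ZMod.natCast_eq_natCast_iff' i j q).1 h
      rwa [Nat.mod_eq_of_lt (Finset.mem_range.1 hi), Nat.mod_eq_of_lt (Finset.mem_range.1 hj)]
        at this
    · intro x _
      exact ⟨x.val, Finset.mem_range.2 (ZMod.val_lt x), ZMod.natCast_zmod_val x⟩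
  have hblocks : ∀ t : ℕ, ∑ i ∈ Finset.range (q * t), f (i : ZMod q) = t * G := by
    intro t
    induction t with
    | zero => simp
    | succ t ih =>
      rw [Nat.mul_succ, Finset.sum_range_add, ih]
      simp [hblock, add_mul]
  set R := ∑ i ∈ Finset.range s, f (i : ZMod q)
  have hR : R ≤ s := by
    calc R ≤ ∑ _i ∈ Finset.range s, 1 := Finset.sum_le_sum fun x _ => hf _
      _ = s := by simp
  have hsum : ∑ i ∈ Finset.range M, f (i : ZMod q) = t * G + R := by
    rw [hMts, Finset.sum_range_add, hblocks]
    simp [R]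
  rw [hsum, expect_unif, ZMod.card]
  have hM0 : (M : ℝ≥0∞) ≠ 0 := by simp; omega
  have hMt : (M : ℝ≥0∞) ≠ ∞ := by simp
  have hq0 : (q : ℝ≥0∞) ≠ 0 := by simp; omega
  have hqt : (q : ℝ≥0∞) ≠ ∞ := by simp
  have e1 : (M : ℝ≥0∞)⁻¹ * M = 1 := ENNReal.inv_mul_cancel hM0 hMt
  have e2 : (q : ℝ≥0∞)⁻¹ * q = 1 := ENNReal.inv_mul_cancel hq0 hqt
  have hMts' : (M : ℝ≥0∞) = q * t + s := by exact_mod_cast hMts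
  have hsq : (s : ℝ≥0∞) ≤ q := by exact_mod_cast hs.le
  -- Split `M / q` into full blocks and a remainder.
  have key : (q : ℝ≥0∞)⁻¹ * G =
      (M : ℝ≥0∞)⁻¹ * (t * G) + (M : ℝ≥0∞)⁻¹ * (s * ((q : ℝ≥0∞)⁻¹ * G)) := by
    calc (q : ℝ≥0∞)⁻¹ * G = ((M : ℝ≥0∞)⁻¹ * M) * ((q : ℝ≥0∞)⁻¹ * G) := by rw [e1, one_mul]
      _ = (M : ℝ≥0∞)⁻¹ * (((q : ℝ≥0∞)⁻¹ * q) * (t * G)) +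
          (M : ℝ≥0∞)⁻¹ * (s * ((q : ℝ≥0∞)⁻¹ * G)) := by
        rw [show (M : ℝ≥0∞)⁻¹ * M = (M : ℝ≥0∞)⁻¹ * (q * t + s) by rw [← hMts']]
        ring
      _ = _ := by rw [e2, one_mul]
  have hqG : (q : ℝ≥0∞)⁻¹ * G ≤ 1 := by
    calc _ ≤ (q : ℝ≥0∞)⁻¹ * q := by gcongr
      _ = 1 := e2
  rw [mul_add, key, ENNReal.div_eq_inv_mul]
  constructor
  · gcongr ?_ + ?_
    · exact le_self_add
    · gcongr
      calc (s : ℝ≥0∞) * ((q : ℝ≥0∞)⁻¹ * G) ≤ s * 1 := by gcongr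
        _ ≤ q := by rwa [mul_one]
  · gcongr ?_ + ?_
    · exact le_self_add
    · gcongr
      exact hR.trans hsq

namespace Sampleable

variable {F : GroupFamily} {α : ℕ → Type} {ea : ∀ κ, α κ → Data} {p : ∀ κ, PMF (α κ)}

lemma scalar : Sampleable F (α := F.Scalar) (fun _ => encScalar) fun _ => unif _ := by
  refine ⟨F.scalarLen + .X, 1, fun x => F.reduceD x.left x.right, by fun_prop, fun κ f hf => ?_⟩
  simp only [Data.left, Data.right, F.reduceD_eq]
  rw [expect_toNat_encBits _ fun n => f (encScalar (n : F.Scalar κ))]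
  have := within_sum_mod (q := F.q κ) (M := 2 ^ (F.scalarLen + .X).eval κ) (by positivity)
    (f := fun x => f (encScalar x)) fun _ => hf _
  push_cast at this
  refine this.mono ?_
  simp only [Polynomial.eval_add, Polynomial.eval_X, Polynomial.eval_one, pow_add, Nat.cast_one]
  rw [ENNReal.div_le_iff (by simp) (by finiteness), ← mul_assoc, mul_comm (1 / _), mul_assoc,
    one_div, ENNReal.inv_mul_cancel (by simp) (by finiteness), mul_one]
  exact_mod_cast (F.q_lt κ).le

end Sampleable

/-- The list of the values of a function at the first `m` blocks of length `n` of a list. -/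
def Data.blocks (D : Data → Data → Data) (P : Data) (m n : ℕ) (d : Data) : Data :=
  .ofList ((List.range m).map fun j => D P (.ofList ((d.toList.drop (j * n)).take n)))

lemma PolyTime.blocks {D : Data → Data → Data} (hD : PolyTime fun y => D y.left y.right)
    {P u v d : Data → Data} (hP : PolyTime P) (hu : PolyTime u) (hv : PolyTime v)
    (hd : PolyTime d) :
    PolyTime fun x => Data.blocks D (P x) (u x).len (v x).len (d x) := by
  let step : Data → Data → Data := fun x s =>
    .node (.drop (v x) s.left) (.node (D (P x) (.take (v x) s.left)) s.right)
  have hstep : PolyTime fun y => step y.left y.right := by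
    have := comp hD (show PolyTime fun y => .node (P y.left) (.take (v y.left) y.right.left)
      by fun_prop)
    simp only [Data.left_node, Data.right_node] at this
    exact node (by fun_prop) (node this (by fun_prop))
  have hit : ∀ x n, (step x)^[n] (.node (d x) .nil) =
      .node (.ofList ((d x).toList.drop (n * (v x).len)))
        (.ofList ((List.range n).map fun j => D (P x) (.ofList
          (((d x).toList.drop (j * (v x).len)).take (v x).len))).reverse) := by
    intro x n
    induction n with
    | zero => simp [Data.ofList, Data.ofList_toList]
    | succ n ih =>
      rw [Function.iterate_succ_apply', ih, List.range_succ, List.map_append, List.reverse_append]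
      simp [step, Data.left, Data.right, Data.ofList, Data.drop_eq, Data.take, Data.toList_ofList,
        Nat.succ_mul]
  obtain ⟨Q, hQ⟩ := hD.size
  have hblock : ∀ x n, (Data.ofList (((d x).toList.drop n).take (v x).len)).size ≤ (d x).size := by
    intro x n
    refine (Data.size_ofList_sublist ((List.take_sublist _ _).trans (List.drop_sublist _ _))).trans
      ?_
    rw [Data.ofList_toList]
  have key : PolyTime fun x => ((step x)^[(u x).len] (.node (d x) .nil)).right.rev := by
    refine rev (right (iterate hstep hu (by fun_prop) ((hd.polyBdd.add (hu.polyBdd.mul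
      ((PolyBdd.eval Q (hP.polyBdd.add (hd.polyBdd.add (.const 1)))).add (.const 1)))).add
      (.const 2)) fun x n hn => ?_))
    rw [hit, Data.size]
    have h1 := Data.size_ofList_sublist (List.drop_sublist (n * (v x).len) (d x).toList)
    rw [Data.ofList_toList] at h1
    have h2 := Data.size_ofList_le (l := ((List.range n).map fun j => D (P x) (.ofList
          (((d x).toList.drop (j * (v x).len)).take (v x).len))).reverse) (n := (u x).size)
          (B := Q.eval ((P x).size + ((d x).size + 1)))
          (by simpa using hn.trans (Data.len_le_size _))
          (by
            intro a ha
            simp only [List.mem_reverse, List.mem_map] at ha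
            obtain ⟨j, -, rfl⟩ := ha
            refine (hQ (.node (P x) _)).trans (eval_nat_mono Q ?_)
            have := hblock x (j * (v x).len)
            simp only [Data.size]
            omega)
    omega
  convert key using 2 with x
  rw [hit, Data.right, Data.rev_eq, Data.toList_ofList, List.reverse_reverse]
  rfl

lemma Data.blocks_append (D : Data → Data → Data) (P : Data) (m : ℕ) (l l' : List Bool) :
    blocks D P (m + 1) l.length (encBits (l ++ l')) =
      node (D P (encBits l)) (blocks D P m l.length (encBits l')) := by
  unfold blocks
  rw [List.range_succ_eq_map, List.map_cons, List.map_map, ofList]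
  congr 1
  · rw [zero_mul, List.drop_zero, toList_encBits, List.map_append, List.take_left' (by simp)]
    rfl
  · congr 1
    refine List.map_congr_left fun j _ => ?_
    simp only [Function.comp, toList_encBits, Nat.succ_eq_add_one, Nat.add_mul, one_mul]
    rw [List.map_append, add_comm, ← List.drop_drop, List.drop_left' (by simp)]

lemma Sampleable.list {F : GroupFamily} {α : ℕ → Type} [∀ κ, Fintype (α κ)]
    [∀ κ, Nonempty (α κ)] {ea : ∀ κ, α κ → Data} (hp : Sampleable F ea fun κ => unif (α κ))
    (m : Polynomial ℕ) :
    Sampleable F (α := fun κ => List (α κ)) (fun κ l => .ofList (l.map (ea κ)))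
      fun κ => unifList (α κ) (m.eval κ) := by
  obtain ⟨n, P, D, hD, hp⟩ := hp
  refine ⟨m * n, m * P, fun x => Data.blocks (fun P d => D (.node P d)) x.left
    (Data.poly m x.left.left).len (Data.poly n x.left.left).len x.right,
    PolyTime.blocks (by fun_prop) (by fun_prop) (by fun_prop) (by fun_prop) (by fun_prop),
    fun κ f hf => ?_⟩
  simp only [Data.left_node, Data.right_node]
  rw [F.poly_par_left, F.poly_par_left, Data.len_unary, Data.len_unary,
    Polynomial.eval_mul, Polynomial.eval_mul]
  generalize m.eval κ = m
  induction m generalizing f with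
  | zero => exact .of_eq (by simp [Data.blocks, Data.ofList])
  | succ m ih =>
    rw [Nat.succ_mul, Nat.succ_mul, add_comm _ (n.eval κ), add_comm _ (P.eval κ),
      expect_unifList_succ, expect_unifList_add, Nat.cast_add, ENNReal.add_div]
    refine Within.trans (hp κ (fun d => expect (unifList (α κ) m) fun l =>
      f (.node d (.ofList (l.map (ea κ))))) fun d => expect_le_one fun _ => hf _) ?_
    refine Within.expect_unifList fun l hl => ?_
    have := ih (fun d => f (.node (D (.node (F.par κ) (encBits l))) d)) fun _ => hf _
    convert this using 4 with l'
    rw [← hl, Data.blocks_append]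

/-! ### A program that runs oracle algorithms -/

lemma encScalar_eq_nil_iff {q : ℕ} [NeZero q] (x : ZMod q) : encScalar x = .nil ↔ x = 0 := by
  rw [encScalar, ← ZMod.val_eq_zero, ← Nat.size_eq_zero, ← Data.len_ofNat]
  cases Data.ofNat x.val <;> simp [Data.len, Data.toList]

lemma cond_encScalar {q : ℕ} [NeZero q] (x : ZMod q) (a b : Data) :
    Data.cond (encScalar x) a b = if x = 0 then b else a := by
  simp [Data.cond, encScalar_eq_nil_iff]

lemma Data.trunc_encScalar {q : ℕ} (n : ℕ) (x : ZMod q) (h : (encScalar x).len ≤ n) :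
    trunc (unary n) (encScalar x) = encScalar x := by
  have hnorm : ∀ b, norm (ofBool b) = ofBool b := by intro b; cases b <;> rfl
  have : (encScalar x).toList.map norm = (encScalar x).toList := by
    rw [encScalar, ofNat, toList_ofList, List.map_map]
    exact List.map_congr_left fun b _ => hnorm b
  rw [trunc, take, toList_ofList, len_unary, List.take_of_length_le h, this, ofList_toList]

lemma Data.beq_ofBool (a b : Bool) : beq (ofBool a) (ofBool b) = ofBool (a == b) := by
  cases a <;> cases b <;> rfl

/-- The oracle table as a tree. -/
def encTable {q : ℕ} (T : Table q) : Data := .ofList (T.map fun e => .node e.1 (encScalar e.2))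

/-- A list of scalars as a tree. -/
def encScalars {q : ℕ} (l : List (ZMod q)) : Data := .ofList (l.map encScalar)

/-- Look up a table: the result is `nil` or `node nil v`. -/
def lookupD (T d : Data) : Data :=
  T.toList.foldl (fun s e => .cond s s (.cond (.beq e.left d) (.node .nil e.right) .nil)) .nil

lemma foldl_lookup_of_ne_nil (l : List Data) (d : Data) {s : Data} (hs : s ≠ .nil) :
    l.foldl (fun s e => Data.cond s s (.cond (.beq e.left d) (.node .nil e.right) .nil)) s = s := by
  induction l with
  | nil => rfl
  | cons e l ih => rw [List.foldl_cons, Data.cond, if_neg hs, ih]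

lemma lookupD_encTable {q : ℕ} (T : Table q) (d : Data) :
    lookupD (encTable T) d =
      ((T.lookup d).map fun v => Data.node .nil (encScalar v)).getD .nil := by
  rw [lookupD, encTable, Data.toList_ofList]
  induction T with
  | nil => rfl
  | cons e T ih =>
    obtain ⟨k, v⟩ := e
    rw [List.map_cons, List.foldl_cons, List.lookup_cons]
    by_cases h : d = k
    · subst h
      rw [foldl_lookup_of_ne_nil]
      · simp [Data.cond, Data.beq, Data.ofBool]
      · simp [Data.cond, Data.beq, Data.ofBool]
    · rw [beq_eq_false_iff_ne.2 h]
      simpa [Data.cond, Data.beq, Data.ofBool, Ne.symm h] using ih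

@[fun_prop]
lemma PolyTime.lookupD {f g : Data → Data} (hf : PolyTime f) (hg : PolyTime g) :
    PolyTime fun x => lookupD (f x) (g x) := by
  refine foldl (f := fun x e s => .cond s s (.cond (.beq e.left (g x)) (.node .nil e.right) .nil))
    (by fun_prop) hf (by fun_prop) ((hf.polyBdd.add (.const 2))) fun x l' hl' => ?_
  have key : ∀ (l : List Data) (s : Data) (B : ℕ), s.size ≤ B + 2 → (∀ e ∈ l, e.size ≤ B) →
      (l.foldl (fun s e => Data.cond s s (.cond (.beq e.left (g x)) (.node .nil e.right) .nil))
        s).size ≤ B + 2 := by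
    intro l
    induction l with
    | nil => exact fun s B h _ => h
    | cons e l ih =>
      intro s B hs hl
      refine ih _ B ?_ fun e he => hl e (List.mem_cons_of_mem _ he)
      have := hl e List.mem_cons_self
      have := e.size_right_le
      dsimp only
      unfold Data.cond
      split_ifs <;> (try simp only [Data.size]) <;> omega
  refine key _ _ _ (by simp [Data.size]) fun e he => ?_
  exact Data.size_le_of_mem (hl'.subset he)

section Run

variable (F : GroupFamily) (p : Prog)

/-- The oracle answer to the query `d` when the next fresh value is `v`. -/
def answerD (P T d v : Data) : Data :=
  .trunc (F.lenD P) (.cond (lookupD T d) (lookupD T d).right v)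

/-- The table after the query `d` when the next fresh value is `v`. -/
def insertD (T d v : Data) : Data := .cond (lookupD T d) T (.node (.node d v) T)

/-- One query of an oracle algorithm. The state consists of the answers, the table and the
tape. -/
def stepD (P input s : Data) : Data :=
  .cond (p.eval (.node input s.left)).left
    (.node (.node (answerD F P s.right.left (p.eval (.node input s.left)).right
        s.right.right.left) s.left)
      (.node (insertD s.right.left (p.eval (.node input s.left)).right s.right.right.left)
        s.right.right.right)) s

/-- The output and the table of a state of an oracle algorithm. -/
def finishD (input s : Data) : Data :=
  .node (.cond (p.eval (.node input s.left)).left .nil (p.eval (.node input s.left)).right)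
    s.right.left

/-- The run of an oracle algorithm on a tape of fresh oracle values. -/
def runD (P input tape T : Data) : Data :=
  finishD p input ((stepD F p P input)^[tape.len] (.node .nil (.node T tape)))

variable {F} {κ : ℕ}

lemma answerD_eq (T : Table (F.q κ)) (d : Data) (v : F.Scalar κ) :
    answerD F (F.par κ) (encTable T) d (encScalar v) = encScalar (T.get d v) := by
  rw [answerD, F.lenD_eq, lookupD_encTable, Table.get]
  cases T.lookup d with
  | none => exact Data.trunc_encScalar _ _ (F.len_encScalar_le _)
  | some w => exact Data.trunc_encScalar _ _ (F.len_encScalar_le _)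

lemma insertD_eq (T : Table (F.q κ)) (d : Data) (v : F.Scalar κ) :
    insertD (encTable T) d (encScalar v) = encTable (T.insert d v) := by
  rw [insertD, lookupD_encTable, Table.insert]
  cases T.lookup d with
  | none => rfl
  | some w => rfl

lemma runD_aux (input : Data) (tape : List (F.Scalar κ)) (answers : Data) (T : Table (F.q κ)) :
    finishD p input ((stepD F p (F.par κ) input)^[tape.length]
      (.node answers (.node (encTable T) (encScalars tape)))) =
    .node (runTape p input tape answers T).1 (encTable (runTape p input tape answers T).2) := by
  induction tape generalizing answers T with
  | nil =>
    simp only [List.length_nil, Function.iterate_zero, id, finishD, Data.left_node,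
      Data.right_node, runTape, haltOutput]
    by_cases h : (p.eval (.node input answers)).left = .nil
    · rw [h, Data.cond_nil, if_pos rfl]
    · rw [Data.cond_of_ne h, if_neg h]
  | cons v tape ih =>
    rw [runTape]
    by_cases h : (p.eval (.node input answers)).left = .nil
    · have hfix : ∀ n tp, (stepD F p (F.par κ) input)^[n]
          (.node answers (.node (encTable T) tp)) = .node answers (.node (encTable T) tp) := by
        intro n tp
        exact Function.iterate_fixed (by simp [stepD, h]) n
      rw [hfix, if_pos h]
      simp [finishD, h]
    · rw [if_neg h, ← ih, List.length_cons, Function.iterate_succ_apply]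
      congr 2
      simp only [stepD, Data.left_node, Data.right_node]
      rw [Data.cond_of_ne h]
      rw [← answerD_eq, ← insertD_eq]
      rfl

lemma runD_eq (input : Data) (tape : List (F.Scalar κ)) (T : Table (F.q κ)) :
    runD F p (F.par κ) input (encScalars tape) (encTable T) =
      .node (runTape p input tape .nil T).1 (encTable (runTape p input tape .nil T).2) := by
  have : (encScalars tape).len = tape.length := by
    simp [encScalars, Data.len, Data.toList_ofList]
  rw [runD, this, runD_aux]

@[fun_prop]
lemma PolyTime.answerD {f g h k : Data → Data} (hf : PolyTime f) (hg : PolyTime g)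
    (hh : PolyTime h) (hk : PolyTime k) : PolyTime fun x => answerD F (f x) (g x) (h x) (k x) := by
  unfold Dao2.answerD; fun_prop

@[fun_prop]
lemma PolyTime.insertD {f g h : Data → Data} (hf : PolyTime f) (hg : PolyTime g)
    (hh : PolyTime h) : PolyTime fun x => insertD (f x) (g x) (h x) := by
  unfold Dao2.insertD; fun_prop

lemma size_insertD_le (T d v : Data) : (insertD T d v).size ≤ T.size + d.size + v.size + 2 := by
  unfold insertD Data.cond
  split_ifs
  · simp only [Data.size]; omega
  · omega

/-- The state of a run grows polynomially: answers have bounded length, and each round adds one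
query and one entry of the tape to the table. -/
lemma size_stepD_iterate_le {P input T tape : Data} {Q : Polynomial ℕ}
    (hQ : ∀ x, (p.eval x).size ≤ Q.eval x.size) (n : ℕ) :
    ((stepD F p P input)^[n] (.node .nil (.node T tape))).left.size ≤
        1 + n * ((F.lenD P).len * 4 + 2) ∧
      ((stepD F p P input)^[n] (.node .nil (.node T tape))).right.right.size ≤ tape.size ∧
      ((stepD F p P input)^[n] (.node .nil (.node T tape))).right.left.size ≤ T.size +
        n * (Q.eval (input.size + (2 + n * ((F.lenD P).len * 4 + 2))) + tape.size + 2) := by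
  induction n with
  | zero => simp [Data.size]
  | succ n ih =>
    rw [Function.iterate_succ_apply']
    generalize (stepD F p P input)^[n] (.node .nil (.node T tape)) = s at ih
    obtain ⟨h1, h2, h3⟩ := ih
    set B := (F.lenD P).len * 4 + 2
    have hmono : Q.eval (input.size + (2 + n * B)) ≤ Q.eval (input.size + (2 + (n + 1) * B)) :=
      eval_nat_mono Q (by rw [add_mul]; omega)
    have hm : n * (Q.eval (input.size + (2 + n * B)) + tape.size + 2) ≤
        n * (Q.eval (input.size + (2 + (n + 1) * B)) + tape.size + 2) := by gcongr
    have e1 : (n + 1) * B = n * B + B := by ring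
    have e2 : (n + 1) * (Q.eval (input.size + (2 + (n + 1) * B)) + tape.size + 2) =
        n * (Q.eval (input.size + (2 + (n + 1) * B)) + tape.size + 2) +
          (Q.eval (input.size + (2 + (n + 1) * B)) + tape.size + 2) := by ring
    rw [e2]
    unfold stepD Data.cond
    split_ifs with h
    · exact ⟨by omega, h2, by omega⟩
    · simp only [Data.left_node, Data.right_node]
      refine ⟨?_, (Data.size_right_le _).trans h2, ?_⟩
      · have := Data.size_trunc_le (F.lenD P) (.cond (lookupD s.right.left
          (p.eval (.node input s.left)).right) (lookupD s.right.left
          (p.eval (.node input s.left)).right).right s.right.right.left)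
        simp only [Data.size, answerD]
        omega
      · refine (size_insertD_le _ _ _).trans ?_
        have a1 := s.right.right.size_left_le
        have a2 := (p.eval (.node input s.left)).size_right_le
        have a3 := hQ (.node input s.left)
        have a4 : Q.eval (Data.node input s.left).size ≤ Q.eval (input.size + (2 + n * B)) :=
          eval_nat_mono Q (by simp only [Data.size]; omega)
        omega

lemma PolyTime.runD {p : Prog} (hp : p.IsPolyTime) {P input tape T : Data → Data}
    (hP : PolyTime P) (hi : PolyTime input) (ht : PolyTime tape) (hT : PolyTime T) :
    PolyTime fun x => runD F p (P x) (input x) (tape x) (T x) := by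
  have hp' : PolyTime p.eval := ⟨p, hp, fun _ => rfl⟩
  have hl := PolyTime.polyBdd (f := fun x => F.lenD (P x)) (by fun_prop)
  obtain ⟨Q, hQ⟩ := hp'.size
  have key : PolyTime fun x =>
      (stepD F p (P x) (input x))^[(tape x).len] (.node .nil (.node (T x) (tape x))) := by
    have hB := (hl.mul (.const 4)).add (.const 2)
    have hnB := (PolyBdd.const 2).add (ht.polyBdd.mul hB)
    refine iterate (f := fun x s => stepD F p (P x) (input x) s) (by unfold stepD; fun_prop) ht
      (by fun_prop) ((hnB.add (hT.polyBdd.add (ht.polyBdd.mul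
        (((PolyBdd.eval Q (hi.polyBdd.add hnB)).add ht.polyBdd).add (.const 2))))).add
        (ht.polyBdd.add (.const 3))) fun x n hn => ?_
    obtain ⟨h1, h2, h3⟩ := size_stepD_iterate_le (F := F) (P := P x) (input := input x) (T := T x)
      (tape := tape x) p hQ n
    generalize (stepD F p (P x) (input x))^[n] (.node .nil (.node (T x) (tape x))) = s at *
    have hn' := hn.trans (Data.len_le_size _)
    have hl' := Data.len_le_size (F.lenD (P x))
    have m1 : n * ((F.lenD (P x)).len * 4 + 2) ≤
        (tape x).size * ((F.lenD (P x)).size * 4 + 2) := by gcongr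
    have m2 : n * (Q.eval ((input x).size + (2 + n * ((F.lenD (P x)).len * 4 + 2))) +
        (tape x).size + 2) ≤ (tape x).size * (Q.eval ((input x).size +
        (2 + (tape x).size * ((F.lenD (P x)).size * 4 + 2))) + (tape x).size + 2) := by
      refine Nat.mul_le_mul hn' ?_
      gcongr
      exact eval_nat_mono Q (by omega)
    have hs : s.size ≤ s.left.size + s.right.left.size + s.right.right.size + 2 := by
      rcases s with _ | ⟨a, _ | ⟨b, c⟩⟩ <;> (simp [Data.size, Data.left, Data.right]; try omega)
    omega
  unfold Dao2.runD finishD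
  fun_prop

end Run

/-! ### Protocol steps as programs -/

section Protocol

variable (F : GroupFamily)

/-- The conversion of the nonce point in a simulated signature. -/
def nonceD (P A u v : Data) : Data := F.convD P (F.addD P (F.baseD P u) (F.mulD P v A))

/-- `simS` on trees. -/
def simSD (P A u v : Data) : Data := F.scalarMulD P (nonceD F P A u v) (F.scalarInvD P v)

/-- `simSig` on trees. A scalar is zero exactly if its encoding is `nil`. -/
def simSigD (P A u v : Data) : Data :=
  .cond (nonceD F P A u v) (.cond (simSD F P A u v) (.node (nonceD F P A u v) (simSD F P A u v))
    .nil) .nil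

/-- `simHash` on trees. -/
def simHashD (P A u v e : Data) : Data :=
  .cond (nonceD F P A u v) (F.scalarMulD P u (simSD F P A u v)) e

/-- The destination of a simulated session with randomness `s`. -/
def destD (P Y x s : Data) : Data :=
  F.addD P (F.addD P Y (F.baseD P x)) (F.baseD P s.right.right.left)

/-- The transcript of a simulated session with randomness `s`, for a receiver with offset `x`. -/
def transcriptD (P A Y x pay s : Data) : Data :=
  .ofList [.node pay (destD F P Y x s),
    simSigD F P A s.right.right.right.left s.right.right.right.right.left,
    destD F P Y x s, s.left, s.right.left]

/-- The oracle table after a simulated session with randomness `s`. -/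
def tableD (P A Y Z x pay s T : Data) : Data :=
  .node (.node (msgKey (.node pay (destD F P Y x s)))
      (simHashD F P A s.right.right.right.left s.right.right.right.right.left
        s.right.right.right.right.right))
    (.node (.node (stealthKey (F.addD P Z (F.mulD P x A)) s.right.left) s.right.right.left) T)

/-- The length of tags and chain codes, in unary. -/
def tagLenD (P : Data) : Data := .poly (.C 2 * .X) P.left

/-- `simView` on trees. -/
def viewD (P A Y w coins : Data) : Data :=
  .ofList [P, coins, A, .ofList (w.toList.map fun x => F.addD P Y (F.baseD P x))]

/-- `parseOff` on trees; an invalid choice is `nil`. -/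
def parseOffD (P w d : Data) : Data :=
  .cond (.drop (d.nth 0) w)
    (.node (F.scalarAddD P (.left (.drop (d.nth 0) w)) (F.reduceD P (d.nth 1)))
      (.pad (tagLenD P) (d.nth 2))) .nil

variable {F} (hm : Hmac F)

/-- The call of the HMAC in key derivation, for the state with offset encoded by `st`. -/
def hmacD (P Y st tag : Data) : Data :=
  hm.eff.fn (.node P (.node st.right (.node (F.addD P Y (F.baseD P st.left)) tag)))

/-- Key derivation on offsets. Truncation and padding change nothing on proper inputs. They keep
the size of the state bounded in loops. -/
def deriveOffD (P Y st tag : Data) : Data :=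
  .node (.trunc (F.lenD P) (F.scalarAddD P st.left (F.reduceD P (hmacD hm P Y st tag).left)))
    (.pad (tagLenD P) (hmacD hm P Y st tag).right)

/-- Key derivation along a list of tags. -/
def deriveAllD (P Y tags st : Data) : Data :=
  tags.toList.foldl (fun st tag => deriveOffD hm P Y st (.pad (tagLenD P) tag)) st

/-- `privOffset` on trees, for a session with randomness `s`. -/
def privOffsetD (P Y st₀ st₁ b s : Data) : Data :=
  (deriveOffD hm P Y (.cond b st₁ st₀) s.left).left

/-- `secondOffset` on trees, for sessions with randomness `s₁` and `s₂`. -/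
def secondOffsetD (P Y st₀ st₁ choice b₁ b₂ s₁ s₂ : Data) : Data :=
  (deriveOffD hm P Y (deriveAllD hm P Y (.cond b₂ (choice.nth 4) (choice.nth 3))
    (.cond (.beq b₂ b₁) (deriveOffD hm P Y (.cond b₁ st₁ st₀) s₁.left) (.cond b₂ st₁ st₀)))
    s₂.left).left

/-! ### Correctness of the protocol steps -/
variable {κ : ℕ}

/-- The randomness of a session as a tree. -/
def SessRand.encode (s : SessRand F κ) : Data :=
  .node s.tag.enc (.node s.ξ.enc (.node (encScalar s.ρ) (.node (encScalar s.u)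
    (.node (encScalar s.v) (encScalar s.e)))))

/-- A state as a tree, which is never `nil`. -/
def OffState.encode (st : OffState F κ) : Data := .node (encScalar st.1) st.2.enc

lemma nonceD_eq (A : F.G κ) (u v : F.Scalar κ) :
    nonceD F (F.par κ) (F.enc κ A) (encScalar u) (encScalar v) =
      encScalar (F.conv κ (F.base u + GroupFamily.mul v A)) := by simp [nonceD]

lemma simSD_eq (A : F.G κ) (u v : F.Scalar κ) :
    simSD F (F.par κ) (F.enc κ A) (encScalar u) (encScalar v) = encScalar (simS A u v) := by
  simp [simSD, nonceD_eq, simS]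

lemma simSigD_eq (A : F.G κ) (u v : F.Scalar κ) :
    simSigD F (F.par κ) (F.enc κ A) (encScalar u) (encScalar v) = simSig A u v := by
  simp only [simSigD, nonceD_eq, simSD_eq, cond_encScalar, simSig, encSig]
  split_ifs <;> simp_all

lemma simHashD_eq (A : F.G κ) (u v e : F.Scalar κ) :
    simHashD F (F.par κ) (F.enc κ A) (encScalar u) (encScalar v) (encScalar e) =
      encScalar (simHash A u v e) := by
  simp only [simHashD, nonceD_eq, simSD_eq, cond_encScalar, simHash, F.scalarMulD_eq]
  split_ifs <;> rfl

lemma destD_eq (Y : F.G κ) (x : F.Scalar κ) (s : SessRand F κ) :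
    destD F (F.par κ) (F.enc κ Y) (encScalar x) s.encode = F.enc κ (s.dest Y x) := by
  simp [destD, SessRand.dest, SessRand.encode]

lemma transcriptD_eq (A Y : F.G κ) (x : F.Scalar κ) (pay : Data) (s : SessRand F κ) :
    transcriptD F (F.par κ) (F.enc κ A) (F.enc κ Y) (encScalar x) pay s.encode =
      s.transcript A (s.dest Y x) pay := by
  rw [transcriptD, destD_eq]
  simp [SessRand.encode, simSigD_eq, SessRand.transcript, transcript]

lemma tableD_eq (A Y Z : F.G κ) (x : F.Scalar κ) (pay : Data) (s : SessRand F κ)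
    (T : Table (F.q κ)) :
    tableD F (F.par κ) (F.enc κ A) (F.enc κ Y) (F.enc κ Z) (encScalar x) pay s.encode
      (encTable T) = encTable (s.table A Y Z x pay T) := by
  rw [tableD, destD_eq]
  simp [SessRand.encode, simHashD_eq, SessRand.table, SessRand.msgEntry, SessRand.stealthEntry,
    encTable, Data.ofList]

lemma tagLenD_eq : tagLenD (F.par κ) = .unary (2 * κ) := by
  rw [tagLenD, F.poly_par_left]
  simp

lemma viewD_eq (A Y : F.G κ) (w : List (F.Scalar κ)) (coins : Data) :
    viewD F (F.par κ) (F.enc κ A) (F.enc κ Y) (encScalars w) coins = simView A Y w coins := by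
  simp [viewD, simView, encScalars, Data.toList_ofList, Function.comp_def]

lemma parseOffD_eq (w : List (F.Scalar κ)) (d : Data) :
    parseOffD F (F.par κ) (encScalars w) d =
      ((parseOff κ w d).map OffState.encode).getD .nil := by
  rw [parseOffD, Data.drop_eq, encScalars, Data.toList_ofList, ← List.map_drop, parseOff,
    ← List.head?_drop, tagLenD_eq, Data.pad_unary]
  cases w.drop (d.nth 0).len with
  | nil => simp [Data.ofList]
  | cons x l =>
    rw [Data.cond_of_ne (by simp [Data.ofList])]
    simp [Data.ofList, OffState.encode]

lemma Bits.dec_enc {n : ℕ} (x : Bits n) : Bits.dec n x.enc = x := by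
  funext i
  have hb : ∀ b, (Data.ofBool b).toBool = b := by intro b; cases b <;> rfl
  simp [Bits.dec, Data.nth, Bits.enc, Data.toList_ofList, hb]

lemma hmacD_eq (Y : F.G κ) (st : OffState F κ) (tag : Bits (2 * κ)) :
    hmacD hm (F.par κ) (F.enc κ Y) st.encode tag.enc =
      .node (Bits.enc (hm.fn κ (st.2, .node (F.enc κ (Y + F.base st.1)) tag.enc)).1)
        (Bits.enc (hm.fn κ (st.2, .node (F.enc κ (Y + F.base st.1)) tag.enc)).2) := by
  simp only [hmacD, OffState.encode, Data.left_node, Data.right_node, F.baseD_eq, F.addD_eq]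
  exact hm.eff.fn_eq κ (st.2, .node (F.enc κ (Y + F.base st.1)) tag.enc)

lemma deriveOffD_eq (Y : F.G κ) (st : OffState F κ) (tag : Bits (2 * κ)) :
    deriveOffD hm (F.par κ) (F.enc κ Y) st.encode tag.enc =
      OffState.encode (deriveOff hm Y st tag) := by
  rw [deriveOffD, hmacD_eq, tagLenD_eq, Data.pad_unary, F.lenD_eq]
  simp only [OffState.encode, Data.left_node, Data.right_node, F.reduceD_eq, F.scalarAddD_eq,
    Bits.dec_enc]
  rw [Data.trunc_encScalar _ _ (F.len_encScalar_le _)]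
  rfl

lemma deriveAllD_eq (Y : F.G κ) (tags : Data) (st : OffState F κ) :
    deriveAllD hm (F.par κ) (F.enc κ Y) tags st.encode =
      OffState.encode ((tags.toList.map (Bits.dec (2 * κ))).foldl (deriveOff hm Y) st) := by
  rw [deriveAllD]
  induction tags.toList generalizing st with
  | nil => rfl
  | cons d l ih =>
    rw [List.foldl_cons, tagLenD_eq, Data.pad_unary, deriveOffD_eq, ← tagLenD_eq (F := F), ih]
    rfl

lemma privOffsetD_eq (Y : F.G κ) (st₀ st₁ : OffState F κ) (b : Bool) (s : SessRand F κ) :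
    privOffsetD hm (F.par κ) (F.enc κ Y) st₀.encode st₁.encode (.ofBool b) s.encode =
      encScalar (privOffset hm Y st₀ st₁ b s.tag) := by
  rw [privOffsetD, Data.cond_ofBool, ← apply_ite OffState.encode, SessRand.encode, Data.left_node,
    deriveOffD_eq]
  rfl

lemma secondOffsetD_eq (Y : F.G κ) (st₀ st₁ : OffState F κ) (choice : Data) (b₁ b₂ : Bool)
    (s₁ s₂ : SessRand F κ) :
    secondOffsetD hm (F.par κ) (F.enc κ Y) st₀.encode st₁.encode choice (.ofBool b₁) (.ofBool b₂)
      s₁.encode s₂.encode =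
      encScalar (secondOffset hm Y st₀ st₁ choice b₁ b₂ s₁.tag s₂.tag) := by
  rw [secondOffsetD, Data.beq_ofBool]
  simp only [Data.cond_ofBool, ← apply_ite OffState.encode, SessRand.encode, Data.left_node,
    deriveOffD_eq, deriveAllD_eq, beq_iff_eq]
  rw [secondOffset, midTags]
  cases b₂ <;> rfl

/-! ### Running time of the protocol steps -/
variable {a b c d e f g h i j : Data → Data}

variable (F) in
@[fun_prop]
lemma polyTime_nonceD (ha : PolyTime a) (hb : PolyTime b) (hc : PolyTime c) (hd : PolyTime d) :
    PolyTime fun x => nonceD F (a x) (b x) (c x) (d x) := by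
  unfold nonceD; fun_prop

variable (F) in
@[fun_prop]
lemma polyTime_simSD (ha : PolyTime a) (hb : PolyTime b) (hc : PolyTime c) (hd : PolyTime d) :
    PolyTime fun x => simSD F (a x) (b x) (c x) (d x) := by
  unfold simSD; fun_prop

variable (F) in
@[fun_prop]
lemma polyTime_simSigD (ha : PolyTime a) (hb : PolyTime b) (hc : PolyTime c) (hd : PolyTime d) :
    PolyTime fun x => simSigD F (a x) (b x) (c x) (d x) := by
  unfold simSigD; fun_prop

variable (F) in
@[fun_prop]
lemma polyTime_simHashD (ha : PolyTime a) (hb : PolyTime b) (hc : PolyTime c) (hd : PolyTime d)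
    (he : PolyTime e) : PolyTime fun x => simHashD F (a x) (b x) (c x) (d x) (e x) := by
  unfold simHashD; fun_prop

variable (F) in
@[fun_prop]
lemma polyTime_destD (ha : PolyTime a) (hb : PolyTime b) (hc : PolyTime c) (hd : PolyTime d) :
    PolyTime fun x => destD F (a x) (b x) (c x) (d x) := by
  unfold destD; fun_prop

variable (F) in
@[fun_prop]
lemma polyTime_transcriptD (ha : PolyTime a) (hb : PolyTime b) (hc : PolyTime c) (hd : PolyTime d)
    (he : PolyTime e) (hf : PolyTime f) :
    PolyTime fun x => transcriptD F (a x) (b x) (c x) (d x) (e x) (f x) := by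
  simp only [transcriptD, Data.ofList]; fun_prop

variable (F) in
@[fun_prop]
lemma polyTime_tableD (ha : PolyTime a) (hb : PolyTime b) (hc : PolyTime c) (hd : PolyTime d)
    (he : PolyTime e) (hf : PolyTime f) (hg : PolyTime g) (hh : PolyTime h) :
    PolyTime fun x => tableD F (a x) (b x) (c x) (d x) (e x) (f x) (g x) (h x) := by
  simp only [tableD, msgKey, stealthKey]; fun_prop

@[fun_prop]
lemma polyTime_tagLenD (ha : PolyTime a) : PolyTime fun x => tagLenD (a x) := by
  unfold tagLenD; fun_prop

variable (F) in
@[fun_prop]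
lemma polyTime_viewD (ha : PolyTime a) (hb : PolyTime b) (hc : PolyTime c) (hd : PolyTime d)
    (he : PolyTime e) : PolyTime fun x => viewD F (a x) (b x) (c x) (d x) (e x) := by
  have := PolyTime.map (f := fun x y => F.addD (a x) (c x) (F.baseD (a x) y)) (l := d)
    (by fun_prop) (by fun_prop)
  simp only [viewD, Data.ofList]
  fun_prop

variable (F) in
@[fun_prop]
lemma polyTime_parseOffD (ha : PolyTime a) (hb : PolyTime b) (hc : PolyTime c) :
    PolyTime fun x => parseOffD F (a x) (b x) (c x) := by
  unfold parseOffD; fun_prop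

@[fun_prop]
lemma polyTime_hmacD (ha : PolyTime a) (hb : PolyTime b) (hc : PolyTime c) (hd : PolyTime d) :
    PolyTime fun x => hmacD hm (a x) (b x) (c x) (d x) := by
  unfold hmacD; fun_prop

@[fun_prop]
lemma polyTime_deriveOffD (ha : PolyTime a) (hb : PolyTime b) (hc : PolyTime c)
    (hd : PolyTime d) : PolyTime fun x => deriveOffD hm (a x) (b x) (c x) (d x) := by
  unfold deriveOffD; fun_prop

@[fun_prop]
lemma polyTime_deriveAllD (ha : PolyTime a) (hb : PolyTime b) (hc : PolyTime c)
    (hd : PolyTime d) : PolyTime fun x => deriveAllD hm (a x) (b x) (c x) (d x) := by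
  have h1 := PolyTime.polyBdd (f := fun x => F.lenD (a x)) (by fun_prop)
  have h2 := PolyTime.polyBdd (f := fun x => tagLenD (a x)) (by fun_prop)
  refine PolyTime.foldl
    (f := fun x tag st => deriveOffD hm (a x) (b x) st (.pad (tagLenD (a x)) tag)) (by fun_prop)
    hc hd (hd.polyBdd.add (((h1.mul (.const 4)).add (h2.mul (.const 4))).add (.const 3)))
    fun x l' _ => ?_
  rcases List.eq_nil_or_concat l' with rfl | ⟨l, tag, rfl⟩
  · simp only [List.foldl_nil]
    omega
  · rw [List.concat_eq_append, List.foldl_append, List.foldl_cons, List.foldl_nil, deriveOffD,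
      Data.size]
    refine (Nat.add_le_add_right (Nat.add_le_add (Data.size_trunc_le _ _)
      (Data.size_pad_le _ _)) 1).trans ?_
    have := Data.len_le_size (F.lenD (a x))
    have := Data.len_le_size (tagLenD (a x))
    omega

@[fun_prop]
lemma polyTime_privOffsetD (ha : PolyTime a) (hb : PolyTime b) (hc : PolyTime c)
    (hd : PolyTime d) (he : PolyTime e) (hf : PolyTime f) :
    PolyTime fun x => privOffsetD hm (a x) (b x) (c x) (d x) (e x) (f x) := by
  unfold privOffsetD; fun_prop

@[fun_prop]
lemma polyTime_secondOffsetD (ha : PolyTime a) (hb : PolyTime b) (hc : PolyTime c)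
    (hd : PolyTime d) (he : PolyTime e) (hf : PolyTime f) (hg : PolyTime g) (hh : PolyTime h)
    (hi : PolyTime i) :
    PolyTime fun x =>
      secondOffsetD hm (a x) (b x) (c x) (d x) (e x) (f x) (g x) (h x) (i x) := by
  unfold secondOffsetD; fun_prop

end Protocol

/-! ### The simulated games as programs -/

section Games

variable {F : GroupFamily} (hm : Hmac F) (𝒜 : Adversary)

/-- The first phase of the adversary; `r` is the randomness of the game. The result is its choice,
paired with the oracle table. -/
def choiceD (F : GroupFamily) (𝒜 : Adversary) (P A Y r : Data) : Data :=
  runD F 𝒜.choose P (viewD F P A Y r.left r.right.left) r.right.right.left .nil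

/-- The truth value of the guess of the adversary. -/
def guessD (F : GroupFamily) (𝒜 : Adversary) (P input h T : Data) : Data :=
  .norm (runD F 𝒜.guess P input h T).left

/-- Two parent states, each of which is `nil` if it is invalid. -/
def parentsD (F : GroupFamily) (P w choice : Data) : Data :=
  .node (parseOffD F P w (choice.nth 1)) (parseOffD F P w (choice.nth 2))

/-- The guess in the privacy experiment, from the first phase `ch` of the adversary and the key
offset `x` of the receiver. -/
def privGuessD (P A Y Z r h ch x : Data) : Data :=
  guessD F 𝒜 P (.ofList [viewD F P A Y r.left r.right.left, ch.left.nth 0,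
      transcriptD F P A Y x (ch.left.nth 3) r.right.right.right.right.right.left]) h
    (tableD F P A Y Z x (ch.left.nth 3) r.right.right.right.right.right.left ch.right)

/-- The privacy experiment after the choice of the two parent states. -/
def privBodyD (P A Y Z r h ch sts : Data) : Data :=
  .beq (.cond sts.left (.cond sts.right (privGuessD (F := F) 𝒜 P A Y Z r h ch
    (privOffsetD hm P Y sts.left sts.right r.right.right.right.left
      r.right.right.right.right.right.left)) .nil) .nil) r.right.right.right.left

/-- `simPriv` on trees. -/
def simPrivD (P A Y Z r h : Data) : Data :=
  privBodyD hm 𝒜 P A Y Z r h (choiceD F 𝒜 P A Y r)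
    (parentsD F P r.left (choiceD F 𝒜 P A Y r).left)

/-- The guess in the unlinkability experiment, from the first phase `ch` of the adversary and the
key offsets of the receivers of the two sessions. -/
def unlinkGuessD (P A Y Z r h ch x₁ x₂ : Data) : Data :=
  guessD F 𝒜 P (.ofList [viewD F P A Y r.left r.right.left, ch.left.nth 0,
      transcriptD F P A Y x₁ (ch.left.nth 5) r.right.right.right.right.right.left,
      transcriptD F P A Y x₂ (ch.left.nth 6) r.right.right.right.right.right.right]) h
    (tableD F P A Y Z x₂ (ch.left.nth 6) r.right.right.right.right.right.right
      (tableD F P A Y Z x₁ (ch.left.nth 5) r.right.right.right.right.right.left ch.right))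

/-- The unlinkability experiment after the choice of the two parent states. -/
def unlinkBodyD (P A Y Z r h ch sts : Data) : Data :=
  .beq (.cond sts.left (.cond sts.right (unlinkGuessD (F := F) 𝒜 P A Y Z r h ch
    (privOffsetD hm P Y sts.left sts.right r.right.right.right.left
      r.right.right.right.right.right.left)
    (secondOffsetD hm P Y sts.left sts.right ch.left r.right.right.right.left
      r.right.right.right.right.left r.right.right.right.right.right.left
      r.right.right.right.right.right.right)) .nil) .nil)
    (.beq r.right.right.right.left r.right.right.right.right.left)

/-- `simUnlink` on trees. -/
def simUnlinkD (P A Y Z r h : Data) : Data :=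
  unlinkBodyD hm 𝒜 P A Y Z r h (choiceD F 𝒜 P A Y r)
    (parentsD F P r.left (choiceD F 𝒜 P A Y r).left)

variable {κ c : ℕ}

/-- The randomness of an experiment as a tree. -/
def GameRand.encode (r : GameRand F κ c) : Data :=
  .node (encScalars r.w) (.node r.coins.enc (.node (encScalars r.h) (.node (.ofBool r.b₁)
    (.node (.ofBool r.b₂) (.node r.s₁.encode r.s₂.encode)))))

lemma choiceD_eq (A Y : F.G κ) (r : GameRand F κ c) :
    choiceD F 𝒜 (F.par κ) (F.enc κ A) (F.enc κ Y) r.encode =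
      .node (r.choice 𝒜 A Y).1 (encTable (r.choice 𝒜 A Y).2) := by
  simp only [choiceD, GameRand.encode, Data.left_node, Data.right_node, viewD_eq]
  exact runD_eq 𝒜.choose _ _ []

lemma guessD_eq (input : Data) (h : List (F.Scalar κ)) (T : Table (F.q κ)) :
    guessD F 𝒜 (F.par κ) input (encScalars h) (encTable T) = .ofBool (simGuess 𝒜 input h T) := by
  rw [guessD, runD_eq]
  rfl

lemma simPrivD_eq (A Y Z : F.G κ) (r : GameRand F κ c) (h : List (F.Scalar κ)) :
    simPrivD hm 𝒜 (F.par κ) (F.enc κ A) (F.enc κ Y) (F.enc κ Z) r.encode (encScalars h) =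
      .ofBool (simPriv hm 𝒜 A Y Z r h) := by
  have hfalse : Data.nil = .ofBool false := rfl
  rw [simPrivD, choiceD_eq, simPriv]
  generalize r.choice 𝒜 A Y = ch
  simp only [privBodyD, parentsD, GameRand.encode, Data.left_node, Data.right_node, parseOffD_eq]
  cases parseOff κ r.w (ch.1.nth 1) with
  | none => simp [hfalse, Data.beq_ofBool]
  | some st₀ =>
  cases parseOff κ r.w (ch.1.nth 2) with
  | none => simp [hfalse, Data.cond_self, Data.beq_ofBool]
  | some st₁ =>
  have hne : ∀ st : OffState F κ, st.encode ≠ .nil := fun st => by simp [OffState.encode]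
  simp only [Option.map_some, Option.getD_some, Data.cond_of_ne (hne _), privOffsetD_eq,
    privGuessD, Data.left_node, Data.right_node, transcriptD_eq, tableD_eq, viewD_eq, guessD_eq,
    Data.beq_ofBool]
  rfl

lemma simUnlinkD_eq (A Y Z : F.G κ) (r : GameRand F κ c) (h : List (F.Scalar κ)) :
    simUnlinkD hm 𝒜 (F.par κ) (F.enc κ A) (F.enc κ Y) (F.enc κ Z) r.encode (encScalars h) =
      .ofBool (simUnlink hm 𝒜 A Y Z r h) := by
  have hfalse : Data.nil = .ofBool false := rfl
  rw [simUnlinkD, choiceD_eq, simUnlink]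
  generalize r.choice 𝒜 A Y = ch
  simp only [unlinkBodyD, parentsD, GameRand.encode, Data.left_node, Data.right_node, parseOffD_eq]
  cases parseOff κ r.w (ch.1.nth 1) with
  | none => simp [hfalse, Data.beq_ofBool]
  | some st₀ =>
  cases parseOff κ r.w (ch.1.nth 2) with
  | none => simp [hfalse, Data.cond_self, Data.beq_ofBool]
  | some st₁ =>
  have hne : ∀ st : OffState F κ, st.encode ≠ .nil := fun st => by simp [OffState.encode]
  simp only [Option.map_some, Option.getD_some, Data.cond_of_ne (hne _), privOffsetD_eq,
    secondOffsetD_eq, unlinkGuessD, Data.left_node, Data.right_node, transcriptD_eq, tableD_eq,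
    viewD_eq, guessD_eq, Data.beq_ofBool]
  rfl

section PolyTime

variable {a b c d e f g h i : Data → Data}

@[fun_prop]
lemma polyTime_choiceD (ha : PolyTime a) (hb : PolyTime b) (hc : PolyTime c) (hd : PolyTime d) :
    PolyTime fun x => choiceD F 𝒜 (a x) (b x) (c x) (d x) := by
  unfold choiceD
  exact PolyTime.runD 𝒜.choose_poly (by fun_prop) (by fun_prop) (by fun_prop) (by fun_prop)

@[fun_prop]
lemma polyTime_guessD (ha : PolyTime a) (hb : PolyTime b) (hc : PolyTime c) (hd : PolyTime d) :
    PolyTime fun x => guessD F 𝒜 (a x) (b x) (c x) (d x) := by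
  unfold guessD
  have := PolyTime.runD (F := F) 𝒜.guess_poly ha hb hc hd
  fun_prop

@[fun_prop]
lemma polyTime_parentsD (ha : PolyTime a) (hb : PolyTime b) (hc : PolyTime c) :
    PolyTime fun x => parentsD F (a x) (b x) (c x) := by
  unfold parentsD; fun_prop

@[fun_prop]
lemma polyTime_privGuessD (ha : PolyTime a) (hb : PolyTime b) (hc : PolyTime c)
    (hd : PolyTime d) (he : PolyTime e) (hf : PolyTime f) (hg : PolyTime g) (hh : PolyTime h) :
    PolyTime fun x =>
      privGuessD (F := F) 𝒜 (a x) (b x) (c x) (d x) (e x) (f x) (g x) (h x) := by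
  simp only [privGuessD, Data.ofList]; fun_prop

@[fun_prop]
lemma polyTime_privBodyD (ha : PolyTime a) (hb : PolyTime b) (hc : PolyTime c)
    (hd : PolyTime d) (he : PolyTime e) (hf : PolyTime f) (hg : PolyTime g) (hh : PolyTime h) :
    PolyTime fun x =>
      privBodyD hm 𝒜 (a x) (b x) (c x) (d x) (e x) (f x) (g x) (h x) := by
  unfold privBodyD; fun_prop

@[fun_prop]
lemma polyTime_simPrivD (ha : PolyTime a) (hb : PolyTime b) (hc : PolyTime c)
    (hd : PolyTime d) (he : PolyTime e) (hf : PolyTime f) :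
    PolyTime fun x => simPrivD hm 𝒜 (a x) (b x) (c x) (d x) (e x) (f x) := by
  unfold simPrivD; fun_prop

@[fun_prop]
lemma polyTime_unlinkGuessD (ha : PolyTime a) (hb : PolyTime b) (hc : PolyTime c)
    (hd : PolyTime d) (he : PolyTime e) (hf : PolyTime f) (hg : PolyTime g) (hh : PolyTime h)
    (hi : PolyTime i) :
    PolyTime fun x =>
      unlinkGuessD (F := F) 𝒜 (a x) (b x) (c x) (d x) (e x) (f x) (g x) (h x) (i x) := by
  simp only [unlinkGuessD, Data.ofList]; fun_prop

@[fun_prop]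
lemma polyTime_unlinkBodyD (ha : PolyTime a) (hb : PolyTime b) (hc : PolyTime c)
    (hd : PolyTime d) (he : PolyTime e) (hf : PolyTime f) (hg : PolyTime g) (hh : PolyTime h) :
    PolyTime fun x =>
      unlinkBodyD hm 𝒜 (a x) (b x) (c x) (d x) (e x) (f x) (g x) (h x) := by
  unfold unlinkBodyD; fun_prop

@[fun_prop]
lemma polyTime_simUnlinkD (ha : PolyTime a) (hb : PolyTime b) (hc : PolyTime c)
    (hd : PolyTime d) (he : PolyTime e) (hf : PolyTime f) :
    PolyTime fun x => simUnlinkD hm 𝒜 (a x) (b x) (c x) (d x) (e x) (f x) := by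
  unfold simUnlinkD; fun_prop

end PolyTime

/-! ### The reduction -/

lemma sampleable_sessTuple (F : GroupFamily) :
    Sampleable F (α := SessTuple F) (fun _ x => (SessRand.ofTuple x).encode) (sessTuple F) := by
  have hbits : Sampleable F (α := fun κ => Bits (2 * κ)) (fun _ => Bits.enc) fun _ => unif _ :=
    .bits (.C 2 * .X) fun κ => by simp
  have hs := Sampleable.scalar (F := F)
  exact hbits.prod (hbits.prod (hs.prod (hs.prod (hs.prod hs))))

lemma sampleable_gameTuple (F : GroupFamily) (N c n : Polynomial ℕ) :
    Sampleable F (α := fun κ => GameTuple F κ (c.eval κ))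
      (fun _ x => (GameRand.ofTuple x).encode)
      fun κ => gameTuple F κ (N.eval κ) (c.eval κ) (n.eval κ) := by
  have hs := Sampleable.scalar (F := F)
  have hbits : Sampleable F (α := fun κ => Bits (c.eval κ)) (fun _ => Bits.enc) fun _ => unif _ :=
    .bits c fun _ => rfl
  exact (hs.list N).prod (hbits.prod ((hs.list n).prod (Sampleable.bool.prod
    (Sampleable.bool.prod ((sampleable_sessTuple F).prod (sampleable_sessTuple F))))))

/-- A simulated game that a program computes from its randomness is, up to an exponentially small
error, played by a distinguisher for Diffie-Hellman triples. -/
lemma exists_distinguisher (F : GroupFamily) (N c n : Polynomial ℕ)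
    {sim : ∀ κ, F.G κ → F.G κ → F.G κ → GameRand F κ (c.eval κ) → List (F.Scalar κ) → Bool}
    {simD : Data → Data → Data → Data → Data → Data → Data}
    (hD : PolyTime fun x => simD (x.nth 0) (x.nth 1) (x.nth 2) (x.nth 3) (x.nth 4) (x.nth 5))
    (hsim : ∀ κ A Y Z r h, simD (F.par κ) (F.enc κ A) (F.enc κ Y) (F.enc κ Z) r.encode
      (encScalars h) = .ofBool (sim κ A Y Z r h)) :
    ∃ (𝒟 : Distinguisher) (P : Polynomial ℕ), ∀ κ A Y Z,
      Within ((P.eval κ : ℕ) / 2 ^ κ)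
        (simValue F κ (N.eval κ) (c.eval κ) (n.eval κ) (sim κ A Y Z))
        (expect (𝒟.run F κ A Y Z) ind) := by
  obtain ⟨m, P, S, hS, hP⟩ :=
    (sampleable_gameTuple F N c n).prod (Sampleable.scalar.list n)
  have key : PolyTime fun x => simD (x.nth 0) (x.nth 1) (x.nth 2) (x.nth 3)
      (S (.node (x.nth 0) (x.nth 4))).left (S (.node (x.nth 0) (x.nth 4))).right := by
    have := PolyTime.comp hD (show PolyTime fun x => .ofList [x.nth 0, x.nth 1, x.nth 2, x.nth 3,
      (S (.node (x.nth 0) (x.nth 4))).left, (S (.node (x.nth 0) (x.nth 4))).right] by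
        simp only [Data.ofList]; fun_prop)
    simpa [Data.nth, Data.toList_ofList] using this
  obtain ⟨p, hp, hpe⟩ := key
  refine ⟨⟨p, m, hp⟩, P, fun κ A Y Z => ?_⟩
  have h1 := hP κ (fun d => ind (simD (F.par κ) (F.enc κ A) (F.enc κ Y) (F.enc κ Z) d.left
    d.right).toBool) fun _ => ind_le_one _
  have htoBool : ∀ b, (Data.ofBool b).toBool = b := by intro b; cases b <;> rfl
  have h2 : ∀ r h, ind (simD (F.par κ) (F.enc κ A) (F.enc κ Y) (F.enc κ Z)
      (GameRand.ofTuple r).encode (.ofList (h.map encScalar))).toBool =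
      ind (sim κ A Y Z (.ofTuple r) h) := fun r h => by
    rw [← htoBool (sim _ _ _ _ _ _), ← hsim]
    rfl
  rw [expect_prodPMF] at h1
  simp only [Data.left_node, Data.right_node, h2] at h1
  unfold simValue gameRand
  rw [expect_map]
  refine h1.trans (ε := _) (δ := 0) (.of_eq ?_) |>.mono (by rw [add_zero])
  unfold Distinguisher.run
  rw [← expect_unif_fin]
  simp only [expect_bind, expect_pure, hpe]
  rfl

end Games

/-! ### Negligible functions -/

namespace Negligible

variable {f g : ℕ → ℝ}

lemma of_le (hg : Negligible g) (hf : ∀ κ, 0 ≤ f κ) (h : ∀ κ, f κ ≤ g κ) : Negligible f :=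
  Asymptotics.SuperpolynomialDecay.trans_abs_le hg fun κ => by
    rw [abs_of_nonneg (hf κ), abs_of_nonneg ((hf κ).trans (h κ))]
    exact h κ

lemma poly_mul (hf : Negligible f) (P : Polynomial ℕ) :
    Negligible fun κ => (P.eval κ : ℕ) * f κ := by
  refine (Asymptotics.SuperpolynomialDecay.polynomial_mul hf
    (P.map (Nat.castRingHom ℝ))).congr fun κ => ?_
  simp [Polynomial.eval_natCast_map]

lemma two_inv_pow : Negligible fun κ => (2 ^ κ : ℝ)⁻¹ := fun n => by
  simpa using tendsto_pow_const_mul_const_pow_of_lt_one n (r := 2⁻¹) (by norm_num) (by norm_num)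

end Negligible

lemma expect_unif_ind_eq {α : Type} [Fintype α] [Nonempty α] [DecidableEq α] (a : α) :
    (expect (unif α) fun x => ind (decide (x = a))) = (Fintype.card α : ℝ≥0∞)⁻¹ := by
  simp [expect_unif, ind]

lemma expect_ddhReal (F : GroupFamily) (𝒟 : Distinguisher) (κ : ℕ) (f : Bool → ℝ≥0∞) :
    expect (ddhReal F 𝒟 κ) f = expect (unif (F.Scalar κ)) fun x => expect (unif (F.Scalar κ))
      fun y => expect (𝒟.run F κ (F.base x) (F.base y) (F.base (x * y))) f := by
  simp only [ddhReal, expect_bind]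

lemma expect_ddhRandom (F : GroupFamily) (𝒟 : Distinguisher) (κ : ℕ) (f : Bool → ℝ≥0∞) :
    expect (ddhRandom F 𝒟 κ) f = expect (unif (F.Scalar κ)) fun x => expect (unif (F.Scalar κ))
      fun y => expect (unif (F.Scalar κ)) fun z =>
        expect (𝒟.run F κ (F.base x) (F.base y) (F.base z)) f := by
  simp only [ddhRandom, expect_bind]

/-- The distinguisher that accepts `(0, Y, 0)` has advantage `1 / q - 1 / q ^ 2`, so the group is
large. -/
lemma DDH.negligible_inv_q {F : GroupFamily} (h : DDH F) :
    Negligible fun κ => (F.q κ : ℝ)⁻¹ := by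
  have hD : PolyTime fun x => .cond (.beq (x.nth 1) (F.baseD (x.nth 0) .nil))
      (.beq (x.nth 3) (F.baseD (x.nth 0) .nil)) .nil := by fun_prop
  obtain ⟨p, hp, hpe⟩ := hD
  have hrun : ∀ κ (x y z : F.Scalar κ), expect (Distinguisher.run ⟨p, 0, hp⟩ F κ (F.base x)
      (F.base y) (F.base z)) ind = ind (decide (x = 0)) * ind (decide (z = 0)) := by
    intro κ x y z
    have h0 : F.baseD (F.par κ) .nil = F.enc κ (F.base 0) := by
      rw [← F.baseD_eq, (encScalar_eq_nil_iff (0 : F.Scalar κ)).2 rfl]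
    have hiff : ∀ x : F.Scalar κ, F.enc κ (F.base x) = F.enc κ (F.base 0) ↔ x = 0 := fun x =>
      ((F.enc_injective κ).comp GroupFamily.base_injective).eq_iff (b := 0)
    simp only [Distinguisher.run, expect_bind, expect_pure, hpe]
    have e0 : ∀ a b c d e : Data, (Data.ofList [a, b, c, d, e]).nth 0 = a := fun _ _ _ _ _ => rfl
    have e1 : ∀ a b c d e : Data, (Data.ofList [a, b, c, d, e]).nth 1 = b := fun _ _ _ _ _ => rfl
    have e3 : ∀ a b c d e : Data, (Data.ofList [a, b, c, d, e]).nth 3 = d := fun _ _ _ _ _ => rfl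
    simp only [e0, e1, e3, h0, expect_const, Data.beq, Data.cond_ofBool, hiff]
    by_cases hx : x = 0 <;> by_cases hz : z = 0 <;> simp [hx, hz, ind, Data.toBool, Data.ofBool]
  have hreal : ∀ κ, prTrue (ddhReal F ⟨p, 0, hp⟩ κ) = (F.q κ : ℝ)⁻¹ := by
    intro κ
    have e : ∀ x y : F.Scalar κ, ind (decide (x = 0)) * ind (decide (x * y = 0)) =
        ind (decide (x = 0)) := by
      intro x y
      by_cases hx : x = 0 <;> simp [hx, ind]
    rw [prTrue_eq_expect, expect_ddhReal]
    simp only [hrun, e, expect_const]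
    rw [expect_unif_ind_eq, ZMod.card]
    simp
  have hrandom : ∀ κ, prTrue (ddhRandom F ⟨p, 0, hp⟩ κ) = (F.q κ : ℝ)⁻¹ * (F.q κ : ℝ)⁻¹ := by
    intro κ
    have e : ∀ x : F.Scalar κ, (expect (unif (F.Scalar κ)) fun z =>
        ind (decide (x = 0)) * ind (decide (z = 0))) =
        ind (decide (x = 0)) * (F.q κ : ℝ≥0∞)⁻¹ := by
      intro x
      by_cases hx : x = 0
      · have := expect_unif_ind_eq (0 : F.Scalar κ)
        rw [ZMod.card] at this
        simp only [hx, decide_true, show ind true = 1 from rfl, one_mul, this]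
      · simp only [hx, decide_false, show ind false = 0 from rfl, zero_mul, expect_const]
    have e' : (expect (unif (F.Scalar κ)) fun x => ind (decide (x = 0)) * (F.q κ : ℝ≥0∞)⁻¹) =
        (F.q κ : ℝ≥0∞)⁻¹ * (F.q κ : ℝ≥0∞)⁻¹ := by
      have := expect_unif_ind_eq (0 : F.Scalar κ)
      rw [ZMod.card] at this
      simp only [expect] at this ⊢
      simp only [← mul_assoc, ENNReal.tsum_mul_right, this]
    rw [prTrue_eq_expect, expect_ddhRandom]
    simp only [hrun, e, e', expect_const]
    simp
  have key := (h ⟨p, 0, hp⟩).poly_mul (.C 2)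
  refine key.of_le (fun κ => by positivity) fun κ => ?_
  have hq : (2 : ℝ) ≤ F.q κ := by exact_mod_cast (F.prime κ).two_le
  have hq' : (F.q κ : ℝ)⁻¹ ≤ 2⁻¹ := inv_anti₀ (by norm_num) hq
  have hpos : 0 < (F.q κ : ℝ)⁻¹ := by positivity
  simp only [hreal, hrandom, Polynomial.eval_C, Nat.cast_ofNat]
  refine le_trans ?_ (mul_le_mul_of_nonneg_left (le_abs_self _) (by norm_num))
  nlinarith

lemma natCast_div_eq_ofReal (n m : ℕ) (hm : 0 < m) :
    (n : ℝ≥0∞) / m = ENNReal.ofReal (n * (m : ℝ)⁻¹) := by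
  rw [← div_eq_mul_inv, ENNReal.ofReal_div_of_pos (by exact_mod_cast hm), ENNReal.ofReal_natCast,
    ENNReal.ofReal_natCast]

/-! ### Privacy and unlinkability under DDH -/

/-- A game is won with probability about `1 / 2` if it is close to a simulation on Diffie-Hellman
triples that a distinguisher can play and that is won with probability about `1 / 2` on random
triples. -/
lemma DDH.negligible_advantage {F : GroupFamily} (h : DDH F) (p : ℕ → PMF Bool)
    (V : ∀ κ, F.G κ → F.G κ → F.G κ → ℝ≥0∞) (R : Polynomial ℕ)
    (hreal : ∀ κ, Within ((R.eval κ : ℕ) / F.q κ + (R.eval κ : ℕ) / 2 ^ κ) (expect (p κ) ind)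
      (expect (unif (F.Scalar κ)) fun a => expect (unif (F.Scalar κ)) fun y =>
        V κ (F.base a) (F.base y) (F.base (a * y))))
    (hV : ∃ (𝒟 : Distinguisher) (P : Polynomial ℕ), ∀ κ A Y Z,
      Within ((P.eval κ : ℕ) / 2 ^ κ) (V κ A Y Z) (expect (𝒟.run F κ A Y Z) ind))
    (hrandom : ∀ κ (a y : F.Scalar κ), Within ((R.eval κ : ℕ) / F.q κ)
      (expect (unif (F.Scalar κ)) fun z => V κ (F.base a) (F.base y) (F.base z)) 2⁻¹) :
    Negligible fun κ => |prTrue (p κ) - 1 / 2| := by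
  obtain ⟨𝒟, P, hP⟩ := hV
  have hfin : ∀ p : PMF Bool, expect p ind ≠ ∞ := fun p =>
    ((expect_le_one ind_le_one).trans_lt ENNReal.one_lt_top).ne
  have hnegl : Negligible fun κ =>
      ((R.eval κ : ℕ) * (F.q κ : ℝ)⁻¹ + (R.eval κ : ℕ) * (2 ^ κ : ℝ)⁻¹) +
      ((P.eval κ : ℕ) * (2 ^ κ : ℝ)⁻¹ + (|prTrue (ddhReal F 𝒟 κ) - prTrue (ddhRandom F 𝒟 κ)| +
      ((P.eval κ : ℕ) * (2 ^ κ : ℝ)⁻¹ + (R.eval κ : ℕ) * (F.q κ : ℝ)⁻¹))) := by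
    have hq := h.negligible_inv_q.poly_mul R
    have h1 := Negligible.two_inv_pow.poly_mul R
    have h2 := Negligible.two_inv_pow.poly_mul P
    exact (hq.add h1).add (h2.add ((h 𝒟).add (h2.add hq)))
  refine hnegl.of_le (fun _ => abs_nonneg _) fun κ => ?_
  have hpow : ∀ n : ℕ, (n : ℝ≥0∞) / 2 ^ κ = ENNReal.ofReal (n * (2 ^ κ : ℝ)⁻¹) := fun n => by
    have := natCast_div_eq_ofReal n (2 ^ κ) (by positivity)
    push_cast at this
    exact this
  have hdiv : ∀ n : ℕ, (n : ℝ≥0∞) / F.q κ = ENNReal.ofReal (n * (F.q κ : ℝ)⁻¹) := fun n =>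
    natCast_div_eq_ofReal n _ (F.prime κ).pos
  have hddh : Within (ENNReal.ofReal |prTrue (ddhReal F 𝒟 κ) - prTrue (ddhRandom F 𝒟 κ)|)
      (expect (ddhReal F 𝒟 κ) ind) (expect (ddhRandom F 𝒟 κ) ind) :=
    within_of_abs_toReal_sub_le (hfin _) (hfin _) (by rw [← prTrue_eq_expect, ← prTrue_eq_expect])
  rw [expect_ddhReal, expect_ddhRandom] at hddh
  have hhalf := Within.expect_const (p := unif (F.Scalar κ)) fun a =>
    Within.expect_const (p := unif (F.Scalar κ)) fun y => hrandom κ a y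
  rw [expect_const, expect_const] at hhalf
  have total := (hreal κ).trans ((Within.expect_const fun a => Within.expect_const fun y =>
    hP κ _ _ _).trans (hddh.trans ((Within.expect_const fun a => Within.expect_const fun y =>
    Within.expect_const fun z => (hP κ _ _ _).symm).trans hhalf)))
  rw [hpow, hpow, hdiv, ← ENNReal.ofReal_add (by positivity) (by positivity),
    ← ENNReal.ofReal_add (by positivity) (by positivity),
    ← ENNReal.ofReal_add (by positivity) (by positivity),
    ← ENNReal.ofReal_add (by positivity) (by positivity),
    ← ENNReal.ofReal_add (by positivity) (by positivity)] at total
  have := total.abs_toReal_sub_le (by positivity) (hfin _) (by simp)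
  rwa [← prTrue_eq_expect, ENNReal.toReal_inv, ENNReal.toReal_ofNat, ← one_div] at this

lemma sessError_le (F : GroupFamily) (κ n : ℕ) :
    sessError F κ n ≤ (n + 2 : ℕ) / F.q κ + (n + 2 : ℕ) / 2 ^ κ := by
  rw [sessError, ← ENNReal.add_div, add_comm]
  push_cast
  gcongr
  · exact le_self_add
  · norm_num
  · omega

lemma negligible_privExp {F : GroupFamily} (hDDH : DDH F) (hm : Hmac F) {dao : SenderDAO F}
    (N : Polynomial ℕ) (Q : Quorum dao) (𝒜 : Adversary) :
    Negligible fun κ => |prTrue (privExp hm Q N 𝒜 κ) - 1 / 2| := by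
  refine hDDH.negligible_advantage _ (fun κ A Y Z => simValue F κ (N.eval κ) (𝒜.coinLen.eval κ)
    (𝒜.queries.eval κ) (simPriv hm 𝒜 A Y Z)) (𝒜.queries + .C 2)
    (fun κ => (within_privExp hm Q N 𝒜 κ).mono ?_)
    (exists_distinguisher F N _ _ (by fun_prop) fun κ A Y Z r h => simPrivD_eq hm 𝒜 A Y Z r h)
    fun κ a y => (within_simPriv_random hm 𝒜 _ _ _ a y).mono ?_
  · rw [Polynomial.eval_add, Polynomial.eval_C]
    exact sessError_le _ _ _
  · rw [Polynomial.eval_add, Polynomial.eval_C]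
    gcongr
    omega

/-- The second session starts with a table that the first one has made longer by two entries, and
each session hides one shared secret; hence the larger polynomial than in `negligible_privExp`. -/
lemma negligible_unlinkExp {F : GroupFamily} (hDDH : DDH F) (hm : Hmac F) {dao : SenderDAO F}
    (N : Polynomial ℕ) (Q₁ Q₂ : Quorum dao) (𝒜 : Adversary) :
    Negligible fun κ => |prTrue (unlinkExp hm Q₁ Q₂ N 𝒜 κ) - 1 / 2| := by
  refine hDDH.negligible_advantage _ (fun κ A Y Z => simValue F κ (N.eval κ) (𝒜.coinLen.eval κ)
    (𝒜.queries.eval κ) (simUnlink hm 𝒜 A Y Z)) (.C 2 * 𝒜.queries + .C 6)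
    (fun κ => (within_unlinkExp hm Q₁ Q₂ N 𝒜 κ).mono ?_)
    (exists_distinguisher F N _ _ (by fun_prop) fun κ A Y Z r h => simUnlinkD_eq hm 𝒜 A Y Z r h)
    fun κ a y => (within_simUnlink_random hm 𝒜 _ _ _ a y).mono ?_
  · rw [Polynomial.eval_add, Polynomial.eval_mul, Polynomial.eval_C, Polynomial.eval_C]
    refine (add_le_add (sessError_le _ _ _) (sessError_le _ _ _)).trans_eq ?_
    rw [add_add_add_comm, ← ENNReal.add_div, ← ENNReal.add_div, ← Nat.cast_add]
    congr 3 <;> ring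
  · rw [Polynomial.eval_add, Polynomial.eval_mul, Polynomial.eval_C, Polynomial.eval_C]
    gcongr
    omega

end

end Dao2

theorem mainTheorem3 (F : Dao2.GroupFamily) (hDDH : Dao2.DDH F) (hm : Dao2.Hmac F)
    (dao : Dao2.SenderDAO F) (N : Polynomial ℕ) :
    (∀ (Q : Dao2.Quorum dao) (𝒜 : Dao2.Adversary),
      Dao2.Negligible fun κ => |Dao2.prTrue (Dao2.privExp hm Q N 𝒜 κ) - 1 / 2|) ∧
    (∀ (Q₁ Q₂ : Dao2.Quorum dao) (𝒜 : Dao2.Adversary),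
      Dao2.Negligible fun κ => |Dao2.prTrue (Dao2.unlinkExp hm Q₁ Q₂ N 𝒜 κ) - 1 / 2|) :=
  ⟨fun Q 𝒜 => Dao2.negligible_privExp hDDH hm N Q 𝒜,
    fun Q₁ Q₂ 𝒜 => Dao2.negligible_unlinkExp hDDH hm N Q₁ Q₂ 𝒜⟩
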